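/- Fix integers $m,n\ge 1$ and $r,s\ge 0$ with $(s,m,n)\neq(0,1,1)$. Let $V$ be the set of pairs $(\mu,\nu)$ of tuples of positive integers $\mu=(\mu_1,\dots,\mu_m)$, $\nu=(\nu_1,\dots,\nu_n)$ with $\sum_i\mu_i=\sum_j\nu_j$. For $(\mu,\nu)\in V$ with $d=\sum_i\mu_i$, the (disconnected) double Hurwitz number with $s$ completed $(r+1)$-cycles is $$h^{s}_{\mu,\nu}=\frac{1}{\prod_{i=1}^m\mu_i\prod_{j=1}^n\nu_j}\sum_{|\lambda|=d}\chi^\lambda_\mu\left(\frac{p_{r+1}(\lambda)}{(r+1)!}\right)^{s}\chi^\lambda_\nu ,\qquad p_k(\lambda)=\sum_{i\ge 1}\left(\left(\lambda_i-i+\tfrac12\right)^k-\left(-i+\tfrac12\right)^k\right),$$ where the sum is over the partitions $\lambda$ of $d$, and $\chi^\lambda_\mu$ is the value of the irreducible character of $S_d$ attached to $\lambda$ on the permutations of cycle type $\mu$. Let $V_{\mathbb R}$ be the cone of pairs $(x,y)\in\mathbb R_{\ge0}^m\times\mathbb R_{\ge0}^n$ with $\sum_i x_i=\sum_j y_j$.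 For non-empty proper subsets $I\subset\{1,\dots,m\}$ and $J\subset\{1,\dots,n\}$ let $W_{I,J}\subset V_{\mathbb R}$ be the wall given by $\sum_{i\in I}x_i=\sum_{j\in J}y_j$. Call the connected components of the complement in $V_{\mathbb R}$ of all the walls $W_{I,J}$ chambers. Then the function $h^s\colon V\to\mathbb Q$, $(\mu,\nu)\mapsto h^s_{\mu,\nu}$, is piecewise polynomial with walls the $W_{I,J}$: for every chamber $\mathfrak c$ there is a polynomial $P_{\mathfrak c}\in\mathbb Q[x_1,\dots,x_m,y_1,\dots,y_n]$ such that $h^s_{\mu,\nu}=P_{\mathfrak c}(\mu,\nu)$ for all $(\mu,\nu)\in V\cap\mathfrak c$. -/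

import Mathlib

open scoped BigOperators

noncomputable section

namespace CompletedHurwitz

/-! ### Characters of the symmetric group -/

/-- The parts `λ₁ ≥ λ₂ ≥ ⋯ > 0` of a partition in weakly decreasing order. -/
def rows {d : ℕ} (lam : d.Partition) : List ℕ := lam.parts.sort (· ≥ ·)

theorem rows_sortedGE {d : ℕ} (lam : d.Partition) : (rows lam).SortedGE :=
  (Multiset.pairwise_sort lam.parts (· ≥ ·)).sortedGE

/-- The Young diagram of a partition (row `i` has `λ_{i+1}` cells). -/
def diagram {d : ℕ} (lam : d.Partition) : YoungDiagram :=
  YoungDiagram.ofRowLens (rows lam) (rows_sortedGE lam)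

theorem card_cellsOfRowLens (w : List ℕ) :
    (YoungDiagram.cellsOfRowLens w).card = w.sum := by
  induction w with
  | nil => simp [YoungDiagram.cellsOfRowLens]
  | cons a w ih =>
    rw [YoungDiagram.cellsOfRowLens, Finset.card_union_of_disjoint]
    · simp [ih]
    · rw [Finset.disjoint_left]
      rintro ⟨i, j⟩ h1 h2
      simp only [Finset.mem_product, Finset.mem_singleton] at h1
      simp only [Finset.mem_map, Prod.exists] at h2
      obtain ⟨a', b', _, h⟩ := h2
      have := congrArg Prod.fst h
      simp at this
      omega

theorem card_diagram {d : ℕ} (lam : d.Partition) : (diagram lam).cells.card = d := by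
  have h : ((rows lam : List ℕ) : Multiset ℕ) = lam.parts := Multiset.sort_eq _ _
  have h2 : (rows lam).sum = lam.parts.sum := by rw [← h, Multiset.sum_coe]
  rw [diagram, YoungDiagram.ofRowLens, card_cellsOfRowLens, h2, lam.parts_sum]

/-- A Young tableau of shape `lam`: a bijective filling of the cells by `Fin d`. Which one is
chosen does not matter; a different choice replaces the Young symmetrizer by a conjugate. -/
def tableau {d : ℕ} (lam : d.Partition) : Fin d ≃ (diagram lam).cells :=
  ((diagram lam).cells.equivFinOfCardEq (card_diagram lam)).symm

/-- The row in which the entry `k` stands. -/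
def rowOf {d : ℕ} (lam : d.Partition) (k : Fin d) : ℕ := (tableau lam k).1.1

/-- The column in which the entry `k` stands. -/
def colOf {d : ℕ} (lam : d.Partition) (k : Fin d) : ℕ := (tableau lam k).1.2

open Classical in
/-- The sum of all permutations preserving every row of the tableau. -/
def rowSymmetrizer {d : ℕ} (lam : d.Partition) : MonoidAlgebra ℚ (Equiv.Perm (Fin d)) :=
  ∑ p : Equiv.Perm (Fin d) with ∀ k, rowOf lam (p k) = rowOf lam k,
    MonoidAlgebra.of ℚ (Equiv.Perm (Fin d)) p

open Classical in
/-- The signed sum of all permutations preserving every column of the tableau. -/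
def colAntisymmetrizer {d : ℕ} (lam : d.Partition) : MonoidAlgebra ℚ (Equiv.Perm (Fin d)) :=
  ∑ q : Equiv.Perm (Fin d) with ∀ k, colOf lam (q k) = colOf lam k,
    ((Equiv.Perm.sign q : ℤ) : ℚ) • MonoidAlgebra.of ℚ (Equiv.Perm (Fin d)) q

/-- The Young symmetrizer. -/
def youngSymmetrizer {d : ℕ} (lam : d.Partition) : MonoidAlgebra ℚ (Equiv.Perm (Fin d)) :=
  rowSymmetrizer lam * colAntisymmetrizer lam

/-- The irreducible module attached to `lam`: the left ideal of `ℚ[S_d]` generated by the Young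
symmetrizer (Specht module). -/
abbrev Specht {d : ℕ} (lam : d.Partition) :
    Submodule (MonoidAlgebra ℚ (Equiv.Perm (Fin d))) (MonoidAlgebra ℚ (Equiv.Perm (Fin d))) :=
  Submodule.span _ {youngSymmetrizer lam}

/-- The irreducible representation of `S_d` attached to `lam`: left multiplication on the
Specht module. -/
def spechtRep {d : ℕ} (lam : d.Partition) :
    Representation ℚ (Equiv.Perm (Fin d)) (Specht lam) :=
  (Algebra.lsmul ℚ ℚ (Specht lam)).toMonoidHom.comp
    (MonoidAlgebra.of ℚ (Equiv.Perm (Fin d)))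

theorem exists_perm_of_partition {d : ℕ} (mu : d.Partition) :
    ∃ σ : Equiv.Perm (Fin d), σ.partition.parts = mu.parts := by
  obtain ⟨σ, hσ⟩ := (Equiv.Perm.exists_with_cycleType_iff (Fin d)
    (m := mu.parts.filter fun n => 2 ≤ n)).mpr
    ⟨by
      rw [Fintype.card_fin]
      conv_rhs => rw [← mu.parts_sum, ← Multiset.filter_add_not (fun n => 2 ≤ n) mu.parts,
        Multiset.sum_add]
      exact Nat.le_add_right _ _, fun a ha => (Multiset.mem_filter.mp ha).2⟩
  refine ⟨σ, ?_⟩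
  have hone : mu.parts.filter (fun n => ¬ 2 ≤ n) =
      Multiset.replicate (mu.parts.filter (fun n => ¬ 2 ≤ n)).card 1 := by
    rw [Multiset.eq_replicate]
    refine ⟨rfl, fun b hb => ?_⟩
    have h1 := (Multiset.mem_filter.mp hb).2
    have h2 := mu.parts_pos (Multiset.mem_filter.mp hb).1
    omega
  have hsum : (mu.parts.filter fun n => 2 ≤ n).sum +
      (mu.parts.filter (fun n => ¬ 2 ≤ n)).card = d := by
    conv_rhs => rw [← mu.parts_sum, ← Multiset.filter_add_not (fun n => 2 ≤ n) mu.parts,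
      Multiset.sum_add, hone]
    simp
  rw [Equiv.Perm.parts_partition, ← Equiv.Perm.sum_cycleType, hσ, Fintype.card_fin]
  conv_rhs => rw [← Multiset.filter_add_not (fun n => 2 ≤ n) mu.parts, hone]
  congr 2
  omega

/-- A permutation of cycle type `mu` (unique up to conjugation). -/
def permOfPartition {d : ℕ} (mu : d.Partition) : Equiv.Perm (Fin d) :=
  (exists_perm_of_partition mu).choose

/-- `χ^λ_μ`: the character of the irreducible representation attached to `lam`, evaluated on the
conjugacy class given by `mu`. -/
def chi {d : ℕ} (lam mu : d.Partition) : ℚ :=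
  (spechtRep lam).character (permOfPartition mu)

/-! ### Double Hurwitz numbers with completed cycles -/

/-- The shifted symmetric power sum
`p_k(λ) = ∑_{i ≥ 1} ((λ_i - i + 1/2)^k - (-i + 1/2)^k)`; the terms with `i > ℓ(λ)` vanish.
The index `i` of the code starts at `0`. -/
def shiftedPowerSum (k : ℕ) {d : ℕ} (lam : d.Partition) : ℚ :=
  ∑ i : Fin (rows lam).length,
    ((((rows lam)[i] : ℚ) - ((i : ℕ) + 1 : ℚ) + 1 / 2) ^ k
      - (-((i : ℕ) + 1 : ℚ) + 1 / 2) ^ k)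

/-- The set `V` of pairs `(μ, ν)` of tuples of positive integers, of lengths `m` and `n`, with
`|μ| = |ν|`. -/
def V (m n : ℕ) : Set ((Fin m → ℕ) × (Fin n → ℕ)) :=
  {p | (∀ i, 0 < p.1 i) ∧ (∀ j, 0 < p.2 j) ∧ ∑ i, p.1 i = ∑ j, p.2 j}

/-- The partition of `d` whose parts are the (positive) entries of a tuple with sum `d`. -/
def tuplePartition {l : ℕ} (x : Fin l → ℕ) (d : ℕ) (h : ∑ i, x i = d) : d.Partition :=
  Nat.Partition.ofSums d (Finset.univ.val.map x) h

/-- The (disconnected) double Hurwitz number `h^{(r),s}_{μ,ν}` with `s` completed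
`(r+1)`-cycles, as a function on `V`. -/
def hurwitz (r s : ℕ) {m n : ℕ} (p : V m n) : ℚ :=
  (1 / ((∏ i, (p.1.1 i : ℚ)) * ∏ j, (p.1.2 j : ℚ))) *
    ∑ lam : (∑ i, p.1.1 i).Partition,
      chi lam (tuplePartition p.1.1 _ rfl) *
        (shiftedPowerSum (r + 1) lam / ((r + 1).factorial : ℚ)) ^ s *
        chi lam (tuplePartition p.1.2 _ p.2.2.2.symm)

/-! ### Walls, chambers, piecewise polynomial functions -/

/-- The real version of `V`: the cone of pairs of non-negative real tuples with equal sums. -/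
def realV (m n : ℕ) : Set ((Fin m → ℝ) × (Fin n → ℝ)) :=
  {q | (∀ i, 0 ≤ q.1 i) ∧ (∀ j, 0 ≤ q.2 j) ∧ ∑ i, q.1 i = ∑ j, q.2 j}

/-- The wall `W_{I,J}`, given by `x_I - y_J = 0`. -/
def wall {m n : ℕ} (I : Finset (Fin m)) (J : Finset (Fin n)) :
    Set ((Fin m → ℝ) × (Fin n → ℝ)) :=
  {q | q ∈ realV m n ∧ ∑ i ∈ I, q.1 i - ∑ j ∈ J, q.2 j = 0}

/-- The complement of all walls `W_{I,J}`, for non-empty proper subsets `I` and `J`. -/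
def wallComplement (m n : ℕ) : Set ((Fin m → ℝ) × (Fin n → ℝ)) :=
  {q | q ∈ realV m n ∧ ∀ (I : Finset (Fin m)) (J : Finset (Fin n)),
    I.Nonempty → I ≠ Finset.univ → J.Nonempty → J ≠ Finset.univ → q ∉ wall I J}

/-- The chambers: the connected components of the complement of the walls. -/
def IsChamber {m n : ℕ} (c : Set ((Fin m → ℝ) × (Fin n → ℝ))) : Prop :=
  ∃ q ∈ wallComplement m n, c = connectedComponentIn (wallComplement m n) q

/-- A point of `V`, viewed as a real point. -/
def toReal {m n : ℕ} (p : V m n) : (Fin m → ℝ) × (Fin n → ℝ) :=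
  (fun i => (p.1.1 i : ℝ), fun j => (p.1.2 j : ℝ))

/-- `f : V → ℚ` is piecewise polynomial with walls `W_{I,J}`: on (the points of `V` in) every
chamber it agrees with a polynomial in `μ_1, …, μ_m, ν_1, …, ν_n`. -/
def IsPiecewisePolynomial {m n : ℕ} (f : V m n → ℚ) : Prop :=
  ∀ c : Set ((Fin m → ℝ) × (Fin n → ℝ)), IsChamber c →
    ∃ P : MvPolynomial (Fin m ⊕ Fin n) ℚ, ∀ p : V m n, toReal p ∈ c →
      f p = MvPolynomial.eval
        (Sum.elim (fun i => (p.1.1 i : ℚ)) (fun j => (p.1.2 j : ℚ))) P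

end CompletedHurwitz

end

/-! The proof is the Fock-space argument, run on alternating functions of `N` integer exponents in
place of the infinite wedge. A partition is the configuration of exponents `λ_i - i`; the vacuum is
`-1, …, -N`. If `N` is large compared with the energies that occur, the deep exponents are always
filled, and the operators `energyOp` obey the commutation relation of the infinite wedge, central
term included (`energyOp_commutator`).

By the Frobenius formula, `χ^λ_μ` is the coefficient of the configuration of `λ` in the vacuum
multiplied by the power sums `p_{μ_i}` (`chi_eq_psum`). For Specht modules built from Young
symmetrizers it is obtained from inner products over `S_d`: the character and the power-sum
coefficient both have squared norm `d!`, and their inner product is also `d!`, so the norm of the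
difference is zero (`spechtChar_eq_permSum`). The norm of the coefficient comes from Heisenberg
commutation, that of the character from `c x c ∈ ℚ c` for the Young symmetrizer `c`, and the inner
product from dominance order on colourings. Completed cycles act diagonally, so the Hurwitz number
is `1 / (∏ μ_i ∏ ν_j)` times a vacuum expectation of `m` lowering operators, `s` diagonal ones and
`n` raising operators (`hurwitz_eq_vev`).

To evaluate it, look at the last operator. If its energy is not positive, it kills the vacuum.
Otherwise it is commuted to the far left, where it contributes nothing; each commutator shortens the
product. Every operator that arises has energy `y_J - x_I`, whose sign is constant on a chamber, so
the same recursion serves all points of the chamber. A central term needs `y_J - x_I = 0`, which off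
the walls forces `(I, J)` to be empty or full; hence a nonzero central contribution can occur only
when nothing else remains in the product (`exists_central_mul_vev`). It is a sum of a polynomial
over `0 ≤ k < b` with `b` linear, so a polynomial by Faulhaber.

It remains to cancel the prefactor, that is, to show divisibility by all variables. The invariant
`SymOp.Good` says that every operator other than the initial Heisenberg ones has weight divisible by
its own variables; commutators preserve this (`Good.comm`), and the factor `b` of the Faulhaber sum
supplies the variable of a Heisenberg operator in the last pairing (`exists_central`). Only a
pairing of two Heisenberg operators fails, and that is exactly `(s, m, n) = (0, 1, 1)`. -/

noncomputable section

namespace CompletedHurwitz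

open Polynomial

/-! ### One-body operators on functions of `N` integer exponents -/

/-- Functions of `N` integer exponents; the alternating ones model `N`-fermion states. -/
abbrev St (N : ℕ) : Type := (Fin N → ℤ) → ℚ

/-- The one-body operator which raises one exponent by `a` with weight `f` (evaluated at the new
exponent). -/
def oneBody {N : ℕ} (a : ℤ) (f : ℤ → ℚ) : St N →ₗ[ℚ] St N where
  toFun w u := ∑ i, f (u i) * w (Function.update u i (u i - a))
  map_add' w w' := by ext u; simp [mul_add, Finset.sum_add_distrib]
  map_smul' c w := by ext u; simp [Finset.mul_sum, mul_left_comm]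

theorem oneBody_apply {N : ℕ} (a : ℤ) (f : ℤ → ℚ) (w : St N) (u : Fin N → ℤ) :
    oneBody a f w u = ∑ i, f (u i) * w (Function.update u i (u i - a)) := rfl

theorem oneBody_zero_apply {N : ℕ} (f : ℤ → ℚ) (w : St N) (u : Fin N → ℤ) :
    oneBody 0 f w u = (∑ i, f (u i)) * w u := by
  simp [oneBody_apply, Finset.sum_mul]

theorem oneBody_sub {N : ℕ} (a : ℤ) (f g : ℤ → ℚ) (w : St N) :
    oneBody a (fun k => f k - g k) w = oneBody a f w - oneBody a g w := by
  ext u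
  simp [oneBody_apply, sub_mul, Finset.sum_sub_distrib]

theorem oneBody_comp_apply {N : ℕ} (a b : ℤ) (f g : ℤ → ℚ) (w : St N) (u : Fin N → ℤ) :
    oneBody a f (oneBody b g w) u = oneBody (a + b) (fun k => f k * g (k - a)) w u +
      ∑ i, ∑ j ∈ Finset.univ.erase i, f (u i) * g (u j) *
        w (Function.update (Function.update u i (u i - a)) j (u j - b)) := by
  simp only [oneBody_apply]
  rw [← Finset.sum_add_distrib]
  refine Finset.sum_congr rfl fun i _ => ?_
  rw [← Finset.add_sum_erase _ _ (Finset.mem_univ i), mul_add, Finset.mul_sum]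
  congr 1
  · simp [mul_assoc, sub_sub]
  · refine Finset.sum_congr rfl fun j hj => ?_
    rw [Function.update_of_ne (Finset.ne_of_mem_erase hj), mul_assoc]

/-- The terms moving two different particles are the same in both orders and cancel; what is left
moves one particle twice, which is again a one-body operator. -/
theorem oneBody_commutator {N : ℕ} (a b : ℤ) (f g : ℤ → ℚ) (w : St N) :
    oneBody a f (oneBody b g w) = oneBody b g (oneBody a f w) +
      oneBody (a + b) (fun k => f k * g (k - a) - g k * f (k - b)) w := by
  ext u
  rw [Pi.add_apply, oneBody_comp_apply, oneBody_comp_apply, oneBody_sub, Pi.sub_apply, add_comm b a]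
  have : (∑ i, ∑ j ∈ Finset.univ.erase i, f (u i) * g (u j) *
        w (Function.update (Function.update u i (u i - a)) j (u j - b))) =
      ∑ i, ∑ j ∈ Finset.univ.erase i, g (u i) * f (u j) *
        w (Function.update (Function.update u i (u i - b)) j (u j - a)) := by
    rw [Finset.sum_comm' (t' := Finset.univ) (s' := fun j => Finset.univ.erase j)
      (by intro x y; simp [ne_comm])]
    refine Finset.sum_congr rfl fun i _ => Finset.sum_congr rfl fun j hj => ?_
    rw [Function.update_comm (Finset.ne_of_mem_erase hj).symm, mul_comm (f _)]
  rw [this]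
  ring

/-! ### Alternating states of bounded energy -/

/-- Alternating functions of the exponents. -/
def IsAlt {N : ℕ} (w : St N) : Prop :=
  ∀ (σ : Equiv.Perm (Fin N)) (u : Fin N → ℤ),
    w (u ∘ σ) = ((Equiv.Perm.sign σ : ℤ) : ℚ) * w u

theorem IsAlt.eq_zero_of_not_injective {N : ℕ} {w : St N} (hw : IsAlt w) {u : Fin N → ℤ}
    (hu : ¬ Function.Injective u) : w u = 0 := by
  simp only [Function.Injective, not_forall] at hu
  obtain ⟨i, j, hij, hne⟩ := hu
  have h := hw (Equiv.swap i j) u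
  have h2 : u ∘ Equiv.swap i j = u := by
    ext k
    simp only [Function.comp]
    rcases eq_or_ne k i with rfl | hi
    · simp [hij]
    · rcases eq_or_ne k j with rfl | hj
      · simp [hij]
      · rw [Equiv.swap_apply_of_ne_of_ne hi hj]
  rw [h2, Equiv.Perm.sign_swap hne] at h
  simp at h
  linarith

theorem IsAlt.oneBody {N : ℕ} {w : St N} (hw : IsAlt w) (a : ℤ) (f : ℤ → ℚ) :
    IsAlt (oneBody a f w) := by
  intro σ u
  rw [oneBody_apply, oneBody_apply, Finset.mul_sum,
    ← Equiv.sum_comp σ fun i => _ * (f (u i) * w (Function.update u i (u i - a)))]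
  refine Finset.sum_congr rfl fun i _ => ?_
  have : Function.update (u ∘ σ) i ((u ∘ σ) i - a) =
      Function.update u (σ i) (u (σ i) - a) ∘ σ := by
    ext k
    rcases eq_or_ne k i with rfl | hk
    · simp
    · simp [hk]
  rw [this, hw]
  simp only [Function.comp]
  ring

/-- The energy of a configuration, relative to the exponents `-1, -2, …, -N`. -/
def energy {N : ℕ} (u : Fin N → ℤ) : ℤ := ∑ i, (u i + ((i : ℕ) + 1 : ℤ))

theorem energy_comp {N : ℕ} (u : Fin N → ℤ) (σ : Equiv.Perm (Fin N)) :
    energy (u ∘ σ) = energy u := by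
  simp only [energy, Finset.sum_add_distrib, Function.comp]
  rw [Equiv.sum_comp σ u]

theorem energy_update {N : ℕ} (u : Fin N → ℤ) (i : Fin N) (a : ℤ) :
    energy (Function.update u i (u i - a)) = energy u - a := by
  simp only [energy, Finset.sum_add_distrib]
  rw [Finset.sum_update_of_mem (Finset.mem_univ i),
    ← Finset.add_sum_erase _ u (Finset.mem_univ i), Finset.sdiff_singleton_eq_erase]
  ring

/-- The alternating states of energy `E` with all exponents at least `-N`. -/
structure InH {N : ℕ} (E : ℤ) (w : St N) : Prop where
  alt : IsAlt w
  ge : ∀ u, w u ≠ 0 → ∀ i, -(N : ℤ) ≤ u i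
  energy_eq : ∀ u, w u ≠ 0 → energy u = E

theorem InH.injective {N : ℕ} {E : ℤ} {w : St N} (hw : InH E w) {u : Fin N → ℤ} (hu : w u ≠ 0) :
    Function.Injective u := by
  by_contra h
  exact hu (hw.alt.eq_zero_of_not_injective h)

theorem sum_Ico_neg (N : ℕ) (f : ℤ → ℚ) :
    ∑ k ∈ Finset.Ico (-(N : ℤ)) 0, f k = ∑ i : Fin N, f (-((i : ℕ) + 1 : ℤ)) := by
  symm
  refine Finset.sum_bij (fun i _ => -((i : ℕ) + 1 : ℤ)) ?_ ?_ ?_ ?_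
  · intro i _
    have := i.2
    simp only [Finset.mem_Ico]
    omega
  · intro i _ j _ h
    ext
    omega
  · intro k hk
    simp only [Finset.mem_Ico] at hk
    exact ⟨⟨(-k - 1).toNat, by omega⟩, Finset.mem_univ _, by simp; omega⟩
  · intros; rfl

/-- Particle-hole description: exponents occupied both in `u` and in the vacuum cancel, leaving the
particles outside the sea and the holes in it, each with nonnegative cost once all exponents are at
least `-N`. -/
theorem energy_eq_image {N : ℕ} {u : Fin N → ℤ} (hu : Function.Injective u) :
    energy u = ∑ k ∈ Finset.univ.image u \ Finset.Ico (-(N : ℤ)) 0, k +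
      ∑ k ∈ Finset.Ico (-(N : ℤ)) 0 \ Finset.univ.image u, -k := by
  have h1 : ∑ k ∈ Finset.univ.image u, k = ∑ i, u i :=
    Finset.sum_image fun i _ j _ h => hu h
  have h2 : (∑ k ∈ Finset.Ico (-(N : ℤ)) 0, k : ℤ) = ∑ i : Fin N, -((i : ℕ) + 1 : ℤ) := by
    have := sum_Ico_neg N (fun k => (k : ℚ))
    rw [← Int.cast_sum, ← Int.cast_sum] at this
    exact Int.cast_injective this
  have h3 := Finset.sum_sdiff_sub_sum_sdiff (s₁ := Finset.univ.image u)
    (s₂ := Finset.Ico (-(N : ℤ)) 0) (f := fun k : ℤ => k)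
  rw [h1, h2] at h3
  rw [Finset.sum_neg_distrib] at h3 ⊢
  rw [energy, Finset.sum_add_distrib]
  linarith

theorem image_sdiff_nonneg {N : ℕ} {u : Fin N → ℤ} (hge : ∀ i, -(N : ℤ) ≤ u i) {k : ℤ}
    (hk : k ∈ Finset.univ.image u \ Finset.Ico (-(N : ℤ)) 0) : 0 ≤ k := by
  simp only [Finset.mem_sdiff, Finset.mem_image, Finset.mem_univ, true_and, Finset.mem_Ico,
    not_and, not_lt] at hk
  obtain ⟨⟨i, rfl⟩, h⟩ := hk
  exact h (hge i)

theorem energy_nonneg {N : ℕ} {u : Fin N → ℤ} (hu : Function.Injective u)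
    (hge : ∀ i, -(N : ℤ) ≤ u i) : 0 ≤ energy u := by
  rw [energy_eq_image hu]
  refine add_nonneg (Finset.sum_nonneg fun k hk => image_sdiff_nonneg hge hk)
    (Finset.sum_nonneg fun k hk => ?_)
  have := (Finset.mem_Ico.mp (Finset.mem_sdiff.mp hk).1).2
  omega

/-- A hole at `k < 0` alone costs energy `-k`, so holes cannot lie deeper than the energy allows.
This is what makes finite `N` behave like an infinite sea. -/
theorem exists_eq_of_lt_neg_energy {N : ℕ} {u : Fin N → ℤ} (hu : Function.Injective u)
    (hge : ∀ i, -(N : ℤ) ≤ u i) {k : ℤ} (h1 : -(N : ℤ) ≤ k) (h2 : k < 0) (h3 : k < -energy u) :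
    ∃ i, u i = k := by
  by_contra hne
  have hk : k ∈ Finset.Ico (-(N : ℤ)) 0 \ Finset.univ.image u := by
    simp only [Finset.mem_sdiff, Finset.mem_Ico, Finset.mem_image, Finset.mem_univ, true_and]
    exact ⟨⟨h1, h2⟩, hne⟩
  have h4 : -k ≤ ∑ k ∈ Finset.Ico (-(N : ℤ)) 0 \ Finset.univ.image u, -k :=
    Finset.single_le_sum (f := fun k : ℤ => -k) (fun k hk => by
      have := (Finset.mem_Ico.mp (Finset.mem_sdiff.mp hk).1).2
      show 0 ≤ -k
      omega) hk
  have h5 : 0 ≤ ∑ k ∈ Finset.univ.image u \ Finset.Ico (-(N : ℤ)) 0, k :=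
    Finset.sum_nonneg fun k hk => image_sdiff_nonneg hge hk
  rw [energy_eq_image hu] at h3
  linarith

theorem InH.eq_zero {N : ℕ} {E : ℤ} {w : St N} (hw : InH E w) (hE : E < 0) : w = 0 := by
  ext u
  by_contra hu
  have h := energy_nonneg (hw.injective hu) (hw.ge u hu)
  rw [hw.energy_eq u hu] at h
  omega

theorem InH.exists_eq {N : ℕ} {E : ℤ} {w : St N} (hw : InH E w) {u : Fin N → ℤ} (hu : w u ≠ 0)
    {k : ℤ} (h1 : -(N : ℤ) ≤ k) (h2 : k < -E) : ∃ i, u i = k := by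
  have h := energy_nonneg (hw.injective hu) (hw.ge u hu)
  have h' := hw.energy_eq u hu
  exact exists_eq_of_lt_neg_energy (hw.injective hu) (hw.ge u hu) h1 (by omega) (by omega)

theorem InH.smul {N : ℕ} {E : ℤ} {w : St N} (hw : InH E w) (c : ℚ) : InH E (c • w) where
  alt σ u := by simp [hw.alt σ u, mul_left_comm]
  ge u hu := hw.ge u fun h => hu (by simp [h])
  energy_eq u hu := hw.energy_eq u fun h => hu (by simp [h])

theorem InH.sub {N : ℕ} {E : ℤ} {w w' : St N} (hw : InH E w) (hw' : InH E w') :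
    InH E (w - w') where
  alt σ u := by simp [hw.alt σ u, hw'.alt σ u, mul_sub]
  ge u hu := by
    by_cases h : w u = 0
    · exact hw'.ge u fun h' => hu (by simp [h, h'])
    · exact hw.ge u h
  energy_eq u hu := by
    by_cases h : w u = 0
    · exact hw'.energy_eq u fun h' => hu (by simp [h, h'])
    · exact hw.energy_eq u h

/-- One-body operators whose weight lives on the occupied exponents vanish unless they preserve
the energy. -/
theorem InH.oneBody_eq_zero {N : ℕ} {E : ℤ} {w : St N} (hw : InH E w) {c : ℤ} (hc : c ≠ 0)
    {R : ℤ → ℚ} (hR : ∀ k, R k ≠ 0 → -(N : ℤ) ≤ k ∧ k < -E) : oneBody c R w = 0 := by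
  ext u
  by_cases hu : Function.Injective u
  · rw [oneBody_apply]
    refine Finset.sum_eq_zero fun i _ => ?_
    by_contra h
    obtain ⟨h1, h2⟩ := mul_ne_zero_iff.mp h
    -- Pauli exclusion: the exponent reached by particle `i` was already occupied before the move,
    -- by some `j`.
    obtain ⟨j, hj⟩ := hw.exists_eq h2 (hR _ h1).1 (hR _ h1).2
    rcases eq_or_ne j i with rfl | hji
    · simp [hc] at hj
    · rw [Function.update_of_ne hji] at hj
      exact hji (hu hj)
  · exact (hw.alt.oneBody c R).eq_zero_of_not_injective hu

/-- Every exponent in the support of `R` is occupied exactly once in every configuration of the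
state, so the total weight does not depend on the configuration. -/
theorem InH.oneBody_zero {N : ℕ} {E : ℤ} {w : St N} (hw : InH E w)
    {R : ℤ → ℚ} {t : ℤ} (ht : t ≤ -E) (hR : ∀ k, R k ≠ 0 → -(N : ℤ) ≤ k ∧ k < t) :
    oneBody 0 R w = (∑ k ∈ Finset.Ico (-(N : ℤ)) t, R k) • w := by
  ext u
  rw [oneBody_zero_apply, Pi.smul_apply, smul_eq_mul]
  by_cases hu : w u = 0
  · simp [hu]
  congr 1
  have hinj := hw.injective hu
  rw [← Finset.sum_image (s := Finset.univ) (g := u) (f := R) fun i _ j _ h => hinj h]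
  symm
  refine Finset.sum_subset (fun k hk => ?_) fun k _ hk => ?_
  · obtain ⟨h1, h2⟩ := Finset.mem_Ico.mp hk
    obtain ⟨i, hi⟩ := hw.exists_eq hu h1 (by omega)
    exact Finset.mem_image.mpr ⟨i, Finset.mem_univ _, hi⟩
  · by_contra h
    exact hk (Finset.mem_Ico.mpr (hR k h))

/-! ### Energy operators with polynomial weights -/

/-- A polynomial weight, cut off below `-N`. -/
def cutoff (N : ℕ) (f : ℚ[X]) (k : ℤ) : ℚ := if -(N : ℤ) ≤ k then f.eval (k : ℚ) else 0

theorem cutoff_of_le {N : ℕ} (f : ℚ[X]) {k : ℤ} (h : -(N : ℤ) ≤ k) :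
    cutoff N f k = f.eval (k : ℚ) := if_pos h

theorem cutoff_of_lt {N : ℕ} (f : ℚ[X]) {k : ℤ} (h : k < -(N : ℤ)) : cutoff N f k = 0 :=
  if_neg (by omega)

/-- The operator raising the energy by `a` with polynomial weight `f`, normalized to have vanishing
vacuum expectation. -/
def energyOp (N : ℕ) (a : ℤ) (f : ℚ[X]) : St N →ₗ[ℚ] St N :=
  oneBody a (cutoff N f) -
    (if a = 0 then ∑ k ∈ Finset.Ico (-(N : ℤ)) 0, f.eval (k : ℚ) else 0) • LinearMap.id

theorem energyOp_apply (N : ℕ) (a : ℤ) (f : ℚ[X]) (w : St N) :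
    energyOp N a f w = oneBody a (cutoff N f) w -
      (if a = 0 then ∑ k ∈ Finset.Ico (-(N : ℤ)) 0, f.eval (k : ℚ) else 0) • w := rfl

theorem energyOp_of_ne {N : ℕ} {a : ℤ} (ha : a ≠ 0) (f : ℚ[X]) (w : St N) :
    energyOp N a f w = oneBody a (cutoff N f) w := by
  simp [energyOp_apply, ha]

theorem energyOp_poly_zero (N : ℕ) (a : ℤ) (w : St N) : energyOp N a 0 w = 0 := by
  ext u
  simp [energyOp_apply, oneBody_apply, cutoff]

theorem InH.oneBody_cutoff {N : ℕ} {E : ℤ} {w : St N} (hw : InH E w) (a : ℤ) (f : ℚ[X]) :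
    InH (E + a) (oneBody a (cutoff N f) w) where
  alt := hw.alt.oneBody _ _
  ge u hu j := by
    obtain ⟨i, _, hi⟩ := Finset.exists_ne_zero_of_sum_ne_zero
      (show ∑ i, cutoff N f (u i) * w (Function.update u i (u i - a)) ≠ 0 from hu)
    obtain ⟨h1, h2⟩ := mul_ne_zero_iff.mp hi
    rcases eq_or_ne j i with rfl | hj
    · by_contra h
      exact h1 (cutoff_of_lt f (by omega))
    · simpa [Function.update_of_ne hj] using hw.ge _ h2 j
  energy_eq u hu := by
    obtain ⟨i, _, hi⟩ := Finset.exists_ne_zero_of_sum_ne_zero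
      (show ∑ i, cutoff N f (u i) * w (Function.update u i (u i - a)) ≠ 0 from hu)
    have := hw.energy_eq _ (mul_ne_zero_iff.mp hi).2
    rw [energy_update] at this
    omega

theorem InH.energyOp {N : ℕ} {E : ℤ} {w : St N} (hw : InH E w) (a : ℤ) (f : ℚ[X]) :
    InH (E + a) (energyOp N a f w) := by
  rcases eq_or_ne a 0 with rfl | ha
  · rw [energyOp_apply]
    refine (hw.oneBody_cutoff 0 f).sub ?_
    rw [add_zero]
    exact hw.smul _
  · rw [energyOp_of_ne ha]
    exact hw.oneBody_cutoff a f

/-- The weight of the commutator of two energy operators. -/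
def commWeight {K : Type*} [CommRing K] (a b : K) (f g : K[X]) : K[X] :=
  f * g.comp (X - C a) - g * f.comp (X - C b)

theorem sum_Ico_add_sum_Ico (φ : ℤ → ℚ) {a b c : ℤ} (hab : a ≤ b) (hbc : b ≤ c) :
    ∑ k ∈ Finset.Ico a b, φ k + ∑ k ∈ Finset.Ico b c, φ k = ∑ k ∈ Finset.Ico a c, φ k := by
  rw [← Finset.sum_union (Finset.Ico_disjoint_Ico_consecutive a b c),
    Finset.Ico_union_Ico_eq_Ico hab hbc]

/-- The cutoff spoils the one-body commutation relation only within `max a b` of the bottom, and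
`hN` says that this zone is filled. The error therefore vanishes if `a + b ≠ 0` and is a scalar
otherwise; together with the vacuum normalization this scalar gives the central term. -/
theorem energyOp_commutator {N : ℕ} {E : ℤ} {w : St N} (hw : InH E w) (a b : ℤ) (hb : 0 < b)
    (hN : E + max a b ≤ N) (f g : ℚ[X]) :
    energyOp N a f (energyOp N b g w) = energyOp N b g (energyOp N a f w) +
      energyOp N (a + b) (commWeight (a : ℚ) (b : ℚ) f g) w +
      (if a + b = 0 then ∑ k ∈ Finset.Ico (0 : ℤ) b, g.eval (k : ℚ) * f.eval ((k - b : ℤ) : ℚ)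
        else 0) • w := by
  set h := commWeight (a : ℚ) (b : ℚ) f g with hh
  have heval : ∀ k : ℤ, h.eval (k : ℚ) = f.eval (k : ℚ) * g.eval ((k - a : ℤ) : ℚ) -
      g.eval (k : ℚ) * f.eval ((k - b : ℤ) : ℚ) := by
    intro k
    simp [hh, commWeight, eval_comp]
  -- `R` is the cutoff of the commutator weight minus the commutator weight of the cutoffs.
  set R : ℤ → ℚ := fun k => cutoff N h k -
    (cutoff N f k * cutoff N g (k - a) - cutoff N g k * cutoff N f (k - b)) with hR
  have hRsupp : ∀ k, R k ≠ 0 → -(N : ℤ) ≤ k ∧ k < -(N : ℤ) + max a b := by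
    intro k hk
    by_contra hcon
    apply hk
    rcases lt_or_ge k (-(N : ℤ)) with h1 | h1
    · simp [hR, cutoff_of_lt _ h1]
    · have h2 : -(N : ℤ) + max a b ≤ k := by
        by_contra h2
        exact hcon ⟨h1, by omega⟩
      have h3 := le_max_left a b
      have h4 := le_max_right a b
      simp only [hR]
      rw [cutoff_of_le _ h1, cutoff_of_le _ h1, cutoff_of_le _ h1, cutoff_of_le _ (by omega),
        cutoff_of_le _ (by omega), heval, sub_self]
  have hcomm : energyOp N a f (energyOp N b g w) = energyOp N b g (energyOp N a f w) +
      (oneBody (a + b) (cutoff N h) w - oneBody (a + b) R w) := by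
    have h1 : (fun k => cutoff N f k * cutoff N g (k - a) - cutoff N g k * cutoff N f (k - b)) =
        fun k => cutoff N h k - R k := by
      ext k
      simp [hR]
    have h2 := oneBody_commutator a b (cutoff N f) (cutoff N g) w
    rw [h1, oneBody_sub] at h2
    simp only [energyOp_apply, map_sub, map_smul, h2]
    module
  rw [hcomm]
  rcases eq_or_ne (a + b) 0 with hab | hab
  · rw [hab, hw.oneBody_zero (t := -(N : ℤ) + max a b) (by omega) hRsupp, energyOp_apply N 0 h]
    simp only [↓reduceIte]
    have hmax : max a b = b := max_eq_right (by omega)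
    -- Since `a = -b`, the weight `h` is the difference `φ (k + b) - φ k` and its sum telescopes to
    -- one boundary term at the surface and one at the bottom; the sum of `R` cancels the latter.
    have key : ∑ k ∈ Finset.Ico (-(N : ℤ)) 0, h.eval (k : ℚ) -
        ∑ k ∈ Finset.Ico (-(N : ℤ)) (-(N : ℤ) + b), R k =
        ∑ k ∈ Finset.Ico (0 : ℤ) b, g.eval (k : ℚ) * f.eval ((k - b : ℤ) : ℚ) := by
      set φ : ℤ → ℚ := fun k => g.eval (k : ℚ) * f.eval ((k - b : ℤ) : ℚ) with hφ
      have e1 : ∀ k : ℤ, h.eval (k : ℚ) = φ (k + b) - φ k := by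
        intro k
        rw [heval]
        simp only [hφ]
        have : a = -b := by omega
        rw [this, sub_neg_eq_add, add_sub_cancel_right]
        ring
      have e2 : ∑ k ∈ Finset.Ico (-(N : ℤ)) (-(N : ℤ) + b), R k =
          ∑ k ∈ Finset.Ico (-(N : ℤ)) (-(N : ℤ) + b), -φ k := by
        refine Finset.sum_congr rfl fun k hk => ?_
        obtain ⟨h1, h2⟩ := Finset.mem_Ico.mp hk
        simp only [hR]
        rw [cutoff_of_le _ h1, cutoff_of_le _ h1, cutoff_of_le _ h1, cutoff_of_le g (by omega),
          cutoff_of_lt f (k := k - b) (by omega), heval]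
        simp [hφ]
      have e3 : ∑ k ∈ Finset.Ico (-(N : ℤ)) 0, φ (k + b) =
          ∑ k ∈ Finset.Ico (-(N : ℤ) + b) b, φ k := by
        have := Finset.sum_Ico_add' φ (-(N : ℤ)) 0 b
        rw [this, zero_add]
      have e4 := sum_Ico_add_sum_Ico φ (show -(N : ℤ) ≤ -(N : ℤ) + b by omega)
        (show -(N : ℤ) + b ≤ b by omega)
      have e5 := sum_Ico_add_sum_Ico φ (show -(N : ℤ) ≤ 0 by omega) hb.le
      rw [e2, Finset.sum_congr rfl fun k _ => e1 k, Finset.sum_sub_distrib, e3,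
        Finset.sum_neg_distrib]
      linarith
    rw [hmax, ← key]
    module
  · rw [hw.oneBody_eq_zero hab (R := R) fun k hk => ⟨(hRsupp k hk).1, by
      have := (hRsupp k hk).2
      omega⟩, energyOp_of_ne hab]
    simp [hab]

/-- At energy zero the occupied exponents are exactly those of the vacuum, whose total weight was
subtracted in the normalization. -/
theorem InH.energyOp_zero {N : ℕ} {w : St N} (hw : InH 0 w) (f : ℚ[X]) :
    CompletedHurwitz.energyOp N 0 f w = 0 := by
  ext u
  rw [energyOp_apply, Pi.sub_apply, oneBody_zero_apply, Pi.smul_apply, smul_eq_mul, if_pos rfl,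
    ← sub_mul]
  by_cases hu : w u = 0
  · simp [hu]
  have hinj := hw.injective hu
  have himg : Finset.Ico (-(N : ℤ)) 0 = Finset.univ.image u := by
    refine Finset.eq_of_subset_of_card_le (fun k hk => ?_) ?_
    · obtain ⟨h1, h2⟩ := Finset.mem_Ico.mp hk
      obtain ⟨i, hi⟩ := hw.exists_eq hu h1 (by omega)
      exact Finset.mem_image.mpr ⟨i, Finset.mem_univ _, hi⟩
    · rw [Finset.card_image_of_injective _ hinj]
      simp
  rw [himg, Finset.sum_image fun i _ j _ h => hinj h]
  rw [Finset.sum_congr rfl fun i _ => cutoff_of_le f (hw.ge u hu i)]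
  simp

/-! ### The vacuum and vacuum expectations -/

/-- The Slater determinant with the exponents `y`. -/
def slater {N : ℕ} (y : Fin N → ℤ) : St N :=
  fun u => ∑ σ : Equiv.Perm (Fin N), if u = y ∘ σ then ((Equiv.Perm.sign σ : ℤ) : ℚ) else 0

/-- The exponents of the vacuum. -/
def rho (N : ℕ) : Fin N → ℤ := fun i => -((i : ℕ) + 1 : ℤ)

theorem exists_of_slater_ne_zero {N : ℕ} {y u : Fin N → ℤ} (h : slater y u ≠ 0) :
    ∃ σ : Equiv.Perm (Fin N), u = y ∘ σ := by
  obtain ⟨σ, _, hσ⟩ := Finset.exists_ne_zero_of_sum_ne_zero h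
  exact ⟨σ, by by_contra h; exact hσ (if_neg h)⟩

theorem slater_comp {N : ℕ} {y : Fin N → ℤ} (hy : Function.Injective y)
    (σ : Equiv.Perm (Fin N)) : slater y (y ∘ σ) = ((Equiv.Perm.sign σ : ℤ) : ℚ) := by
  rw [slater, Finset.sum_eq_single σ]
  · simp
  · intro τ _ hτ
    rw [if_neg]
    intro h
    exact hτ (Equiv.ext fun i => (hy (congrFun h i)).symm)
  · simp

theorem isAlt_slater {N : ℕ} (y : Fin N → ℤ) : IsAlt (slater y) := by
  intro τ u
  rw [slater, slater, Finset.mul_sum, ← Equiv.sum_comp (Equiv.mulRight τ)]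
  refine Finset.sum_congr rfl fun σ _ => ?_
  have : u ∘ τ = y ∘ (Equiv.mulRight τ σ) ↔ u = y ∘ σ := by
    constructor
    · intro h
      ext i
      simpa using congrFun h (τ⁻¹ i)
    · rintro rfl
      rfl
  simp only [this]
  split_ifs <;> simp [mul_comm]

theorem rho_injective (N : ℕ) : Function.Injective (rho N) := by
  intro i j h
  simp only [rho] at h
  ext
  omega

theorem energy_rho (N : ℕ) : energy (rho N) = 0 := by
  simp [energy, rho]

theorem le_rho {N : ℕ} (i : Fin N) : -(N : ℤ) ≤ rho N i := by
  have := i.2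
  simp only [rho]
  omega

theorem inH_slater_rho (N : ℕ) : InH 0 (slater (rho N)) where
  alt := isAlt_slater _
  ge u hu i := by
    obtain ⟨σ, rfl⟩ := exists_of_slater_ne_zero hu
    exact le_rho _
  energy_eq u hu := by
    obtain ⟨σ, rfl⟩ := exists_of_slater_ne_zero hu
    rw [energy_comp, energy_rho]

theorem slater_rho_rho (N : ℕ) : slater (rho N) (rho N) = 1 := by
  have := slater_comp (rho_injective N) 1
  simpa using this

/-- Apply the operators of a list, the last one first. -/
def applyOps (N : ℕ) (L : List (ℤ × ℚ[X])) (w : St N) : St N :=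
  L.foldr (fun o w => energyOp N o.1 o.2 w) w

@[simp] theorem applyOps_nil (N : ℕ) (w : St N) : applyOps N [] w = w := rfl

@[simp] theorem applyOps_cons (N : ℕ) (o : ℤ × ℚ[X]) (L : List (ℤ × ℚ[X])) (w : St N) :
    applyOps N (o :: L) w = energyOp N o.1 o.2 (applyOps N L w) := rfl

theorem applyOps_append (N : ℕ) (L L' : List (ℤ × ℚ[X])) (w : St N) :
    applyOps N (L ++ L') w = applyOps N L (applyOps N L' w) := by
  simp [applyOps]

theorem applyOps_zero (N : ℕ) (L : List (ℤ × ℚ[X])) : applyOps N L (0 : St N) = 0 := by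
  induction L with
  | nil => rfl
  | cons o L ih => rw [applyOps_cons, ih, map_zero]

/-- The total energy of a list of operators. -/
def totalEnergy (L : List (ℤ × ℚ[X])) : ℤ := (L.map Prod.fst).sum

/-- The total absolute energy of a list of operators. -/
def absEnergy (L : List (ℤ × ℚ[X])) : ℤ := (L.map fun o => |o.1|).sum

theorem totalEnergy_le_absEnergy (L : List (ℤ × ℚ[X])) : totalEnergy L ≤ absEnergy L := by
  induction L with
  | nil => simp [totalEnergy, absEnergy]
  | cons o L ih =>
    simp only [totalEnergy, absEnergy, List.map_cons, List.sum_cons] at *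
    exact add_le_add (le_abs_self _) ih

theorem InH.applyOps {N : ℕ} {E : ℤ} {w : St N} (hw : InH E w) (L : List (ℤ × ℚ[X])) :
    InH (E + totalEnergy L) (applyOps N L w) := by
  induction L with
  | nil => simpa [totalEnergy] using hw
  | cons o L ih =>
    have := ih.energyOp o.1 o.2
    rw [applyOps_cons]
    convert this using 1
    simp [totalEnergy]
    ring

/-- The vacuum expectation of a product of energy operators. -/
def vev (N : ℕ) (L : List (ℤ × ℚ[X])) : ℚ := applyOps N L (slater (rho N)) (rho N)

/-- The non-central part of the commutator of two operators. -/
def commOp (o o' : ℤ × ℚ[X]) : ℤ × ℚ[X] :=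
  (o.1 + o'.1, commWeight (o.1 : ℚ) (o'.1 : ℚ) o.2 o'.2)

/-- The central part of the commutator of two operators. -/
def central (o o' : ℤ × ℚ[X]) : ℚ :=
  if o.1 + o'.1 = 0 then
    ∑ k ∈ Finset.Ico (0 : ℤ) o'.1, o'.2.eval (k : ℚ) * o.2.eval ((k - o'.1 : ℤ) : ℚ)
  else 0

theorem vev_nil (N : ℕ) : vev N [] = 1 := slater_rho_rho N

theorem vev_append_of_nonpos (N : ℕ) (L : List (ℤ × ℚ[X])) (o : ℤ × ℚ[X]) (ho : o.1 ≤ 0) :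
    vev N (L ++ [o]) = 0 := by
  have h : energyOp N o.1 o.2 (slater (rho N)) = 0 := by
    rcases ho.lt_or_eq with h | h
    · exact ((inH_slater_rho N).energyOp o.1 o.2).eq_zero (by omega)
    · rw [h]
      exact (inH_slater_rho N).energyOp_zero _
  rw [vev, applyOps_append, applyOps_cons, applyOps_nil, h, applyOps_zero]
  rfl

/-- Leibniz rule for moving `o` to the left. The bound by `absEnergy` controls every intermediate
energy, so each commutation is legitimate for the same `N`. -/
theorem applyOps_energyOp (N : ℕ) (o : ℤ × ℚ[X]) (ho : 0 < o.1) {w : St N} (hw : InH 0 w)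
    (L : List (ℤ × ℚ[X])) (hN : absEnergy L + o.1 ≤ N) :
    applyOps N L (energyOp N o.1 o.2 w) = energyOp N o.1 o.2 (applyOps N L w) +
      ∑ t : Fin L.length, (applyOps N (L.set t (commOp L[t] o)) w +
        central L[t] o • applyOps N (L.eraseIdx t) w) := by
  induction L with
  | nil => simp
  | cons o₁ L ih =>
    have habs : absEnergy (o₁ :: L) = |o₁.1| + absEnergy L := by simp [absEnergy]
    have h0 := abs_nonneg o₁.1
    have h1 := le_abs_self o₁.1
    have h2 := totalEnergy_le_absEnergy L
    have h3 : 0 ≤ absEnergy L := List.sum_nonneg (by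
      intro x hx
      obtain ⟨o, _, rfl⟩ := List.mem_map.mp hx
      exact abs_nonneg _)
    have hc := energyOp_commutator (hw.applyOps L) o₁.1 o.1 ho (by
      rcases max_cases o₁.1 o.1 with h | h <;> omega) o₁.2 o.2
    rw [applyOps_cons, ih (by omega), map_add, hc, map_sum]
    simp only [List.length_cons]
    rw [Fin.sum_univ_succ]
    simp only [map_add, map_smul, applyOps_cons]
    simp [commOp, central]
    abel

/-- Once `o` stands at the far left, a contribution at `rho` would need a state of negative energy
to its right; so only the commutator terms survive. -/
theorem vev_append_of_pos (N : ℕ) (L : List (ℤ × ℚ[X])) (o : ℤ × ℚ[X]) (ho : 0 < o.1)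
    (hN : absEnergy L + o.1 ≤ N) :
    vev N (L ++ [o]) = ∑ t : Fin L.length, (vev N (L.set t (commOp L[t] o)) +
      central L[t] o * vev N (L.eraseIdx t)) := by
  have h0 : energyOp N o.1 o.2 (applyOps N L (slater (rho N))) (rho N) = 0 := by
    by_contra h
    have hH := (inH_slater_rho N).applyOps L
    have h1 := (hH.energyOp o.1 o.2).energy_eq _ h
    rw [energy_rho] at h1
    rw [hH.eq_zero (by omega), map_zero] at h
    exact h rfl
  rw [vev, applyOps_append, applyOps_cons, applyOps_nil,
    applyOps_energyOp N o ho (inH_slater_rho N) L hN, Pi.add_apply, h0, zero_add,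
    Finset.sum_apply]
  rfl

end CompletedHurwitz

end

noncomputable section

namespace CompletedHurwitz

open Polynomial

/-! ### Exponents of partitions -/

theorem coe_rows {d : ℕ} (lam : d.Partition) : (rows lam : Multiset ℕ) = lam.parts :=
  Multiset.sort_eq _ _

theorem sum_rows {d : ℕ} (lam : d.Partition) : (rows lam).sum = d := by
  rw [← Multiset.sum_coe, coe_rows, lam.parts_sum]

theorem pos_of_mem_rows {d : ℕ} {lam : d.Partition} {a : ℕ} (h : a ∈ rows lam) : 0 < a :=
  lam.parts_pos (by rw [← coe_rows]; exact h)

theorem length_rows_le {d : ℕ} (lam : d.Partition) : (rows lam).length ≤ d := by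
  conv_rhs => rw [← sum_rows lam]
  exact List.length_le_sum_of_one_le _ fun a ha => pos_of_mem_rows ha

/-- The `i`-th part of a partition (zero beyond its length). -/
def part {d : ℕ} (lam : d.Partition) (i : ℕ) : ℕ := (rows lam).getD i 0

theorem part_of_length_le {d : ℕ} (lam : d.Partition) {i : ℕ} (h : (rows lam).length ≤ i) :
    part lam i = 0 := by
  simp [part, h]

theorem part_antitone {d : ℕ} (lam : d.Partition) : Antitone (part lam) := by
  intro i j hij
  by_cases hj : j < (rows lam).length
  · have := (rows_sortedGE lam).getElem_ge_getElem_of_le (i := j) (j := i)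
      (hi := hj) (hj := by omega) hij
    simpa [part, hj, lt_of_le_of_lt hij hj] using this
  · rw [part_of_length_le lam (by omega)]
    exact Nat.zero_le _

theorem eq_of_getD_eq {l l' : List ℕ} (hl : ∀ a ∈ l, 0 < a) (hl' : ∀ a ∈ l', 0 < a)
    (h : ∀ i, l.getD i 0 = l'.getD i 0) : l = l' := by
  induction l generalizing l' with
  | nil =>
    cases l' with
    | nil => rfl
    | cons b l' =>
      have h1 := h 0
      have h2 := hl' b (by simp)
      simp at h1
      omega
  | cons a l ih =>
    cases l' with
    | nil =>
      have h1 := h 0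
      have h2 := hl a (by simp)
      simp at h1
      omega
    | cons b l' =>
      have h1 := h 0
      simp only [List.getD_cons_zero] at h1
      rw [h1, ih (l' := l') (fun x hx => hl x (by simp [hx])) (fun x hx => hl' x (by simp [hx]))
        fun i => by simpa using h (i + 1)]

theorem eq_of_part_eq {d : ℕ} {lam lam' : d.Partition} (h : ∀ i, part lam i = part lam' i) :
    lam = lam' := by
  have h1 := eq_of_getD_eq (fun _ => pos_of_mem_rows) (fun _ => pos_of_mem_rows) h
  ext1
  rw [← coe_rows, ← coe_rows, h1]

theorem getD_filter_of_sorted {l : List ℕ} (hl : l.Pairwise (· ≥ ·)) (i : ℕ) :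
    (l.filter (· ≠ 0)).getD i 0 = l.getD i 0 := by
  induction l generalizing i with
  | nil => simp
  | cons a l ih =>
    rw [List.pairwise_cons] at hl
    rcases Nat.eq_zero_or_pos a with rfl | ha
    · have h0 : ∀ b ∈ (0 :: l), b = 0 := by
        intro b hb
        rcases List.mem_cons.mp hb with rfl | hb
        · rfl
        · have := hl.1 b hb
          omega
      have h1 : (0 :: l).filter (· ≠ 0) = [] := by
        rw [List.filter_eq_nil_iff]
        intro b hb
        simp [h0 b hb]
      rw [h1]
      by_cases hi : i < (0 :: l).length
      · rw [List.getD_eq_getElem _ _ hi, h0 _ (List.getElem_mem hi)]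
        simp
      · rw [List.getD_eq_default (0 :: l) _ (by omega)]
        simp
    · rw [List.filter_cons_of_pos (by simpa using ha.ne')]
      cases i with
      | zero => simp
      | succ i => simpa using ih hl.2 i

/-- The exponents `λ_i - i` (with `i ≥ 1`) of a partition. -/
def exps (N : ℕ) {d : ℕ} (lam : d.Partition) : Fin N → ℤ :=
  fun i => (part lam i : ℤ) - ((i : ℕ) + 1 : ℤ)

theorem exps_strictAnti (N : ℕ) {d : ℕ} (lam : d.Partition) : StrictAnti (exps N lam) := by
  intro i j hij
  have h1 := part_antitone lam (show (i : ℕ) ≤ j from hij.le)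
  have h2 : (i : ℕ) < j := hij
  simp only [exps]
  omega

theorem exps_injective (N : ℕ) {d : ℕ} (lam : d.Partition) : Function.Injective (exps N lam) :=
  (exps_strictAnti N lam).injective

theorem le_exps {N d : ℕ} (lam : d.Partition) (i : Fin N) : -(N : ℤ) ≤ exps N lam i := by
  have := i.2
  simp only [exps]
  omega

/-- A strictly decreasing tuple is determined by its set of values, and `d ≤ N` leaves room for all
the parts. -/
theorem exps_inj {N d : ℕ} (hN : d ≤ N) {lam lam' : d.Partition}
    {σ : Equiv.Perm (Fin N)} (h : exps N lam = exps N lam' ∘ σ) : lam = lam' := by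
  have h1 : exps N lam = exps N lam' := by
    have h2 : (fun i => -exps N lam i) = fun i => -exps N lam' i := by
      refine (StrictMono.range_inj (fun i j hij => neg_lt_neg (exps_strictAnti N lam hij))
        (fun i j hij => neg_lt_neg (exps_strictAnti N lam' hij))).mp ?_
      rw [h]
      ext k
      constructor
      · rintro ⟨i, rfl⟩
        exact ⟨σ i, rfl⟩
      · rintro ⟨i, rfl⟩
        exact ⟨σ⁻¹ i, by simp⟩
    ext i
    exact neg_injective (congrFun h2 i)
  refine eq_of_part_eq fun i => ?_
  by_cases hi : i < N
  · have := congrFun h1 ⟨i, hi⟩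
    simp only [exps] at this
    omega
  · rw [part_of_length_le lam (by have := length_rows_le lam; omega),
      part_of_length_le lam' (by have := length_rows_le lam'; omega)]

theorem strictAnti_add_antitone {N : ℕ} {z : Fin N → ℤ} (hz : StrictAnti z) :
    Antitone fun i => z i + ((i : ℕ) : ℤ) := by
  have key : ∀ (k : ℕ) (i j : Fin N), (j : ℕ) = i + k →
      z j + ((j : ℕ) : ℤ) ≤ z i + ((i : ℕ) : ℤ) := by
    intro k
    induction k with
    | zero =>
      intro i j h
      have : i = j := Fin.ext (by omega)
      rw [this]
    | succ k ih =>
      intro i j h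
      have hj := j.2
      have h1 := ih i ⟨i + k, by omega⟩ rfl
      have h2 := hz (show (⟨i + k, by omega⟩ : Fin N) < j from by
        rw [Fin.lt_def]
        simp only
        omega)
      simp only at h1
      omega
  intro i j hij
  exact key (j - i) i j (by have : (i : ℕ) ≤ j := hij; omega)

/-- Sort the exponents decreasingly and add `1, …, N`: the result is weakly decreasing and
nonnegative with sum `d`, and dropping the zeros gives the partition. -/
theorem exists_exps {N d : ℕ} {y : Fin N → ℤ} (hy : Function.Injective y)
    (hge : ∀ i, -(N : ℤ) ≤ y i) (hE : energy y = d) :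
    ∃ (lam : d.Partition) (σ : Equiv.Perm (Fin N)), y = exps N lam ∘ σ := by
  set τ := Tuple.sort fun i => -y i with hτ
  set z := y ∘ τ with hz
  have hanti : StrictAnti z := by
    have hm : Monotone fun i => -z i := Tuple.monotone_sort fun i => -y i
    have : Antitone z := fun i j hij => by
      have := hm hij
      simp only at this
      omega
    exact this.strictAnti_of_injective (hy.comp τ.injective)
  -- Compare with the last entry: `z i + i` is at least `z (N - 1) + (N - 1)`, hence at least `-1`.
  have hnonneg : ∀ i : Fin N, 0 ≤ z i + ((i : ℕ) + 1 : ℤ) := by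
    intro i
    have hi := i.2
    have h1 := strictAnti_add_antitone hanti
      (show i ≤ (⟨N - 1, by omega⟩ : Fin N) from by rw [Fin.le_def]; simp only; omega)
    have h2 := hge (τ ⟨N - 1, by omega⟩)
    have h3 : z ⟨N - 1, by omega⟩ = y (τ ⟨N - 1, by omega⟩) := rfl
    simp only at h1
    omega
  set l : Fin N → ℕ := fun i => (z i + ((i : ℕ) + 1 : ℤ)).toNat with hl
  have hlz : ∀ i, (l i : ℤ) = z i + ((i : ℕ) + 1 : ℤ) := fun i => Int.toNat_of_nonneg (hnonneg i)
  have hsum : (Finset.univ.val.map l).sum = d := by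
    have h1 : ((∑ i, l i : ℕ) : ℤ) = d := by
      rw [Nat.cast_sum, ← hE, ← energy_comp y τ]
      exact Finset.sum_congr rfl fun i _ => hlz i
    exact_mod_cast h1
  have hlanti : Antitone l := by
    intro i j hij
    have := strictAnti_add_antitone hanti hij
    have h1 := hlz i
    have h2 := hlz j
    simp only at this
    omega
  have hpw : (List.ofFn l).Pairwise (· ≥ ·) := by
    rw [List.pairwise_ofFn]
    intro i j hij
    exact hlanti hij.le
  set lam : d.Partition := Nat.Partition.ofSums d (Finset.univ.val.map l) hsum with hlam
  have hrows : rows lam = (List.ofFn l).filter (· ≠ 0) := by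
    refine List.Perm.eq_of_pairwise' (r := (· ≥ ·)) ?_ ?_ ?_
    · exact Multiset.pairwise_sort lam.parts (· ≥ ·)
    · exact hpw.filter _
    · rw [← Multiset.coe_eq_coe, coe_rows, ← Multiset.filter_coe]
      simp only [hlam, Nat.Partition.ofSums]
      congr 1
      simp [Fin.univ_def, List.ofFn_eq_map]
  refine ⟨lam, τ⁻¹, ?_⟩
  have hexp : exps N lam = z := by
    ext i
    have h1 : part lam i = l i := by
      rw [part, hrows, getD_filter_of_sorted hpw]
      simp
    simp only [exps, h1, hlz]
    ring
  rw [hexp]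
  ext i
  simp [hz]

/-- Expansion of a state in Slater determinants. -/
theorem InH.expansion {N d : ℕ} (hN : d ≤ N) {w : St N} (hw : InH d w) (y : Fin N → ℤ) :
    w y = ∑ lam : d.Partition, slater (exps N lam) y * w (exps N lam) := by
  by_cases hex : ∃ (lam : d.Partition) (σ : Equiv.Perm (Fin N)), y = exps N lam ∘ σ
  · obtain ⟨lam, σ, rfl⟩ := hex
    rw [Finset.sum_eq_single lam, hw.alt, slater_comp (exps_injective N lam)]
    · intro lam' _ hne
      by_contra h
      obtain ⟨τ, hτ⟩ := exists_of_slater_ne_zero (mul_ne_zero_iff.mp h).1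
      refine hne (exps_inj (σ := τ * σ⁻¹) hN ?_).symm
      ext i
      have := congrFun hτ (σ⁻¹ i)
      simpa using this
    · simp
  · rw [Finset.sum_eq_zero]
    · by_contra h
      exact hex (exists_exps (hw.injective h) (hw.ge y h) (hw.energy_eq y h))
    · intro lam _
      by_contra h
      obtain ⟨τ, hτ⟩ := exists_of_slater_ne_zero (mul_ne_zero_iff.mp h).1
      exact hex ⟨lam, τ, hτ⟩

/-! ### Products of power sums -/

/-- The vector `∑ t, μ t • e_{κ t}`. -/
def shift {ι : Type*} [Fintype ι] {N : ℕ} (μ : ι → ℕ) (κ : ι → Fin N) : Fin N → ℤ :=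
  fun i => ∑ t, if κ t = i then (μ t : ℤ) else 0

/-- The vacuum multiplied by the power sums `p_{μ t}`. -/
def psum {ι : Type*} [Fintype ι] [DecidableEq ι] (N : ℕ) (μ : ι → ℕ) : St N :=
  fun u => ∑ κ : ι → Fin N, slater (rho N) (u - shift μ κ)

theorem psum_apply {ι : Type*} [Fintype ι] [DecidableEq ι] (N : ℕ) (μ : ι → ℕ)
    (u : Fin N → ℤ) : psum N μ u = ∑ κ : ι → Fin N, slater (rho N) (u - shift μ κ) := rfl

theorem psum_congr {ι ι' : Type*} [Fintype ι] [DecidableEq ι] [Fintype ι'] [DecidableEq ι']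
    (N : ℕ) {μ : ι → ℕ} {ν : ι' → ℕ} (e : ι ≃ ι') (h : ∀ t, ν (e t) = μ t) :
    psum N μ = psum N ν := by
  ext u
  refine Fintype.sum_equiv (e.arrowCongr (Equiv.refl _)) _ _ fun κ => ?_
  congr 2
  ext i
  simp only [shift]
  refine Fintype.sum_equiv e _ _ fun t => ?_
  simp [h]

theorem slater_symm {N : ℕ} (y u : Fin N → ℤ) : slater y u = slater u y := by
  rw [slater, slater, ← Equiv.sum_comp (Equiv.inv (Equiv.Perm (Fin N)))]
  refine Finset.sum_congr rfl fun σ _ => ?_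
  have : u = y ∘ (Equiv.inv (Equiv.Perm (Fin N)) σ) ↔ y = u ∘ σ := by
    constructor
    · rintro rfl
      ext i
      simp
    · rintro rfl
      ext i
      simp
  simp only [this]
  simp

theorem shift_comp {ι : Type*} [Fintype ι] {N : ℕ} (μ : ι → ℕ) (κ : ι → Fin N)
    (σ : Equiv.Perm (Fin N)) : shift μ (σ ∘ κ) ∘ σ = shift μ κ := by
  ext i
  simp [shift]

/-- Raising the vacuum to `y` or lowering `y` to the vacuum gives the same coefficient. -/
theorem sum_slater_add_shift {ι : Type*} [Fintype ι] [DecidableEq ι] {N : ℕ} (μ : ι → ℕ)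
    (y : Fin N → ℤ) : ∑ κ : ι → Fin N, slater y (rho N + shift μ κ) = psum N μ y := by
  simp only [psum]
  simp_rw [slater_symm y, slater]
  rw [Finset.sum_comm]
  conv_rhs => rw [Finset.sum_comm]
  refine Finset.sum_congr rfl fun σ _ => ?_
  rw [← Equiv.sum_comp ((Equiv.refl ι).arrowCongr σ)]
  refine Finset.sum_congr rfl fun κ _ => ?_
  have : y = (rho N + shift μ ((Equiv.refl ι).arrowCongr σ κ)) ∘ σ ↔
      y - shift μ κ = rho N ∘ σ := by
    have h1 : (rho N + shift μ ((Equiv.refl ι).arrowCongr σ κ)) ∘ σ =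
        rho N ∘ σ + shift μ κ := by
      rw [← shift_comp μ κ σ]
      rfl
    rw [h1, sub_eq_iff_eq_add]
  simp only [this]

/-- The operators multiplying by power sums. -/
def raises {m : ℕ} (μ : Fin m → ℕ) : List (ℤ × ℚ[X]) := List.ofFn fun t => ((μ t : ℤ), 1)

/-- The operators adjoint to multiplication by power sums. -/
def lowers {m : ℕ} (μ : Fin m → ℕ) : List (ℤ × ℚ[X]) := List.ofFn fun t => (-(μ t : ℤ), 1)

theorem totalEnergy_raises {m : ℕ} (μ : Fin m → ℕ) : totalEnergy (raises μ) = ∑ t, (μ t : ℤ) := by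
  simp [totalEnergy, raises, List.map_ofFn, Function.comp_def, List.sum_ofFn]

theorem sum_cons_fun {m N : ℕ} (F : (Fin (m + 1) → Fin N) → ℚ) :
    ∑ κ, F κ = ∑ i, ∑ κ : Fin m → Fin N, F (Fin.cons i κ) := by
  rw [← Equiv.sum_comp (Fin.consEquiv fun _ => Fin N), Fintype.sum_prod_type]
  rfl

theorem update_eq_add_shift {m N : ℕ} (μ : Fin (m + 1) → ℕ) (y : Fin N → ℤ) (i : Fin N)
    (κ : Fin m → Fin N) :
    Function.update y i (y i + μ 0) + shift (fun t => μ t.succ) κ = y + shift μ (Fin.cons i κ) := by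
  ext k
  rcases eq_or_ne k i with rfl | hk
  · simp [shift, Fin.sum_univ_succ, add_assoc]
  · simp [shift, Fin.sum_univ_succ, hk, hk.symm]

theorem update_eq_sub_shift {m N : ℕ} (μ : Fin (m + 1) → ℕ) (y : Fin N → ℤ) (i : Fin N)
    (κ : Fin m → Fin N) :
    Function.update y i (y i - μ 0) - shift (fun t => μ t.succ) κ = y - shift μ (Fin.cons i κ) := by
  ext k
  rcases eq_or_ne k i with rfl | hk
  · simp [shift, Fin.sum_univ_succ, sub_sub]
  · simp [shift, Fin.sum_univ_succ, hk, hk.symm]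

/-- The cutoff only discards new exponents below `-N`, where the corresponding term vanishes anyway
because raising never leads below the range of the state. -/
theorem applyOps_raises {m N : ℕ} (μ : Fin m → ℕ) (hμ : ∀ t, 0 < μ t) :
    applyOps N (raises μ) (slater (rho N)) = psum N μ := by
  induction m with
  | zero => ext u; simp [raises, psum, shift, Pi.sub_def]
  | succ m ih =>
    have hcons : raises μ = ((μ 0 : ℤ), 1) :: raises fun t => μ t.succ := by
      simp [raises, List.ofFn_succ]
    have hH := (inH_slater_rho N).applyOps (raises fun t => μ t.succ)
    rw [ih _ fun t => hμ _] at hH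
    have h0 := hμ 0
    rw [hcons, applyOps_cons, ih _ fun t => hμ _, energyOp_of_ne (by simp; omega)]
    ext u
    rw [oneBody_apply, psum_apply N μ, sum_cons_fun]
    refine Finset.sum_congr rfl fun i _ => ?_
    simp only [← update_eq_sub_shift]
    rw [← psum_apply]
    by_cases hi : -(N : ℤ) ≤ u i
    · simp [cutoff_of_le _ hi]
    · rw [cutoff_of_lt _ (by omega), zero_mul]
      by_contra h
      have := hH.ge _ (Ne.symm h) i
      simp at this
      omega

/-- Unwinding lowering operators from `y` evaluates `w` at larger and larger exponents, so the
cutoff never acts. -/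
theorem applyOps_lowers {m N : ℕ} (μ : Fin m → ℕ) (hμ : ∀ t, 0 < μ t) (w : St N)
    (y : Fin N → ℤ) (hy : ∀ i, -(N : ℤ) ≤ y i) :
    applyOps N (lowers μ) w y = ∑ κ : Fin m → Fin N, w (y + shift μ κ) := by
  induction m generalizing y with
  | zero => simp [lowers, shift, Pi.add_def]
  | succ m ih =>
    have hcons : lowers μ = (-(μ 0 : ℤ), 1) :: lowers fun t => μ t.succ := by
      simp [lowers, List.ofFn_succ]
    have h0 := hμ 0
    rw [hcons, applyOps_cons, energyOp_of_ne (by simp; omega), oneBody_apply, sum_cons_fun]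
    refine Finset.sum_congr rfl fun i _ => ?_
    rw [cutoff_of_le _ (hy i), sub_neg_eq_add, ih _ fun t => hμ _]
    · simp [update_eq_add_shift]
    · intro k
      rcases eq_or_ne k i with rfl | hk
      · have := hy k
        simp
        omega
      · simpa [hk] using hy k

theorem applyOps_lowers_rho {m N d : ℕ} (hN : d ≤ N) (μ : Fin m → ℕ) (hμ : ∀ t, 0 < μ t)
    {w : St N} (hw : InH d w) :
    applyOps N (lowers μ) w (rho N) =
      ∑ lam : d.Partition, psum N μ (exps N lam) * w (exps N lam) := by
  rw [applyOps_lowers μ hμ w _ le_rho]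
  simp_rw [hw.expansion hN (rho N + _)]
  rw [Finset.sum_comm]
  refine Finset.sum_congr rfl fun lam _ => ?_
  rw [← Finset.sum_mul, sum_slater_add_shift]

theorem inH_psum {m N : ℕ} (μ : Fin m → ℕ) (hμ : ∀ t, 0 < μ t) {d : ℕ} (hd : ∑ t, μ t = d) :
    InH d (psum N μ) := by
  have := (inH_slater_rho N).applyOps (raises μ)
  rw [applyOps_raises μ hμ, totalEnergy_raises, zero_add, ← Nat.cast_sum, hd] at this
  exact this

/-! ### Completed cycles act diagonally -/

/-- The polynomial `(X + 1/2)^(r+1) / (r+1)!`. -/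
def cyclePoly (r : ℕ) : ℚ[X] := C (((r + 1).factorial : ℚ)⁻¹) * (X + C (1 / 2)) ^ (r + 1)

theorem shiftedPowerSum_eq {N d : ℕ} (hN : d ≤ N) (k : ℕ) (lam : d.Partition) :
    shiftedPowerSum k lam = ∑ i : Fin N,
      (((exps N lam i : ℚ) + 1 / 2) ^ k - ((rho N i : ℚ) + 1 / 2) ^ k) := by
  set F : ℕ → ℚ := fun i => ((part lam i : ℚ) - ((i : ℕ) + 1 : ℚ) + 1 / 2) ^ k
      - (-((i : ℕ) + 1 : ℚ) + 1 / 2) ^ k with hF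
  have h1 : shiftedPowerSum k lam = ∑ i ∈ Finset.range (rows lam).length, F i := by
    rw [← Fin.sum_univ_eq_sum_range, shiftedPowerSum]
    refine Finset.sum_congr rfl fun i _ => ?_
    simp [hF, part]
  have h2 : (∑ i : Fin N, (((exps N lam i : ℚ) + 1 / 2) ^ k - ((rho N i : ℚ) + 1 / 2) ^ k)) =
      ∑ i ∈ Finset.range N, F i := by
    rw [← Fin.sum_univ_eq_sum_range]
    refine Finset.sum_congr rfl fun i _ => ?_
    simp [hF, exps, rho]
  rw [h1, h2]
  refine Finset.sum_subset (Finset.range_subset_range.mpr ((length_rows_le lam).trans hN)) ?_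
  intro i _ hi
  simp only [hF]
  rw [part_of_length_le lam (by simpa using hi)]
  simp

theorem energyOp_cyclePoly {N d : ℕ} (hN : d ≤ N) (r : ℕ) (w : St N) (lam : d.Partition) :
    energyOp N 0 (cyclePoly r) w (exps N lam) =
      shiftedPowerSum (r + 1) lam / ((r + 1).factorial : ℚ) * w (exps N lam) := by
  rw [energyOp_apply, Pi.sub_apply, oneBody_zero_apply, Pi.smul_apply, if_pos rfl, smul_eq_mul,
    ← sub_mul]
  congr 1
  rw [sum_Ico_neg N fun k => (cyclePoly r).eval (k : ℚ), shiftedPowerSum_eq hN,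
    Finset.sum_congr rfl fun i _ => cutoff_of_le _ (le_exps lam i), ← Finset.sum_sub_distrib,
    Finset.sum_div]
  refine Finset.sum_congr rfl fun i _ => ?_
  simp only [cyclePoly, eval_mul, eval_C, eval_pow, eval_add, eval_X, rho]
  ring

theorem applyOps_cyclePoly {N d : ℕ} (hN : d ≤ N) (r s : ℕ) (w : St N) (lam : d.Partition) :
    applyOps N (List.replicate s (0, cyclePoly r)) w (exps N lam) =
      (shiftedPowerSum (r + 1) lam / ((r + 1).factorial : ℚ)) ^ s * w (exps N lam) := by
  induction s with
  | zero => simp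
  | succ s ih =>
    rw [List.replicate_succ, applyOps_cons, energyOp_cyclePoly hN, ih]
    ring

/-- Sums over partitions as vacuum expectations. -/
theorem sum_psum_eq_vev {m n N d : ℕ} (hN : d ≤ N) (r s : ℕ) (μ : Fin m → ℕ) (ν : Fin n → ℕ)
    (hμ : ∀ t, 0 < μ t) (hν : ∀ t, 0 < ν t) (hd : ∑ t, ν t = d) :
    ∑ lam : d.Partition, psum N μ (exps N lam) *
      (shiftedPowerSum (r + 1) lam / ((r + 1).factorial : ℚ)) ^ s * psum N ν (exps N lam) =
    vev N (lowers μ ++ (List.replicate s (0, cyclePoly r) ++ raises ν)) := by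
  rw [vev, applyOps_append, applyOps_append, applyOps_raises ν hν]
  have h := (inH_psum (N := N) ν hν hd).applyOps (List.replicate s (0, cyclePoly r))
  rw [show totalEnergy (List.replicate s (0, cyclePoly r)) = 0 by simp [totalEnergy],
    add_zero] at h
  rw [applyOps_lowers_rho hN μ hμ h]
  refine Finset.sum_congr rfl fun lam _ => ?_
  rw [applyOps_cyclePoly hN, mul_assoc]

end CompletedHurwitz

end

noncomputable section

namespace CompletedHurwitz

open Polynomial

/-! ### Orthogonality of products of power sums -/

/-- The order of the centralizer of a permutation whose cycle lengths (including `1`s) are `s`. -/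
def zfac (s : Multiset ℕ) : ℕ := s.prod * ∏ n ∈ s.toFinset, (s.count n).factorial

theorem zfac_cons (b : ℕ) (s : Multiset ℕ) : zfac (b ::ₘ s) = b * (s.count b + 1) * zfac s := by
  have h : ∀ t : Multiset ℕ, t ≤ b ::ₘ s → ∏ n ∈ t.toFinset, (t.count n).factorial =
      ∏ n ∈ (b ::ₘ s).toFinset, (t.count n).factorial := by
    intro t ht
    refine Finset.prod_subset (Multiset.toFinset_subset.mpr (Multiset.subset_of_le ht)) ?_
    intro n _ hn
    rw [Multiset.count_eq_zero_of_notMem (by simpa using hn)]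
    rfl
  have hb : b ∈ (b ::ₘ s).toFinset := by simp
  rw [zfac, zfac, Multiset.prod_cons, h s (Multiset.le_cons_self s b),
    ← Finset.mul_prod_erase _ _ hb, ← Finset.mul_prod_erase _ (fun n => (s.count n).factorial) hb,
    Multiset.count_cons_self, Nat.factorial_succ]
  rw [Finset.prod_congr rfl fun n hn => by
    rw [Multiset.count_cons_of_ne (Finset.ne_of_mem_erase hn)]]
  ring

theorem zfac_pos {s : Multiset ℕ} (hs : ∀ a ∈ s, 0 < a) : 0 < zfac s :=
  Nat.mul_pos (Multiset.prod_pos hs) (Finset.prod_pos fun _ _ => Nat.factorial_pos _)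

theorem sum_ite_getElem_eq_count (l : List ℤ) (x : ℤ) :
    ∑ t : Fin l.length, (if l[t] = x then (1 : ℚ) else 0) = l.count x := by
  induction l with
  | nil => simp
  | cons a l ih =>
    simp only [List.length_cons]
    rw [Fin.sum_univ_succ, List.count_cons]
    simp only [Fin.getElem_fin, Fin.val_succ, List.getElem_cons_succ] at ih ⊢
    rw [ih]
    simp only [Fin.val_zero, List.getElem_cons_zero, beq_iff_eq, Nat.cast_add, Nat.cast_ite,
      Nat.cast_one, Nat.cast_zero]
    exact add_comm _ _

/-- The Heisenberg operators of the given energies. -/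
def heis (l : List ℤ) : List (ℤ × ℚ[X]) := l.map fun a => (a, 1)

theorem applyOps_set_zero (N : ℕ) (L : List (ℤ × ℚ[X])) (t : ℕ) (ht : t < L.length) (a : ℤ)
    (w : St N) : applyOps N (L.set t (a, 0)) w = 0 := by
  induction L generalizing t with
  | nil => simp at ht
  | cons o L ih =>
    cases t with
    | zero => simp [energyOp_poly_zero]
    | succ t =>
      rw [List.set_cons_succ, applyOps_cons, ih t (by simpa using ht), map_zero]

/-- Weights equal to one have zero commutator weight, so only the central term survives; it is `∑_{0
≤ k < b} 1 = b`. -/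
theorem vev_heis_append (N : ℕ) (l : List ℤ) (b : ℤ) (hb : 0 < b)
    (hN : absEnergy (heis l) + b ≤ N) :
    vev N (heis l ++ [(b, 1)]) = ∑ t : Fin l.length,
      if l[t] = -b then (b : ℚ) * vev N (heis (l.eraseIdx t)) else 0 := by
  rw [vev_append_of_pos N (heis l) (b, 1) hb hN]
  refine Fintype.sum_equiv (finCongr (by simp [heis])) _ _ fun t => ?_
  have ht : (t : ℕ) < l.length := by simpa [heis] using t.2
  have hget : (heis l)[t] = (l[(t : ℕ)], 1) := List.getElem_map _
  have hcomm : commOp (l[(t : ℕ)], 1) (b, 1) = (l[(t : ℕ)] + b, 0) := by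
    simp [commOp, commWeight]
  rw [hget, hcomm, vev, applyOps_set_zero N _ _ t.2]
  have h1 : (heis l).eraseIdx t = heis (l.eraseIdx t) := by simp [heis, List.eraseIdx_map]
  have h2 : l[(t : ℕ)] + b = 0 ↔ l[(t : ℕ)] = -b := by omega
  have h3 : ((b.toNat : ℕ) : ℚ) = (b : ℚ) := by exact_mod_cast Int.toNat_of_nonneg hb.le
  rw [h1]
  simp [central, h2, h3]

theorem absEnergy_heis (l : List ℤ) : absEnergy (heis l) = (l.map fun a => |a|).sum := by
  simp [absEnergy, heis, Function.comp_def]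

/-- Wick pairing: the last raising operator `b` pairs with each copy of `-b`, giving `b` times the
multiplicity, which is the recursion `zfac_cons`. -/
theorem vev_heis (N : ℕ) (M K : List ℕ) (hM : ∀ a ∈ M, 0 < a) (hK : ∀ a ∈ K, 0 < a)
    (hN : M.sum + K.sum ≤ N) :
    vev N (heis (M.map (fun a : ℕ => -(a : ℤ)) ++ K.map (fun a : ℕ => (a : ℤ)))) =
      if (M : Multiset ℕ) = K then (zfac K : ℚ) else 0 := by
  induction K using List.reverseRecOn generalizing M with
  | nil =>
    rcases List.eq_nil_or_concat' M with rfl | ⟨M, c, rfl⟩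
    · simp [heis, vev_nil, zfac]
    · have h : heis ((M ++ [c]).map (fun a : ℕ => -(a : ℤ)) ++ [].map (fun a : ℕ => (a : ℤ))) =
          heis (M.map fun a : ℕ => -(a : ℤ)) ++ [(-(c : ℤ), 1)] := by simp [heis]
      rw [h, vev_append_of_nonpos _ _ _ (by simp), if_neg]
      simp
  | append_singleton K b ih =>
    have hb : 0 < b := hK b (by simp)
    have hK' : ∀ a ∈ K, 0 < a := fun a ha => hK a (by simp [ha])
    set l : List ℤ := M.map (fun a : ℕ => -(a : ℤ)) ++ K.map (fun a : ℕ => (a : ℤ)) with hl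
    have h : heis (M.map (fun a : ℕ => -(a : ℤ)) ++ (K ++ [b]).map (fun a : ℕ => (a : ℤ))) =
        heis l ++ [((b : ℤ), 1)] := by simp [heis, hl]
    have habs : absEnergy (heis l) + b ≤ N := by
      rw [absEnergy_heis, hl]
      simp only [List.map_append, List.map_map, Function.comp_def, abs_neg, Nat.abs_cast,
        List.sum_append]
      have h1 : ∀ l : List ℕ, (l.map fun a : ℕ => (a : ℤ)).sum = (l.sum : ℤ) := fun l => by
        simp
      rw [h1, h1]
      simp only [List.sum_append, List.sum_singleton] at hN
      omega
    rw [h, vev_heis_append N l b (by omega) habs]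
    -- All admissible partners of `b` give the same value, so the sum over `t` reduces to counting
    -- them.
    have hterm : ∀ t : Fin l.length, (if l[t] = -(b : ℤ) then
        ((b : ℤ) : ℚ) * vev N (heis (l.eraseIdx t)) else 0) =
        (b : ℚ) * (if (M : Multiset ℕ) = (b ::ₘ (K : Multiset ℕ)) then (zfac K : ℚ) else 0) *
          (if l[t] = -(b : ℤ) then 1 else 0) := by
      intro t
      split_ifs with h1 h2 h2
      all_goals try simp
      all_goals
        have htM : (t : ℕ) < M.length := by
          by_contra hcon
          simp only [hl, Fin.getElem_fin] at h1
          rw [List.getElem_append_right (by simpa using hcon)] at h1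
          simp at h1
          omega
        have hMt : M[(t : ℕ)] = b := by
          simp only [hl, Fin.getElem_fin] at h1
          rw [List.getElem_append_left (by simpa using htM)] at h1
          simpa using h1
        have herase : l.eraseIdx t = (M.eraseIdx t).map (fun a : ℕ => -(a : ℤ)) ++
            K.map (fun a : ℕ => (a : ℤ)) := by
          conv_lhs => rw [show l.eraseIdx (t : ℕ) = (M.map (fun a : ℕ => -(a : ℤ)) ++
            K.map (fun a : ℕ => (a : ℤ))).eraseIdx (t : ℕ) from rfl]
          rw [List.eraseIdx_append_of_lt_length (by simpa using htM), List.eraseIdx_map]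
        have hperm : (M : Multiset ℕ) = b ::ₘ (M.eraseIdx t : Multiset ℕ) := by
          rw [Multiset.cons_coe, Multiset.coe_eq_coe, ← hMt]
          exact (List.getElem_cons_eraseIdx_perm htM).symm
        have hsum : M.sum = b + (M.eraseIdx t).sum := by
          have := congrArg Multiset.sum hperm
          simpa using this
        have := ih (M.eraseIdx t) (fun a ha => hM a (List.mem_of_mem_eraseIdx ha)) hK' (by
          simp only [List.sum_append, List.sum_singleton] at hN
          omega)
        rw [herase, this]
        rw [hperm, Multiset.cons_inj_right] at h2
        simp [h2]
    rw [Finset.sum_congr rfl fun t _ => hterm t, ← Finset.mul_sum, sum_ite_getElem_eq_count]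
    have hKb : ((K ++ [b] : List ℕ) : Multiset ℕ) = b ::ₘ (K : Multiset ℕ) := by
      rw [Multiset.cons_coe, Multiset.coe_eq_coe]
      exact List.perm_append_singleton b K
    rw [hKb]
    split_ifs with h1
    · have hc : l.count (-(b : ℤ)) = (K : Multiset ℕ).count b + 1 := by
        have h2 : l.count (-(b : ℤ)) = M.count b := by
          rw [hl, List.count_append]
          have h3 : (K.map fun a : ℕ => (a : ℤ)).count (-(b : ℤ)) = 0 := by
            rw [List.count_eq_zero]
            intro hmem
            obtain ⟨a, _, ha⟩ := List.mem_map.mp hmem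
            omega
          rw [h3, add_zero]
          exact List.count_map_of_injective M (fun a : ℕ => -(a : ℤ))
            (fun x y hxy => by simpa using hxy) b
        rw [h2, ← Multiset.coe_count, h1, Multiset.count_cons_self]
      rw [hc, zfac_cons]
      push_cast
      ring
    · simp

/-- The parts of a partition as a tuple. -/
def partsTuple {d : ℕ} (mu : d.Partition) : Fin (rows mu).length → ℕ := fun t => (rows mu)[t]

theorem partsTuple_pos {d : ℕ} (mu : d.Partition) (t) : 0 < partsTuple mu t :=
  pos_of_mem_rows (List.getElem_mem _)

theorem ofFn_partsTuple {d : ℕ} (mu : d.Partition) : List.ofFn (partsTuple mu) = rows mu := by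
  exact List.ofFn_getElem

theorem sum_partsTuple {d : ℕ} (mu : d.Partition) : ∑ t, partsTuple mu t = d := by
  rw [← List.sum_ofFn, ofFn_partsTuple, sum_rows]

theorem map_partsTuple {d : ℕ} (mu : d.Partition) :
    Finset.univ.val.map (partsTuple mu) = mu.parts := by
  have h := ofFn_partsTuple mu
  rw [List.ofFn_eq_map] at h
  conv_rhs => rw [← coe_rows, ← h]
  rfl

theorem sum_psum_mul_psum {N d : ℕ} (hN : d + d ≤ N) (mu nu : d.Partition) :
    ∑ lam : d.Partition, psum N (partsTuple mu) (exps N lam) * psum N (partsTuple nu) (exps N lam) =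
      if mu = nu then (zfac nu.parts : ℚ) else 0 := by
  have h := sum_psum_eq_vev (N := N) (by omega) 0 0 (partsTuple mu) (partsTuple nu)
    (partsTuple_pos mu) (partsTuple_pos nu) (sum_partsTuple nu)
  have h1 : lowers (partsTuple mu) ++ (List.replicate 0 (0, cyclePoly 0) ++
      raises (partsTuple nu)) = heis ((rows mu).map (fun a : ℕ => -(a : ℤ)) ++
        (rows nu).map (fun a : ℕ => (a : ℤ))) := by
    have h2 : lowers (partsTuple mu) =
        heis ((List.ofFn (partsTuple mu)).map fun a : ℕ => -(a : ℤ)) := by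
      simp [lowers, heis, List.map_ofFn, Function.comp_def]
    have h3 : raises (partsTuple nu) =
        heis ((List.ofFn (partsTuple nu)).map fun a : ℕ => (a : ℤ)) := by
      simp [raises, heis, List.map_ofFn, Function.comp_def]
    rw [h2, h3, ofFn_partsTuple, ofFn_partsTuple]
    simp [heis]
  rw [h1, vev_heis N _ _ (fun _ => pos_of_mem_rows) (fun _ => pos_of_mem_rows)
    (by rw [sum_rows, sum_rows]; exact hN)] at h
  simp only [pow_zero, mul_one, coe_rows] at h
  rw [h]
  simp only [Nat.Partition.ext_iff]

/-- The relation summed over `lam` says that a square matrix has a left inverse; being also a right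
inverse, it gives the dual relation summed over `mu`. -/
theorem sum_psum_sq {N d : ℕ} (hN : d + d ≤ N) (lam : d.Partition) :
    ∑ mu : d.Partition, psum N (partsTuple mu) (exps N lam) ^ 2 / (zfac mu.parts : ℚ) = 1 := by
  classical
  set A : Matrix d.Partition d.Partition ℚ :=
    Matrix.of fun lam mu => psum N (partsTuple mu) (exps N lam) with hA
  set B : Matrix d.Partition d.Partition ℚ :=
    Matrix.of fun mu lam => psum N (partsTuple mu) (exps N lam) / (zfac mu.parts : ℚ) with hB
  have h1 : B * A = 1 := by
    ext mu nu
    rw [Matrix.mul_apply, Matrix.one_apply]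
    have h2 := sum_psum_mul_psum hN mu nu
    simp only [hA, hB, Matrix.of_apply, div_mul_eq_mul_div]
    rw [← Finset.sum_div, h2]
    have h3 : (zfac nu.parts : ℚ) ≠ 0 := by
      exact_mod_cast (zfac_pos fun _ ha => nu.parts_pos ha).ne'
    split_ifs with h
    · rw [h, div_self h3]
    · simp
  have h2 := congrFun (congrFun (show A * B = 1 from mul_eq_one_comm.mp h1) lam) lam
  rw [Matrix.mul_apply, Matrix.one_apply_eq] at h2
  rw [← h2]
  refine Finset.sum_congr rfl fun mu _ => ?_
  simp only [hA, hB, Matrix.of_apply]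
  ring

theorem zfac_add_replicate (m : Multiset ℕ) (hm : 1 ∉ m) (k : ℕ) :
    zfac (m + Multiset.replicate k 1) = k.factorial * zfac m := by
  induction k with
  | zero => simp
  | succ k ih =>
    rw [Multiset.replicate_succ, Multiset.add_cons, zfac_cons, ih, Multiset.count_add,
      Multiset.count_eq_zero_of_notMem hm, Multiset.count_replicate_self, Nat.factorial_succ]
    ring

theorem card_partition_eq {d : ℕ} (mu : d.Partition) :
    (Finset.univ.filter fun g : Equiv.Perm (Fin d) => g.partition.parts = mu.parts).card *
      zfac mu.parts = d.factorial := by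
  obtain ⟨g, hg⟩ := exists_perm_of_partition mu
  have h := Equiv.Perm.card_of_cycleType_mul_eq (Fin d) g.cycleType
  rw [if_pos ⟨g.sum_cycleType_le, fun a => Equiv.Perm.two_le_of_mem_cycleType⟩,
    Fintype.card_fin] at h
  rw [← h]
  have h1 : (Finset.univ.filter fun g : Equiv.Perm (Fin d) => g.partition.parts = mu.parts) =
      Finset.univ.filter fun g' : Equiv.Perm (Fin d) => g'.cycleType = g.cycleType := by
    ext g'
    simp only [Finset.mem_filter, Finset.mem_univ, true_and, ← hg,
      ← Equiv.Perm.isConj_iff_cycleType_eq, Equiv.Perm.partition_eq_of_isConj,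
      Nat.Partition.ext_iff]
  rw [h1, ← hg, Equiv.Perm.parts_partition, zfac_add_replicate _ (fun h => by
    have := Equiv.Perm.two_le_of_mem_cycleType h
    omega), Equiv.Perm.sum_cycleType, Fintype.card_fin, zfac]
  ring

end CompletedHurwitz

end

noncomputable section

namespace CompletedHurwitz

open Polynomial

/-! ### Invariant colourings -/

theorem exists_equiv_of_map_eq {ι ι' : Type*} [Fintype ι] [Fintype ι'] {f : ι → ℕ} {g : ι' → ℕ}
    (h : Finset.univ.val.map f = Finset.univ.val.map g) : ∃ e : ι ≃ ι', ∀ t, g (e t) = f t := by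
  classical
  have hcard : ∀ k, Nonempty ({t // f t = k} ≃ {t // g t = k}) := by
    intro k
    rw [← Fintype.card_eq, Fintype.card_subtype, Fintype.card_subtype]
    have h1 := congrArg (Multiset.count k) h
    rw [Multiset.count_map, Multiset.count_map] at h1
    simpa [Finset.card_def, eq_comm] using h1
  exact ⟨Equiv.ofFiberEquiv fun k => (hcard k).some, fun t => Equiv.ofFiberEquiv_map _ t⟩

/-- The power sum product attached to a permutation: the sum over the invariant colourings. -/
def permSum {d : ℕ} (N : ℕ) (g : Equiv.Perm (Fin d)) : St N :=
  fun u => ∑ κ : Fin d → Fin N with κ ∘ g = κ, slater (rho N) (u - shift (fun _ => 1) κ)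

theorem apply_eq_of_sameCycle {α β : Type*} {g : Equiv.Perm α} {κ : α → β} (h : κ ∘ g = κ)
    {x y : α} (hxy : g.SameCycle x y) : κ x = κ y := by
  have hn : ∀ (n : ℕ) (x : α), κ ((g ^ n) x) = κ x := by
    intro n
    induction n with
    | zero => simp
    | succ n ih =>
      intro x
      rw [pow_succ, Equiv.Perm.mul_apply, ih]
      exact congrFun h x
  obtain ⟨i, rfl⟩ := hxy
  rcases Int.eq_nat_or_neg i with ⟨n, rfl | rfl⟩
  · rw [zpow_natCast, hn]
  · have := hn n ((g ^ (-(n : ℤ))) x)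
    rw [← this, ← Equiv.Perm.mul_apply, ← zpow_natCast, ← zpow_add]
    simp

/-- Invariant colourings are the colourings of the set of cycles, and a cycle of length `k` with
colour `i` shifts the `i`-th exponent by `k`. -/
theorem permSum_eq_psum_of_orbits {d N : ℕ} (g : Equiv.Perm (Fin d)) {ι : Type*} [Fintype ι]
    [DecidableEq ι] (q : Fin d → ι) (hq : Function.Surjective q) (hg : ∀ x, q (g x) = q x)
    (hc : ∀ x y, q x = q y → g.SameCycle x y) (size : ι → ℕ)
    (hsize : ∀ t, size t = (Finset.univ.filter fun x => q x = t).card) :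
    permSum N g = psum N size := by
  ext u
  rw [permSum, psum]
  symm
  refine Finset.sum_bij (fun κ _ => κ ∘ q) ?_ ?_ ?_ ?_
  · intro κ _
    simp only [Finset.mem_filter, Finset.mem_univ, true_and]
    ext x
    simp [hg]
  · intro κ _ κ' _ h
    exact hq.injective_comp_right h
  · intro κ hκ
    have hκ' := (Finset.mem_filter.mp hκ).2
    refine ⟨κ ∘ Function.surjInv hq, Finset.mem_univ _, ?_⟩
    ext x
    simp only [Function.comp]
    rw [apply_eq_of_sameCycle hκ' (hc _ x (Function.surjInv_eq hq (q x)))]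
  · intro κ _
    congr 2
    ext i
    simp only [shift, Function.comp]
    rw [← Finset.sum_fiberwise Finset.univ q]
    refine Finset.sum_congr rfl fun t _ => ?_
    rw [Finset.sum_congr rfl fun x hx => by rw [(Finset.mem_filter.mp hx).2]]
    rw [Finset.sum_const, hsize]
    split_ifs <;> simp

theorem permSum_eq_psum {d N : ℕ} (g : Equiv.Perm (Fin d)) {ι : Type*} [Fintype ι]
    [DecidableEq ι] (μ : ι → ℕ) (hμ : Finset.univ.val.map μ = g.partition.parts) :
    permSum N g = psum N μ := by
  classical
  -- Cycle factors omit fixed points, which are added as orbits of size one.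
  set q : Fin d → g.cycleFactorsFinset ⊕ {x : Fin d // x ∉ g.support} := fun x =>
    if hx : x ∈ g.support then
      Sum.inl ⟨g.cycleOf x, Equiv.Perm.cycleOf_mem_cycleFactorsFinset_iff.mpr hx⟩
    else Sum.inr ⟨x, hx⟩ with hq
  have hql : ∀ (x : Fin d) (c : g.cycleFactorsFinset), q x = Sum.inl c ↔ x ∈ c.1.support := by
    intro x c
    simp only [hq]
    split_ifs with hx
    · rw [Sum.inl.injEq, Subtype.ext_iff]
      constructor
      · intro h
        rw [← h, Equiv.Perm.mem_support_cycleOf_iff]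
        exact ⟨Equiv.Perm.SameCycle.refl _ _, hx⟩
      · intro h
        exact (Equiv.Perm.cycle_is_cycleOf h c.2).symm
    · simp only [false_iff]
      exact fun h => hx (Equiv.Perm.mem_cycleFactorsFinset_support_le c.2 h)
  have hqr : ∀ (x : Fin d) (y : {x : Fin d // x ∉ g.support}), q x = Sum.inr y ↔ x = y := by
    intro x y
    simp only [hq]
    split_ifs with hx
    · simp only [false_iff]
      rintro rfl
      exact y.2 hx
    · rw [Sum.inr.injEq, Subtype.ext_iff]
  set size : g.cycleFactorsFinset ⊕ {x : Fin d // x ∉ g.support} → ℕ :=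
    Sum.elim (fun c => c.1.support.card) fun _ => 1 with hsize
  have h1 : permSum N g = psum N size := by
    refine permSum_eq_psum_of_orbits g q ?_ ?_ ?_ size ?_
    · rintro (c | x)
      · obtain ⟨x, hx⟩ := (Equiv.Perm.mem_cycleFactorsFinset_iff.mp c.2).1.nonempty_support
        exact ⟨x, (hql x c).mpr hx⟩
      · exact ⟨x, (hqr _ x).mpr rfl⟩
    · intro x
      rcases hx : q x with c | y
      · rw [hql] at hx ⊢
        have hc := Equiv.Perm.cycle_is_cycleOf hx c.2
        rw [hc, Equiv.Perm.mem_support_cycleOf_iff] at hx ⊢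
        exact ⟨Equiv.Perm.sameCycle_apply_right.mpr hx.1, hx.2⟩
      · rw [hqr] at hx ⊢
        have := y.2
        rw [Equiv.Perm.notMem_support] at this
        rw [hx, this]
    · intro x y hxy
      rcases hy : q y with c | z
      · rw [hy, hql] at hxy
        rw [hql] at hy
        rw [Equiv.Perm.cycle_is_cycleOf hy c.2, Equiv.Perm.mem_support_cycleOf_iff] at hxy
        exact hxy.1.symm
      · rw [hy, hqr] at hxy
        rw [hqr] at hy
        rw [hxy, hy]
    · rintro (c | x)
      · simp only [hsize, Sum.elim_inl, hql]
        congr 1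
        ext x
        simp
      · simp only [hsize, Sum.elim_inr, hqr]
        rw [Finset.card_eq_one.mpr ⟨x.1, by ext y; simp⟩]
  have h2 : Finset.univ.val.map size = g.partition.parts := by
    rw [Equiv.Perm.parts_partition, ← Finset.univ_disjSum_univ]
    simp only [Finset.disjSum, Multiset.disjSum, Multiset.map_add, Multiset.map_map,
      Function.comp_def, hsize, Sum.elim_inl, Sum.elim_inr]
    congr 1
    · rw [Equiv.Perm.cycleType_def]
      change Multiset.map _ g.cycleFactorsFinset.attach.val = _
      rw [Finset.attach_val]
      exact Multiset.attach_map_val' g.cycleFactorsFinset.val fun c => c.support.card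
    · rw [Multiset.map_const']
      congr 1
      rw [← Finset.card_def, Finset.card_univ, Fintype.card_subtype_compl, Fintype.card_coe]
  obtain ⟨e, he⟩ := exists_equiv_of_map_eq (h2.trans hμ.symm)
  rw [h1, psum_congr N e he]

/-- Group the permutations by cycle type: a class has `d! / zfac` elements, and the weighted sum
over classes is `sum_psum_sq`. -/
theorem sum_permSum_sq {N d : ℕ} (hN : d + d ≤ N) (lam : d.Partition) :
    ∑ g : Equiv.Perm (Fin d), permSum N g (exps N lam) ^ 2 = d.factorial := by
  classical
  have hpart : ∀ g : Equiv.Perm (Fin d), ∃ mu : d.Partition, mu.parts = g.partition.parts := by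
    intro g
    exact ⟨⟨g.partition.parts, fun h => g.partition.parts_pos h,
      by rw [g.partition.parts_sum, Fintype.card_fin]⟩, rfl⟩
  choose P hP using hpart
  rw [← Finset.sum_fiberwise Finset.univ P]
  have key : ∀ mu : d.Partition,
      ∑ g : Equiv.Perm (Fin d) with P g = mu, permSum N g (exps N lam) ^ 2 =
        d.factorial * (psum N (partsTuple mu) (exps N lam) ^ 2 / (zfac mu.parts : ℚ)) := by
    intro mu
    have h1 : ∀ g ∈ Finset.univ.filter (fun g : Equiv.Perm (Fin d) => P g = mu),
        permSum N g (exps N lam) ^ 2 = psum N (partsTuple mu) (exps N lam) ^ 2 := by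
      intro g hg
      rw [permSum_eq_psum g (partsTuple mu)]
      rw [map_partsTuple, ← hP g, (Finset.mem_filter.mp hg).2]
    have h2 : (Finset.univ.filter fun g : Equiv.Perm (Fin d) => P g = mu) =
        Finset.univ.filter fun g : Equiv.Perm (Fin d) => g.partition.parts = mu.parts := by
      ext g
      simp only [Finset.mem_filter, Finset.mem_univ, true_and, Nat.Partition.ext_iff, hP]
    rw [Finset.sum_congr rfl h1, Finset.sum_const, h2, nsmul_eq_mul, ← card_partition_eq mu]
    have h3 : (zfac mu.parts : ℚ) ≠ 0 := by
      exact_mod_cast (zfac_pos fun _ ha => mu.parts_pos ha).ne'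
    push_cast
    field_simp
  rw [Finset.sum_congr rfl fun mu _ => key mu, ← Finset.mul_sum, sum_psum_sq hN, mul_one]

theorem permSum_conj {d : ℕ} (N : ℕ) (g h : Equiv.Perm (Fin d)) :
    permSum N (h * g * h⁻¹) = permSum N g := by
  ext u
  simp only [permSum]
  refine Finset.sum_bij' (fun κ _ => κ ∘ h) (fun κ _ => κ ∘ (h⁻¹ : Equiv.Perm (Fin d))) ?_ ?_ ?_ ?_ ?_
  · intro κ hκ
    have hκ' := (Finset.mem_filter.mp hκ).2
    simp only [Finset.mem_filter, Finset.mem_univ, true_and]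
    funext x
    have := congrFun hκ' (h x)
    simpa using this
  · intro κ hκ
    have hκ' := (Finset.mem_filter.mp hκ).2
    simp only [Finset.mem_filter, Finset.mem_univ, true_and]
    funext x
    have := congrFun hκ' (h⁻¹ x)
    simpa using this
  · intro κ _
    ext x
    simp
  · intro κ _
    ext x
    simp
  · intro κ _
    congr 2
    ext i
    simp only [shift]
    rw [← Equiv.sum_comp h]
    rfl

end CompletedHurwitz

end

noncomputable section

namespace CompletedHurwitz

/-! ### Fillings of Young diagrams -/

theorem mem_diagram {d : ℕ} (lam : d.Partition) (i j : ℕ) :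
    (i, j) ∈ diagram lam ↔ j < part lam i := by
  rw [diagram, YoungDiagram.mem_ofRowLens]
  constructor
  · rintro ⟨h1, h2⟩
    simpa [part, h1] using h2
  · intro h
    have h1 : i < (rows lam).length := by
      by_contra hcon
      rw [part_of_length_le lam (by omega)] at h
      omega
    exact ⟨h1, by simpa [part, h1] using h⟩

theorem tableau_mem {d : ℕ} (lam : d.Partition) (x : Fin d) :
    (rowOf lam x, colOf lam x) ∈ diagram lam := (tableau lam x).2

theorem eq_of_rowOf_eq_of_colOf_eq {d : ℕ} {lam : d.Partition} {x y : Fin d}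
    (h1 : rowOf lam x = rowOf lam y) (h2 : colOf lam x = colOf lam y) : x = y :=
  (tableau lam).injective (Subtype.ext (Prod.ext h1 h2))

theorem exists_entry {d : ℕ} {lam : d.Partition} {i j : ℕ} (h : (i, j) ∈ diagram lam) :
    ∃ x, rowOf lam x = i ∧ colOf lam x = j :=
  ⟨(tableau lam).symm ⟨(i, j), h⟩, by simp [rowOf], by simp [colOf]⟩

theorem card_rowOf_eq {d : ℕ} (lam : d.Partition) (i : ℕ) :
    (Finset.univ.filter fun x => rowOf lam x = i).card = part lam i := by
  rw [← Finset.card_range (part lam i)]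
  refine Finset.card_bij (fun x _ => colOf lam x) ?_ ?_ ?_
  · intro x hx
    rw [Finset.mem_range, ← mem_diagram, ← (Finset.mem_filter.mp hx).2]
    exact tableau_mem lam x
  · intro x hx y hy h
    exact eq_of_rowOf_eq_of_colOf_eq
      ((Finset.mem_filter.mp hx).2.trans (Finset.mem_filter.mp hy).2.symm) h
  · intro j hj
    rw [Finset.mem_range, ← mem_diagram] at hj
    obtain ⟨x, h1, h2⟩ := exists_entry hj
    exact ⟨x, by simp [h1], h2⟩

/-- A colouring is column-injective if entries in one column have different colours. -/
def ColInjective {d : ℕ} (lam : d.Partition) (κ : Fin d → ℕ) : Prop :=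
  ∀ x y, colOf lam x = colOf lam y → κ x = κ y → x = y

/-- If the column reaches row `m`, the right side is `m`, the number of available colours; otherwise
the right side counts the whole column. -/
theorem ColInjective.card_col_le {d : ℕ} {lam : d.Partition} {κ : Fin d → ℕ}
    (h : ColInjective lam κ) (m j : ℕ) :
    (Finset.univ.filter fun x => colOf lam x = j ∧ κ x < m).card ≤
      (Finset.univ.filter fun x => colOf lam x = j ∧ rowOf lam x < m).card := by
  by_cases hex : ∃ x, colOf lam x = j ∧ m ≤ rowOf lam x
  · obtain ⟨x, hx1, hx2⟩ := hex
    have h1 : (Finset.univ.filter fun x => colOf lam x = j ∧ κ x < m).card ≤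
        (Finset.range m).card := by
      refine Finset.card_le_card_of_injOn κ ?_ ?_
      · intro y hy
        simp at hy ⊢
        exact hy.2
      · intro y hy z hz hyz
        simp only [Finset.coe_filter, Finset.mem_univ, true_and, Set.mem_ofPred_eq] at hy hz
        exact h y z (hy.1.trans hz.1.symm) hyz
    have hmem : ∀ i, i < m → (i, j) ∈ diagram lam := by
      intro i hi
      refine (diagram lam).up_left_mem (i2 := rowOf lam x) (j2 := colOf lam x) (by omega) hx1.ge
        (tableau_mem lam x)
    refine h1.trans ?_
    refine Finset.card_le_card_of_surjOn (rowOf lam) ?_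
    intro i hi
    simp only [Finset.coe_range, Set.mem_Iio] at hi
    obtain ⟨y, hy1, hy2⟩ := exists_entry (hmem i hi)
    exact ⟨y, by simp [hy1, hy2, hi], hy1⟩
  · push Not at hex
    refine Finset.card_le_card fun x hx => ?_
    simp only [Finset.mem_filter, Finset.mem_univ, true_and] at hx ⊢
    exact ⟨hx.1, hex x hx.1⟩

theorem card_lt_eq_sum_col {d : ℕ} (lam : d.Partition) (κ : Fin d → ℕ) (m : ℕ) :
    (Finset.univ.filter fun x => κ x < m).card =
      ∑ j ∈ Finset.univ.image (colOf lam),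
        (Finset.univ.filter fun x => colOf lam x = j ∧ κ x < m).card := by
  rw [Finset.card_eq_sum_card_fiberwise (f := colOf lam) (t := Finset.univ.image (colOf lam))
    fun x _ => by simp]
  refine Finset.sum_congr rfl fun j _ => ?_
  rw [Finset.filter_filter]
  congr 1
  ext x
  simp [and_comm]

theorem card_lt_eq_sum {d : ℕ} (κ : Fin d → ℕ) (m : ℕ) :
    (Finset.univ.filter fun x => κ x < m).card =
      ∑ i ∈ Finset.range m, (Finset.univ.filter fun x => κ x = i).card := by
  rw [Finset.card_eq_sum_card_fiberwise (f := κ) (t := Finset.range m) fun x hx => by simpa using hx]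
  refine Finset.sum_congr rfl fun i hi => ?_
  rw [Finset.filter_filter]
  congr 1
  ext x
  simp only [Finset.mem_filter, Finset.mem_univ, true_and, and_iff_right_iff_imp]
  rintro rfl
  simpa using hi

/-- The content of a column-injective filling is dominated by the shape: add up the bounds for the
columns. -/
theorem ColInjective.sum_card_le {d : ℕ} {lam : d.Partition} {κ : Fin d → ℕ}
    (h : ColInjective lam κ) (m : ℕ) :
    ∑ i ∈ Finset.range m, (Finset.univ.filter fun x => κ x = i).card ≤
      ∑ i ∈ Finset.range m, part lam i := by
  rw [← card_lt_eq_sum, ← Finset.sum_congr rfl fun i _ => card_rowOf_eq lam i, ← card_lt_eq_sum,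
    card_lt_eq_sum_col lam, card_lt_eq_sum_col lam (rowOf lam)]
  exact Finset.sum_le_sum fun j _ => h.card_col_le m j

/-- Equality in the dominance bound forces equality in every column, so each column carries the same
colours as `rowOf` and can be rearranged within itself. -/
theorem ColInjective.exists_perm {d : ℕ} {lam : d.Partition} {κ : Fin d → ℕ}
    (h : ColInjective lam κ)
    (hc : ∀ i, (Finset.univ.filter fun x => κ x = i).card = part lam i) :
    ∃ q : Equiv.Perm (Fin d), (∀ x, colOf lam (q x) = colOf lam x) ∧
      ∀ x, rowOf lam (q x) = κ x := by
  have h1 : ∀ m j, (Finset.univ.filter fun x => colOf lam x = j ∧ κ x < m).card =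
      (Finset.univ.filter fun x => colOf lam x = j ∧ rowOf lam x < m).card := by
    intro m j
    by_cases hj : j ∈ Finset.univ.image (colOf lam)
    · have h2 : ∑ j ∈ Finset.univ.image (colOf lam),
          (Finset.univ.filter fun x => colOf lam x = j ∧ κ x < m).card =
          ∑ j ∈ Finset.univ.image (colOf lam),
          (Finset.univ.filter fun x => colOf lam x = j ∧ rowOf lam x < m).card := by
        rw [← card_lt_eq_sum_col, ← card_lt_eq_sum_col, card_lt_eq_sum, card_lt_eq_sum]
        simp_rw [hc, card_rowOf_eq]
      exact (Finset.sum_eq_sum_iff_of_le fun j _ => h.card_col_le m j).mp h2 j hj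
    · have h2 : ∀ x, colOf lam x ≠ j := fun x hx => hj (Finset.mem_image.mpr ⟨x, by simp, hx⟩)
      simp [h2]
  have h2 : ∀ (f : Fin d → ℕ) (i j : ℕ),
      (Finset.univ.filter fun x => colOf lam x = j ∧ f x < i + 1).card =
      (Finset.univ.filter fun x => colOf lam x = j ∧ f x < i).card +
      (Finset.univ.filter fun x => colOf lam x = j ∧ f x = i).card := by
    intro f i j
    rw [← Finset.card_union_of_disjoint]
    · congr 1
      ext x
      simp only [Finset.mem_filter, Finset.mem_univ, true_and, Finset.mem_union]
      omega
    · rw [Finset.disjoint_filter]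
      omega
  have h3 : ∀ c : ℕ × ℕ, Nonempty ({x // (κ x, colOf lam x) = c} ≃
      {x // (rowOf lam x, colOf lam x) = c}) := by
    rintro ⟨i, j⟩
    rw [← Fintype.card_eq, Fintype.card_subtype, Fintype.card_subtype]
    have h4 := h1 (i + 1) j
    rw [h2, h2, h1 i j] at h4
    have h5 := Nat.add_left_cancel h4
    simp only [Prod.mk.injEq]
    simp only [and_comm (a := colOf lam _ = j)] at h5
    exact h5
  refine ⟨Equiv.ofFiberEquiv fun c => (h3 c).some, fun x => ?_, fun x => ?_⟩
  · exact (Prod.ext_iff.mp (Equiv.ofFiberEquiv_map (fun c => (h3 c).some) x)).2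
  · exact (Prod.ext_iff.mp (Equiv.ofFiberEquiv_map (fun c => (h3 c).some) x)).1

/-! ### Young symmetrizers -/

open MonoidAlgebra in
theorem coeff_of_mul {d : ℕ} (g h : Equiv.Perm (Fin d))
    (x : MonoidAlgebra ℚ (Equiv.Perm (Fin d))) :
    (of ℚ (Equiv.Perm (Fin d)) g * x).coeff h = x.coeff (g⁻¹ * h) := by
  rw [of_apply, coeff_single_mul_eq_mul_coeff (g⁻¹ * h) fun m _ => eq_inv_mul_iff_mul_eq.symm,
    one_mul]

open MonoidAlgebra in
theorem eq_sum_coeff {d : ℕ} (x : MonoidAlgebra ℚ (Equiv.Perm (Fin d))) :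
    x = ∑ g, x.coeff g • of ℚ (Equiv.Perm (Fin d)) g := by
  classical
  ext h
  simp only [coeff_sum, coeff_smul, of_apply, coeff_single, Finsupp.coe_finsetSum,
    Finset.sum_apply, Finsupp.smul_apply, Finsupp.single_apply, smul_eq_mul]
  simp

theorem coeff_mul_eq_sum {d : ℕ} (x y : MonoidAlgebra ℚ (Equiv.Perm (Fin d)))
    (h : Equiv.Perm (Fin d)) : (x * y).coeff h = ∑ g, x.coeff g * y.coeff (g⁻¹ * h) := by
  conv_lhs => rw [eq_sum_coeff x, Finset.sum_mul]
  simp only [MonoidAlgebra.coeff_sum, Finsupp.coe_finsetSum, Finset.sum_apply,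
    smul_mul_assoc, MonoidAlgebra.coeff_smul, Finsupp.smul_apply, coeff_of_mul, smul_eq_mul]

open Classical in
/-- The sum of all permutations preserving a colouring. -/
def colorSum {d : ℕ} (κ : Fin d → ℕ) : MonoidAlgebra ℚ (Equiv.Perm (Fin d)) :=
  ∑ p : Equiv.Perm (Fin d) with ∀ k, κ (p k) = κ k, MonoidAlgebra.of ℚ (Equiv.Perm (Fin d)) p

theorem rowSymmetrizer_eq {d : ℕ} (lam : d.Partition) :
    rowSymmetrizer lam = colorSum (rowOf lam) := rfl

theorem colorSum_mul_of {d : ℕ} (κ : Fin d → ℕ) (g : Equiv.Perm (Fin d)) :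
    colorSum κ * MonoidAlgebra.of ℚ _ g = MonoidAlgebra.of ℚ _ g * colorSum (κ ∘ g) := by
  classical
  simp only [colorSum, Finset.sum_mul, Finset.mul_sum, ← map_mul]
  refine Finset.sum_bij' (fun p _ => g⁻¹ * p * g) (fun p _ => g * p * g⁻¹) ?_ ?_ ?_ ?_ ?_
  · intro p hp
    simp only [Finset.mem_filter, Finset.mem_univ, true_and] at hp ⊢
    intro k
    simp [hp]
  · intro p hp
    simp only [Finset.mem_filter, Finset.mem_univ, true_and] at hp ⊢
    intro k
    have := hp (g⁻¹ k)
    simpa using this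
  · intro p _
    group
  · intro p _
    group
  · intro p _
    congr 1
    group

theorem of_mul_colorSum {d : ℕ} {κ : Fin d → ℕ} {g : Equiv.Perm (Fin d)} (hg : ∀ k, κ (g k) = κ k) :
    MonoidAlgebra.of ℚ _ g * colorSum κ = colorSum κ := by
  classical
  simp only [colorSum, Finset.mul_sum, ← map_mul]
  refine Finset.sum_bij' (fun p _ => g * p) (fun p _ => g⁻¹ * p) ?_ ?_ ?_ ?_ ?_
  · intro p hp
    simp only [Finset.mem_filter, Finset.mem_univ, true_and] at hp ⊢
    intro k
    simp [hg, hp]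
  · intro p hp
    simp only [Finset.mem_filter, Finset.mem_univ, true_and] at hp ⊢
    intro k
    have := hg (g⁻¹ (p k))
    simp only [Equiv.Perm.mul_apply, ← this]
    simp [hp]
  · intro p _
    group
  · intro p _
    group
  · intro p _
    rfl

theorem colorSum_mul_of_eq {d : ℕ} {κ : Fin d → ℕ} {g : Equiv.Perm (Fin d)}
    (hg : ∀ k, κ (g k) = κ k) : colorSum κ * MonoidAlgebra.of ℚ _ g = colorSum κ := by
  rw [colorSum_mul_of, show κ ∘ g = κ from funext hg, of_mul_colorSum hg]

theorem of_mul_colAntisymmetrizer {d : ℕ} {lam : d.Partition} {g : Equiv.Perm (Fin d)}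
    (hg : ∀ k, colOf lam (g k) = colOf lam k) :
    MonoidAlgebra.of ℚ _ g * colAntisymmetrizer lam =
      ((Equiv.Perm.sign g : ℤ) : ℚ) • colAntisymmetrizer lam := by
  classical
  simp only [colAntisymmetrizer, Finset.mul_sum, mul_smul_comm, ← map_mul, Finset.smul_sum,
    smul_smul]
  refine Finset.sum_bij' (fun p _ => g * p) (fun p _ => g⁻¹ * p) ?_ ?_ ?_ ?_ ?_
  · intro p hp
    simp only [Finset.mem_filter, Finset.mem_univ, true_and] at hp ⊢
    intro k
    simp [hg, hp]
  · intro p hp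
    simp only [Finset.mem_filter, Finset.mem_univ, true_and] at hp ⊢
    intro k
    have := hg (g⁻¹ (p k))
    simp only [Equiv.Perm.mul_apply, ← this]
    simp [hp]
  · intro p _
    group
  · intro p _
    group
  · intro p _
    congr 1
    rw [Equiv.Perm.sign_mul]
    rcases Int.units_eq_one_or (Equiv.Perm.sign g) with h | h <;> simp [h]

/-- A transposition of two entries with the same colour and column is absorbed by the left factor
with sign `1` and by the right one with sign `-1`. -/
theorem colorSum_mul_colAntisymmetrizer_eq_zero {d : ℕ} {lam : d.Partition} {κ : Fin d → ℕ}
    (h : ¬ ColInjective lam κ) : colorSum κ * colAntisymmetrizer lam = 0 := by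
  simp only [ColInjective, not_forall] at h
  obtain ⟨x, y, h1, h2, hne⟩ := h
  have hswap : ∀ f : Fin d → ℕ, f x = f y → ∀ k, f (Equiv.swap x y k) = f k := by
    intro f hf k
    rcases eq_or_ne k x with rfl | hx
    · simp [hf]
    · rcases eq_or_ne k y with rfl | hy
      · simp [hf]
      · rw [Equiv.swap_apply_of_ne_of_ne hx hy]
  have h3 : colorSum κ * colAntisymmetrizer lam = -(colorSum κ * colAntisymmetrizer lam) := by
    conv_lhs => rw [← colorSum_mul_of_eq (hswap κ h2), mul_assoc,
      of_mul_colAntisymmetrizer (hswap _ h1), Equiv.Perm.sign_swap hne]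
    simp
  have h4 : (2 : ℚ) • (colorSum κ * colAntisymmetrizer lam) = 0 := by
    rw [two_smul]
    nth_rewrite 2 [h3]
    exact add_neg_cancel _
  exact (smul_eq_zero.mp h4).resolve_left two_ne_zero

open Classical in
theorem coeff_colorSum {d : ℕ} (κ : Fin d → ℕ) (g : Equiv.Perm (Fin d)) :
    (colorSum κ).coeff g = if ∀ k, κ (g k) = κ k then 1 else 0 := by
  simp only [colorSum, MonoidAlgebra.coeff_sum, Finsupp.coe_finsetSum, Finset.sum_apply,
    MonoidAlgebra.of_apply, MonoidAlgebra.coeff_single, Finsupp.single_apply]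
  simp

open Classical in
theorem coeff_colAntisymmetrizer {d : ℕ} (lam : d.Partition) (g : Equiv.Perm (Fin d)) :
    (colAntisymmetrizer lam).coeff g =
      if ∀ k, colOf lam (g k) = colOf lam k then ((Equiv.Perm.sign g : ℤ) : ℚ) else 0 := by
  simp only [colAntisymmetrizer, MonoidAlgebra.coeff_sum, Finsupp.coe_finsetSum, Finset.sum_apply,
    MonoidAlgebra.coeff_smul, Finsupp.smul_apply,
    MonoidAlgebra.of_apply, MonoidAlgebra.coeff_single, Finsupp.single_apply]
  simp

theorem coeff_youngSymmetrizer_one {d : ℕ} (lam : d.Partition) :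
    (youngSymmetrizer lam).coeff 1 = 1 := by
  classical
  rw [youngSymmetrizer, rowSymmetrizer_eq, coeff_mul_eq_sum, Finset.sum_eq_single 1]
  · simp [coeff_colorSum, coeff_colAntisymmetrizer]
  · intro p _ hp1
    by_contra hne
    obtain ⟨h1, h2⟩ := mul_ne_zero_iff.mp hne
    rw [coeff_colorSum, ite_ne_right_iff] at h1
    rw [coeff_colAntisymmetrizer, ite_ne_right_iff] at h2
    apply hp1
    ext1 k
    have h := h2.1 (p k)
    simp only [mul_one, Equiv.Perm.inv_def, Equiv.symm_apply_apply] at h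
    exact eq_of_rowOf_eq_of_colOf_eq (h1.1 k) h.symm
  · simp

/-- The rows and columns of a tableau only interact through the Young symmetrizer. -/
theorem row_mul_mul_col {d : ℕ} (lam : d.Partition) (x : MonoidAlgebra ℚ (Equiv.Perm (Fin d))) :
    rowSymmetrizer lam * x * colAntisymmetrizer lam =
      (rowSymmetrizer lam * x * colAntisymmetrizer lam).coeff 1 • youngSymmetrizer lam := by
  have key : ∀ g : Equiv.Perm (Fin d), ∃ t : ℚ, rowSymmetrizer lam * MonoidAlgebra.of ℚ _ g *
      colAntisymmetrizer lam = t • youngSymmetrizer lam := by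
    intro g
    rw [rowSymmetrizer_eq, colorSum_mul_of]
    -- Von Neumann's dichotomy: either `g` is a row permutation times a column permutation, or some
    -- transposition makes the product vanish.
    by_cases h : ColInjective lam (rowOf lam ∘ g)
    · obtain ⟨q, hq1, hq2⟩ := h.exists_perm (by
        intro i
        rw [← card_rowOf_eq lam i]
        refine Finset.card_bij (fun x _ => g x) ?_ ?_ ?_
        · intro x hx
          simpa using hx
        · intro x _ y _ hxy
          exact g.injective hxy
        · intro y hy
          exact ⟨g⁻¹ y, by simpa using hy, by simp⟩)
      refine ⟨((Equiv.Perm.sign q : ℤ) : ℚ), ?_⟩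
      rw [← colorSum_mul_of]
      have h1 : g = (g * q⁻¹) * q := by group
      have h2 : ∀ k, rowOf lam ((g * q⁻¹) k) = rowOf lam k := by
        intro k
        have := hq2 (q⁻¹ k)
        simpa using this.symm
      rw [h1, map_mul, ← mul_assoc, colorSum_mul_of_eq h2, mul_assoc,
        of_mul_colAntisymmetrizer hq1, mul_smul_comm]
      rfl
    · refine ⟨0, ?_⟩
      rw [mul_assoc, colorSum_mul_colAntisymmetrizer_eq_zero h]
      simp
  have key2 : ∃ t : ℚ, rowSymmetrizer lam * x * colAntisymmetrizer lam =
      t • youngSymmetrizer lam := by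
    choose t ht using key
    refine ⟨∑ g, x.coeff g * t g, ?_⟩
    conv_lhs => rw [eq_sum_coeff x]
    simp only [Finset.mul_sum, Finset.sum_mul, mul_smul_comm, smul_mul_assoc, ht, smul_smul,
      Finset.sum_smul]
  obtain ⟨t, ht⟩ := key2
  rw [ht]
  simp [coeff_youngSymmetrizer_one]

end CompletedHurwitz

end

noncomputable section

namespace CompletedHurwitz

/-! ### The characters of Specht modules -/

/-- The factor by which the Young symmetrizer deviates from an idempotent. -/
def youngFactor {d : ℕ} (lam : d.Partition) : ℚ :=
  (youngSymmetrizer lam * youngSymmetrizer lam).coeff 1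

theorem young_mul_mul_young {d : ℕ} (lam : d.Partition)
    (x : MonoidAlgebra ℚ (Equiv.Perm (Fin d))) :
    youngSymmetrizer lam * x * youngSymmetrizer lam =
      (youngSymmetrizer lam * x * youngSymmetrizer lam).coeff 1 • youngSymmetrizer lam := by
  have h : youngSymmetrizer lam * x * youngSymmetrizer lam = rowSymmetrizer lam *
      (colAntisymmetrizer lam * x * rowSymmetrizer lam) * colAntisymmetrizer lam := by
    simp only [youngSymmetrizer, mul_assoc]
  rw [h]
  exact row_mul_mul_col lam _

theorem row_mul_mul_young {d : ℕ} (lam : d.Partition)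
    (x : MonoidAlgebra ℚ (Equiv.Perm (Fin d))) :
    rowSymmetrizer lam * x * youngSymmetrizer lam =
      (rowSymmetrizer lam * x * youngSymmetrizer lam).coeff 1 • youngSymmetrizer lam := by
  have h : rowSymmetrizer lam * x * youngSymmetrizer lam = rowSymmetrizer lam *
      (x * rowSymmetrizer lam) * colAntisymmetrizer lam := by
    simp only [youngSymmetrizer, mul_assoc]
  rw [h]
  exact row_mul_mul_col lam _

theorem young_mul_young {d : ℕ} (lam : d.Partition) :
    youngSymmetrizer lam * youngSymmetrizer lam = youngFactor lam • youngSymmetrizer lam := by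
  have := young_mul_mul_young lam 1
  rwa [mul_one] at this

theorem trace_monoidAlgebra {d : ℕ} (f : MonoidAlgebra ℚ (Equiv.Perm (Fin d)) →ₗ[ℚ]
    MonoidAlgebra ℚ (Equiv.Perm (Fin d))) :
    LinearMap.trace ℚ _ f = ∑ h, (f (MonoidAlgebra.of ℚ _ h)).coeff h := by
  classical
  rw [LinearMap.trace_eq_matrix_trace ℚ (MonoidAlgebra.basis (Equiv.Perm (Fin d)) ℚ),
    Matrix.trace]
  refine Finset.sum_congr rfl fun h _ => ?_
  rw [Matrix.diag_apply, LinearMap.toMatrix_apply]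
  rfl

/-- If the factor were zero, right multiplication by the Young symmetrizer would be nilpotent, hence
of trace zero; but its trace is `d!`, because the coefficient at `1` is `1`. -/
theorem youngFactor_ne_zero {d : ℕ} (lam : d.Partition) : youngFactor lam ≠ 0 := by
  intro h0
  have h1 : youngSymmetrizer lam * youngSymmetrizer lam = 0 := by
    rw [young_mul_young, h0, zero_smul]
  set f := LinearMap.mulRight ℚ (youngSymmetrizer lam) with hf
  have hnil : IsNilpotent f := by
    refine ⟨2, ?_⟩
    refine LinearMap.ext fun x => ?_
    simp [pow_two, hf, mul_assoc, h1]
  have : Module.Finite ℚ (MonoidAlgebra ℚ (Equiv.Perm (Fin d))) :=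
    Module.Finite.of_basis (MonoidAlgebra.basis (Equiv.Perm (Fin d)) ℚ)
  have h2 := (LinearMap.isNilpotent_trace_of_isNilpotent hnil).eq_zero
  rw [trace_monoidAlgebra] at h2
  simp only [hf, LinearMap.mulRight_apply, coeff_of_mul, inv_mul_cancel,
    coeff_youngSymmetrizer_one] at h2
  simp at h2

theorem mul_youngSymmetrizer_of_mem {d : ℕ} {lam : d.Partition}
    {x : MonoidAlgebra ℚ (Equiv.Perm (Fin d))} (hx : x ∈ Specht lam) :
    x * youngSymmetrizer lam = youngFactor lam • x := by
  obtain ⟨y, rfl⟩ := Submodule.mem_span_singleton.mp hx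
  rw [smul_eq_mul, mul_assoc, young_mul_young, mul_smul_comm]

/-- Right multiplication by the rescaled Young symmetrizer projects the group algebra onto the
Specht module. The trace of `g` there is thus the trace of `x ↦ n⁻¹ g x c` on the whole algebra,
computed in the basis of permutations. -/
theorem character_spechtRep {d : ℕ} (lam : d.Partition) (g : Equiv.Perm (Fin d)) :
    (spechtRep lam).character g =
      (youngFactor lam)⁻¹ * ∑ h, (youngSymmetrizer lam).coeff (h⁻¹ * g⁻¹ * h) := by
  have : Module.Finite ℚ (MonoidAlgebra ℚ (Equiv.Perm (Fin d))) :=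
    Module.Finite.of_basis (MonoidAlgebra.basis (Equiv.Perm (Fin d)) ℚ)
  have : Module.Free ℚ (MonoidAlgebra ℚ (Equiv.Perm (Fin d))) :=
    Module.Free.of_basis (MonoidAlgebra.basis (Equiv.Perm (Fin d)) ℚ)
  set f : MonoidAlgebra ℚ (Equiv.Perm (Fin d)) →ₗ[ℚ] MonoidAlgebra ℚ (Equiv.Perm (Fin d)) :=
    (youngFactor lam)⁻¹ • (LinearMap.mulRight ℚ (youngSymmetrizer lam) ∘ₗ
      LinearMap.mulLeft ℚ (MonoidAlgebra.of ℚ _ g)) with hf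
  have hfx : ∀ x, f x = (youngFactor lam)⁻¹ • (MonoidAlgebra.of ℚ _ g * x *
      youngSymmetrizer lam) := fun x => rfl
  have hmem : ∀ x, f x ∈ (Specht lam).restrictScalars ℚ := by
    intro x
    rw [hfx]
    refine Submodule.smul_mem _ _ ?_
    exact Submodule.mem_span_singleton.mpr ⟨MonoidAlgebra.of ℚ _ g * x, rfl⟩
  have h1 := LinearMap.trace_restrict_eq_of_forall_mem ((Specht lam).restrictScalars ℚ) f hmem
  set e : (Specht lam).restrictScalars ℚ ≃ₗ[ℚ] Specht lam :=
    (Submodule.restrictScalarsEquiv ℚ _ _ (Specht lam)).restrictScalars ℚ with he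
  have h2 : e.conj (f.restrict fun x _ => hmem x) = spechtRep lam g := by
    refine LinearMap.ext fun x => Subtype.ext ?_
    have hx := mul_youngSymmetrizer_of_mem (Submodule.smul_mem (Specht lam)
      (MonoidAlgebra.of ℚ _ g) x.2)
    change f x.1 = MonoidAlgebra.of ℚ _ g * x.1
    rw [hfx, ← smul_eq_mul (MonoidAlgebra.of ℚ _ g) x.1, hx,
      smul_smul, inv_mul_cancel₀ (youngFactor_ne_zero lam), one_smul]
  rw [Representation.character, ← h2, LinearMap.trace_conj', h1]
  rw [trace_monoidAlgebra, Finset.mul_sum]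
  refine Finset.sum_congr rfl fun h _ => ?_
  rw [hfx, MonoidAlgebra.coeff_smul, Finsupp.smul_apply, smul_eq_mul, ← map_mul, coeff_of_mul,
    mul_inv_rev, mul_assoc]

theorem sum_conj_mul_classFunction {d : ℕ} (x φ : Equiv.Perm (Fin d) → ℚ)
    (hφ : ∀ g h, φ (h * g * h⁻¹) = φ g) :
    ∑ g, (∑ h, x (h⁻¹ * g⁻¹ * h)) * φ g = d.factorial * ∑ g, x g⁻¹ * φ g := by
  simp_rw [Finset.sum_mul]
  rw [Finset.sum_comm]
  have : ∀ h : Equiv.Perm (Fin d), ∑ g, x (h⁻¹ * g⁻¹ * h) * φ g = ∑ g, x g⁻¹ * φ g := by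
    intro h
    rw [← Equiv.sum_comp (MulAut.conj h).toEquiv]
    refine Finset.sum_congr rfl fun g _ => ?_
    have h1 : (MulAut.conj h).toEquiv g = h * g * h⁻¹ := rfl
    rw [h1, hφ]
    congr 2
    group
  rw [Finset.sum_congr rfl fun h _ => this h, Finset.sum_const, nsmul_eq_mul]
  simp [Fintype.card_perm]

/-- The character, as a class function. -/
def spechtChar {d : ℕ} (lam : d.Partition) (g : Equiv.Perm (Fin d)) : ℚ :=
  (spechtRep lam).character g

theorem spechtChar_eq {d : ℕ} (lam : d.Partition) (g : Equiv.Perm (Fin d)) :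
    spechtChar lam g =
      (youngFactor lam)⁻¹ * ∑ h, (youngSymmetrizer lam).coeff (h⁻¹ * g⁻¹ * h) :=
  character_spechtRep lam g

theorem spechtChar_conj {d : ℕ} (lam : d.Partition) (g h : Equiv.Perm (Fin d)) :
    spechtChar lam (h * g * h⁻¹) = spechtChar lam g := by
  rw [spechtChar_eq, spechtChar_eq]
  congr 1
  rw [← Equiv.sum_comp (Equiv.mulLeft h)]
  refine Finset.sum_congr rfl fun k _ => ?_
  congr 1
  simp only [Equiv.coe_mulLeft]
  group

theorem spechtChar_of_isConj {d : ℕ} (lam : d.Partition) {g h : Equiv.Perm (Fin d)}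
    (hgh : IsConj g h) : spechtChar lam g = spechtChar lam h := by
  obtain ⟨k, rfl⟩ := isConj_iff.mp hgh
  rw [spechtChar_conj]

theorem sum_spechtChar_mul {d : ℕ} (lam : d.Partition) (φ : Equiv.Perm (Fin d) → ℚ)
    (hφ : ∀ g h, φ (h * g * h⁻¹) = φ g) :
    ∑ g, spechtChar lam g * φ g = (youngFactor lam)⁻¹ * (d.factorial *
      ∑ g, (youngSymmetrizer lam).coeff g⁻¹ * φ g) := by
  rw [← sum_conj_mul_classFunction _ φ hφ, Finset.mul_sum]
  refine Finset.sum_congr rfl fun g _ => ?_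
  rw [spechtChar_eq, mul_assoc]

theorem sum_coeff_mul_coeff {d : ℕ} (x c : MonoidAlgebra ℚ (Equiv.Perm (Fin d))) :
    ∑ h, (x * MonoidAlgebra.of ℚ _ h * x).coeff 1 * c.coeff h = (x * c * x).coeff 1 := by
  conv_rhs => rw [eq_sum_coeff c]
  simp only [Finset.mul_sum, Finset.sum_mul, mul_smul_comm, smul_mul_assoc,
    MonoidAlgebra.coeff_sum, Finsupp.coe_finsetSum, Finset.sum_apply, MonoidAlgebra.coeff_smul,
    Finsupp.smul_apply, smul_eq_mul]
  exact Finset.sum_congr rfl fun _ _ => mul_comm _ _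

/-- Expanding both characters in the Young symmetrizer `c` and using that `c k c` is a multiple of
`c` for each `k` reduces the sum to the coefficient of `c * c * c` at `1`, the square of
`youngFactor`. -/
theorem sum_spechtChar_sq {d : ℕ} (lam : d.Partition) :
    ∑ g, spechtChar lam g ^ 2 = d.factorial := by
  set c := youngSymmetrizer lam with hc
  set n := youngFactor lam with hn
  have hn0 : n ≠ 0 := youngFactor_ne_zero lam
  have hinv : ∀ g, spechtChar lam g⁻¹ = spechtChar lam g := fun g =>
    spechtChar_of_isConj lam (Equiv.Perm.isConj_iff_cycleType_eq.mpr g.cycleType_inv)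
  simp_rw [pow_two]
  rw [sum_spechtChar_mul lam _ fun g h => spechtChar_conj lam g h]
  have h1 : ∑ g, c.coeff g⁻¹ * spechtChar lam g = n⁻¹ * ∑ k, (c * MonoidAlgebra.of ℚ _ k * c).coeff k := by
    have h2 : ∀ k : Equiv.Perm (Fin d), (c * MonoidAlgebra.of ℚ _ k * c).coeff k =
        ∑ g, c.coeff g⁻¹ * c.coeff (k⁻¹ * g * k) := by
      intro k
      rw [mul_assoc, coeff_mul_eq_sum, ← Equiv.sum_comp (Equiv.inv _)]
      refine Finset.sum_congr rfl fun g _ => ?_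
      rw [coeff_of_mul]
      simp [mul_assoc]
    simp_rw [h2]
    rw [Finset.sum_comm, Finset.mul_sum]
    refine Finset.sum_congr rfl fun g _ => ?_
    rw [← hinv g, spechtChar_eq, inv_inv, ← Finset.mul_sum]
    ring
  have h3 : ∀ k : Equiv.Perm (Fin d), (c * MonoidAlgebra.of ℚ _ k * c).coeff k =
      (c * MonoidAlgebra.of ℚ _ k * c).coeff 1 * c.coeff k := by
    intro k
    conv_lhs => rw [young_mul_mul_young]
    rfl
  rw [h1, Finset.sum_congr rfl fun k _ => h3 k, sum_coeff_mul_coeff, young_mul_young,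
    smul_mul_assoc, young_mul_young, ← hn, MonoidAlgebra.coeff_smul, MonoidAlgebra.coeff_smul]
  simp only [Finsupp.smul_apply, smul_eq_mul, coeff_youngSymmetrizer_one]
  field_simp

end CompletedHurwitz

end

noncomputable section

namespace CompletedHurwitz

/-! ### The Frobenius character formula -/

theorem shift_one_eq_card {d N : ℕ} (κ : Fin d → Fin N) (i : Fin N) :
    shift (fun _ => 1) κ i = (Finset.univ.filter fun x => (κ x : ℕ) = i).card := by
  simp only [shift, Nat.cast_one, Finset.sum_boole, Fin.ext_iff]

theorem rowOf_lt {d N : ℕ} (hN : d ≤ N) (lam : d.Partition) (x : Fin d) : rowOf lam x < N := by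
  by_contra h
  have h1 := (mem_diagram lam _ _).mp (tableau_mem lam x)
  rw [part_of_length_le lam (by have := length_rows_le lam; omega)] at h1
  omega

theorem exists_colInjective_of_ne_zero {d : ℕ} {lam : d.Partition} {κ : Fin d → ℕ}
    (h : colorSum κ * youngSymmetrizer lam ≠ 0) :
    ∃ p : Equiv.Perm (Fin d), ColInjective lam (κ ∘ p) := by
  by_contra hcon
  push Not at hcon
  apply h
  rw [youngSymmetrizer, rowSymmetrizer, ← mul_assoc, Finset.mul_sum, Finset.sum_mul]
  refine Finset.sum_eq_zero fun p _ => ?_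
  rw [colorSum_mul_of, mul_assoc, colorSum_mul_colAntisymmetrizer_eq_zero (hcon p), mul_zero]

theorem card_comp_perm {d : ℕ} (κ : Fin d → ℕ) (p : Equiv.Perm (Fin d)) (i : ℕ) :
    (Finset.univ.filter fun x => (κ ∘ p) x = i).card =
      (Finset.univ.filter fun x => κ x = i).card :=
  Finset.card_bij (fun x _ => p x) (fun x hx => by simpa using hx)
    (fun x _ y _ hxy => p.injective hxy) fun y hy => ⟨p⁻¹ y, by simpa using hy, by simp⟩

/-- Inductively `σ` fixes everything below `i`; the bound then gives `σ i ≤ i`, and injectivity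
excludes smaller values. -/
theorem perm_eq_one_of_sum_le {N : ℕ} (σ : Equiv.Perm (Fin N))
    (h : ∀ i : Fin N, ∑ j ∈ Finset.Iic i, ((σ j : ℕ) : ℤ) ≤ ∑ j ∈ Finset.Iic i, ((j : ℕ) : ℤ)) :
    σ = 1 := by
  have key : ∀ i : Fin N, σ i = i := by
    intro i
    induction i using WellFoundedLT.induction with
    | ind i ih =>
      have h1 := h i
      rw [← Finset.Iio_insert, Finset.sum_insert (by simp), Finset.sum_insert (by simp),
        Finset.sum_congr rfl fun j hj => by rw [ih j (Finset.mem_Iio.mp hj)]] at h1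
      have h2 : (σ i : ℕ) ≤ i := by omega
      rcases (Fin.le_def.mpr h2).lt_or_eq with h3 | h3
      · exact absurd (σ.injective (ih _ h3)) h3.ne
      · exact h3
  ext1 i
  exact key i

/-- A nonzero Slater coefficient makes the content of `κ` equal to `λ_i - i + σ i`, while a nonzero
second factor makes it dominated by `λ`. Together these force `σ = 1`, so only colourings of content
`λ` contribute. -/
theorem slater_mul_coeff_eq {d N : ℕ} (lam : d.Partition) (κ : Fin d → Fin N) :
    slater (rho N) (exps N lam - shift (fun _ => 1) κ) *
      (colorSum (fun x => (κ x : ℕ)) * youngSymmetrizer lam).coeff 1 =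
    if ∀ i : Fin N, shift (fun _ => 1) κ i = part lam i then
      (colorSum (fun x => (κ x : ℕ)) * youngSymmetrizer lam).coeff 1 else 0 := by
  split_ifs with hκ
  · have : exps N lam - shift (fun _ => 1) κ = rho N := by
      ext i
      simp [exps, rho, hκ i]
    rw [this, slater_rho_rho, one_mul]
  · by_contra hne
    obtain ⟨h1, h2⟩ := mul_ne_zero_iff.mp hne
    obtain ⟨σ, hσ⟩ := exists_of_slater_ne_zero h1
    have h3 : colorSum (fun x => (κ x : ℕ)) * youngSymmetrizer lam ≠ 0 := by
      intro h
      rw [h] at h2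
      exact h2 rfl
    obtain ⟨p, hp⟩ := exists_colInjective_of_ne_zero h3
    have hsh : ∀ i : Fin N, shift (fun _ => 1) κ i = part lam i - (i : ℕ) + (σ i : ℕ) := by
      intro i
      have := congrFun hσ i
      simp only [Pi.sub_apply, exps, Function.comp, rho] at this
      omega
    have hσ1 : σ = 1 := by
      refine perm_eq_one_of_sum_le σ fun i => ?_
      have h4 := hp.sum_card_le (i + 1)
      simp only [card_comp_perm] at h4
      have h5 : ∀ F : ℕ → ℤ, ∑ j ∈ Finset.range (i + 1), F j = ∑ j ∈ Finset.Iic i, F (j : ℕ) := by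
        intro F
        symm
        refine Finset.sum_bij (fun j _ => (j : ℕ)) ?_ ?_ ?_ ?_
        · intro j hj
          have : j ≤ i := Finset.mem_Iic.mp hj
          rw [Finset.mem_range]
          exact Nat.lt_succ_of_le this
        · intro j _ k _ h
          exact Fin.ext h
        · intro j hj
          rw [Finset.mem_range] at hj
          have := i.2
          exact ⟨⟨j, by omega⟩, by rw [Finset.mem_Iic, Fin.le_def]; simp only; omega, rfl⟩
        · intros
          rfl
      have h6 : (∑ j ∈ Finset.range (i + 1),
          ((Finset.univ.filter fun x => (κ x : ℕ) = j).card : ℤ)) ≤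
          ∑ j ∈ Finset.range (i + 1), (part lam j : ℤ) := by exact_mod_cast h4
      rw [h5, h5, Finset.sum_congr rfl fun j _ => by rw [← shift_one_eq_card, hsh],
        Finset.sum_add_distrib, Finset.sum_sub_distrib] at h6
      linarith
    refine hκ fun i => ?_
    rw [hsh, hσ1]
    simp

/-- Orbit counting: the colourings of content `λ` form one orbit of `S_d`, that of `rowOf`, whose
stabilizer is the row group. -/
theorem sum_content_eq {d N : ℕ} (hN : d ≤ N) (lam : d.Partition) (F : (Fin d → Fin N) → ℚ) :
    ∑ h : Equiv.Perm (Fin d), F (fun x => ⟨rowOf lam (h x), rowOf_lt hN lam (h x)⟩) =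
      (Finset.univ.filter fun p : Equiv.Perm (Fin d) =>
        ∀ k, rowOf lam (p k) = rowOf lam k).card *
      ∑ κ : Fin d → Fin N with ∀ i, shift (fun _ => 1) κ i = part lam i, F κ := by
  classical
  set R : Fin d → Fin N := fun x => ⟨rowOf lam x, rowOf_lt hN lam x⟩ with hR
  have hmaps : ∀ h : Equiv.Perm (Fin d), h ∈ Finset.univ → (R ∘ h) ∈ Finset.univ.filter
      fun κ : Fin d → Fin N => ∀ i : Fin N, shift (fun _ => 1) κ i = part lam i := by
    intro h _
    simp only [Finset.mem_filter, Finset.mem_univ, true_and]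
    intro i
    rw [shift_one_eq_card]
    have h1 := card_comp_perm (rowOf lam) h i
    rw [card_rowOf_eq] at h1
    rw [← h1]
    rfl
  rw [← Finset.sum_fiberwise_of_maps_to hmaps, Finset.mul_sum]
  refine Finset.sum_congr rfl fun κ hκ => ?_
  have hF : ∀ h ∈ Finset.univ.filter (fun h : Equiv.Perm (Fin d) => R ∘ h = κ),
      F (fun x => ⟨rowOf lam (h x), rowOf_lt hN lam (h x)⟩) = F κ := by
    intro h hh
    rw [← (Finset.mem_filter.mp hh).2]
    rfl
  rw [Finset.sum_congr rfl hF, Finset.sum_const, nsmul_eq_mul]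
  congr 2
  have hex : ∃ h₀ : Equiv.Perm (Fin d), R ∘ h₀ = κ := by
    have hc : ∀ i, Nonempty ({x // κ x = i} ≃ {x // R x = i}) := by
      intro i
      rw [← Fintype.card_eq, Fintype.card_subtype, Fintype.card_subtype]
      have h1 := (Finset.mem_filter.mp hκ).2 i
      rw [shift_one_eq_card, ← card_rowOf_eq lam] at h1
      have h2 : (Finset.univ.filter fun x => (κ x : ℕ) = i).card =
        (Finset.univ.filter fun x => rowOf lam x = i).card := by exact_mod_cast h1
      simpa [hR, Fin.ext_iff] using h2
    exact ⟨Equiv.ofFiberEquiv fun i => (hc i).some,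
      funext fun x => Equiv.ofFiberEquiv_map (fun i => (hc i).some) x⟩
  obtain ⟨h₀, hh₀⟩ := hex
  refine Finset.card_bij' (fun h _ => h * h₀⁻¹) (fun p _ => p * h₀) ?_ ?_ ?_ ?_
  · intro h hh
    have h1 := (Finset.mem_filter.mp hh).2
    simp only [Finset.mem_filter, Finset.mem_univ, true_and]
    intro k
    have h2 := congrFun (h1.trans hh₀.symm) (h₀⁻¹ k)
    simpa [hR] using h2
  · intro p hp
    have h1 := (Finset.mem_filter.mp hp).2
    simp only [Finset.mem_filter, Finset.mem_univ, true_and]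
    rw [← hh₀]
    ext x
    simp [hR, h1]
  · intro h _
    group
  · intro p _
    group

theorem colorSum_mul_self {d : ℕ} (κ : Fin d → ℕ) :
    colorSum κ * colorSum κ =
      ((Finset.univ.filter fun p : Equiv.Perm (Fin d) => ∀ k, κ (p k) = κ k).card : ℚ) •
        colorSum κ := by
  classical
  conv_lhs => enter [1]; rw [colorSum]
  rw [Finset.sum_mul, Finset.sum_congr rfl fun p hp =>
    of_mul_colorSum (Finset.mem_filter.mp hp).2, Finset.sum_const, Nat.cast_smul_eq_nsmul]

/-- This carries the inner product of the character with the power-sum coefficient. Exchanging the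
sums over permutations and colourings leaves the colourings of content `λ`, which are translates of
the row colouring. -/
theorem sum_coeff_mul_permSum {d N : ℕ} (hN : d ≤ N) (lam : d.Partition) :
    ∑ g, (youngSymmetrizer lam).coeff g⁻¹ * permSum N g (exps N lam) = youngFactor lam := by
  classical
  set c := youngSymmetrizer lam with hc
  set r : ℚ := ((Finset.univ.filter fun p : Equiv.Perm (Fin d) =>
    ∀ k, rowOf lam (p k) = rowOf lam k).card : ℚ) with hr
  have hr0 : r ≠ 0 := by
    rw [hr, Nat.cast_ne_zero]
    exact Finset.card_ne_zero_of_mem (a := 1) (by simp)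
  have h1 : ∑ g, c.coeff g⁻¹ * permSum N g (exps N lam) =
      ∑ κ : Fin d → Fin N, slater (rho N) (exps N lam - shift (fun _ => 1) κ) *
        (colorSum (fun x => (κ x : ℕ)) * c).coeff 1 := by
    simp only [permSum, coeff_mul_eq_sum, Finset.mul_sum, coeff_colorSum, Finset.sum_filter]
    rw [Finset.sum_comm]
    refine Finset.sum_congr rfl fun κ _ => Finset.sum_congr rfl fun g _ => ?_
    have : (∀ k, (κ (g k) : ℕ) = κ k) ↔ κ ∘ g = κ := by
      rw [funext_iff]
      simp [Fin.ext_iff]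
    simp only [this, mul_one]
    split_ifs
    · ring
    · simp
  rw [h1, Finset.sum_congr rfl fun κ _ => slater_mul_coeff_eq lam κ, ← Finset.sum_filter]
  have h2 := sum_content_eq hN lam fun κ => (colorSum (fun x => (κ x : ℕ)) * c).coeff 1
  -- Left multiplication by `h` moves the coefficient from `1` to `h` and turns the element into row
  -- symmetrizer times `h` times `c`, a multiple of `c`.
  have h3 : ∀ h : Equiv.Perm (Fin d), (colorSum (fun x => rowOf lam (h x)) * c).coeff 1 =
      (rowSymmetrizer lam * MonoidAlgebra.of ℚ _ h * c).coeff 1 * c.coeff h := by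
    intro h
    have h4 : MonoidAlgebra.of ℚ _ h * (colorSum (fun x => rowOf lam (h x)) * c) =
        rowSymmetrizer lam * MonoidAlgebra.of ℚ _ h * c := by
      rw [rowSymmetrizer_eq, colorSum_mul_of, mul_assoc]
      rfl
    have h5 := coeff_of_mul h h (colorSum (fun x => rowOf lam (h x)) * c)
    rw [inv_mul_cancel] at h5
    rw [← h5, h4]
    conv_lhs => rw [row_mul_mul_young]
    rfl
  simp only at h2
  rw [Finset.sum_congr rfl fun h _ => h3 h] at h2
  have h6 : ∑ h : Equiv.Perm (Fin d),
      (rowSymmetrizer lam * MonoidAlgebra.of ℚ _ h * c).coeff 1 * c.coeff h =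
      (rowSymmetrizer lam * c * c).coeff 1 := by
    conv_rhs => enter [1, 1, 1, 2]; rw [eq_sum_coeff c]
    simp only [Finset.mul_sum, Finset.sum_mul, mul_smul_comm, smul_mul_assoc,
      MonoidAlgebra.coeff_sum, Finsupp.coe_finsetSum, Finset.sum_apply, MonoidAlgebra.coeff_smul,
      Finsupp.smul_apply, smul_eq_mul]
    exact Finset.sum_congr rfl fun _ _ => mul_comm _ _
  have h7 : rowSymmetrizer lam * c = r • c := by
    rw [hc, youngSymmetrizer, ← mul_assoc, rowSymmetrizer_eq, colorSum_mul_self, smul_mul_assoc]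
  rw [h6, h7, smul_mul_assoc, young_mul_young, MonoidAlgebra.coeff_smul, MonoidAlgebra.coeff_smul]
    at h2
  simp only [Finsupp.smul_apply, smul_eq_mul, coeff_youngSymmetrizer_one, mul_one] at h2
  exact (mul_left_cancel₀ hr0 h2).symm

/-- Two rational functions on `S_d` with squared norms and inner product all equal to `d!` coincide,
since their difference has norm zero. -/
theorem spechtChar_eq_permSum {d N : ℕ} (hN : d + d ≤ N) (lam : d.Partition)
    (g : Equiv.Perm (Fin d)) : spechtChar lam g = permSum N g (exps N lam) := by
  have h1 : ∑ g, spechtChar lam g * permSum N g (exps N lam) = d.factorial := by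
    rw [sum_spechtChar_mul lam _ fun g h => by rw [permSum_conj],
      sum_coeff_mul_permSum (by omega)]
    field_simp [youngFactor_ne_zero lam]
  have h2 : ∑ g, (spechtChar lam g - permSum N g (exps N lam)) ^ 2 = 0 := by
    have : ∀ g, (spechtChar lam g - permSum N g (exps N lam)) ^ 2 = spechtChar lam g ^ 2 +
        permSum N g (exps N lam) ^ 2 - 2 * (spechtChar lam g * permSum N g (exps N lam)) :=
      fun g => by ring
    rw [Finset.sum_congr rfl fun g _ => this g, Finset.sum_sub_distrib, Finset.sum_add_distrib,
      ← Finset.mul_sum, h1, sum_spechtChar_sq, sum_permSum_sq hN]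
    ring
  have h3 := (Finset.sum_eq_zero_iff_of_nonneg fun g _ => sq_nonneg _).mp h2 g (Finset.mem_univ g)
  exact sub_eq_zero.mp (pow_eq_zero_iff two_ne_zero |>.mp h3)

theorem chi_eq_psum {d N m : ℕ} (hN : d + d ≤ N) (lam : d.Partition) (μ : Fin m → ℕ)
    (hμ : ∀ t, 0 < μ t) (hd : ∑ t, μ t = d) :
    chi lam (tuplePartition μ d hd) = psum N μ (exps N lam) := by
  have h1 : chi lam (tuplePartition μ d hd) =
      spechtChar lam (permOfPartition (tuplePartition μ d hd)) := rfl
  rw [h1, spechtChar_eq_permSum hN, permSum_eq_psum _ μ]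
  have h2 : (permOfPartition (tuplePartition μ d hd)).partition.parts =
      (tuplePartition μ d hd).parts := (exists_perm_of_partition _).choose_spec
  rw [h2]
  simp only [tuplePartition, Nat.Partition.ofSums]
  symm
  rw [Multiset.filter_eq_self]
  intro a ha
  obtain ⟨t, _, rfl⟩ := Multiset.mem_map.mp ha
  exact (hμ t).ne'

/-- Double Hurwitz numbers as vacuum expectations. -/
theorem hurwitz_eq_vev {m n : ℕ} (r s : ℕ) (p : V m n) {N : ℕ}
    (hN : (∑ i, p.1.1 i) + ∑ i, p.1.1 i ≤ N) :
    hurwitz r s p = (1 / ((∏ i, (p.1.1 i : ℚ)) * ∏ j, (p.1.2 j : ℚ))) *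
      vev N (lowers p.1.1 ++ (List.replicate s (0, cyclePoly r) ++ raises p.1.2)) := by
  rw [hurwitz, ← sum_psum_eq_vev (d := ∑ i, p.1.1 i) (by omega) r s _ _ p.2.1 p.2.2.1
    p.2.2.2.symm]
  congr 1
  refine Finset.sum_congr rfl fun lam _ => ?_
  rw [chi_eq_psum hN lam _ p.2.1, chi_eq_psum hN lam _ p.2.2.1]

end CompletedHurwitz

end

noncomputable section

namespace CompletedHurwitz

open Polynomial

/-! ### Chambers -/

/-- The value of `y_J - x_I` at an integral point. -/
def wallValue {m n : ℕ} (I : Multiset (Fin m)) (J : Multiset (Fin n)) (p : V m n) : ℤ :=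
  (J.map fun j => (p.1.2 j : ℤ)).sum - (I.map fun i => (p.1.1 i : ℤ)).sum

theorem wallValue_finset {m n : ℕ} (S : Finset (Fin m)) (T : Finset (Fin n)) (p : V m n) :
    wallValue S.val T.val p = ∑ j ∈ T, (p.1.2 j : ℤ) - ∑ i ∈ S, (p.1.1 i : ℤ) := rfl

theorem exists_finset_of_le_univ {α : Type*} [Fintype α] {I : Multiset α}
    (h : I ≤ Finset.univ.val) : ∃ S : Finset α, S.val = I :=
  ⟨⟨I, Multiset.nodup_of_le h Finset.univ.nodup⟩, rfl⟩

theorem sum_lt_sum_univ {k : ℕ} (x : Fin k → ℕ) (hx : ∀ i, 0 < x i) {S : Finset (Fin k)}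
    (hS : S ≠ Finset.univ) : ∑ i ∈ S, (x i : ℤ) < ∑ i, (x i : ℤ) := by
  refine Finset.sum_lt_sum_of_subset (Finset.subset_univ S) (i := ?_) (Finset.mem_univ _) ?_ ?_ ?_
  · exact (not_forall.mp fun h => hS (Finset.eq_univ_iff_forall.mpr h)).choose
  · exact (not_forall.mp fun h => hS (Finset.eq_univ_iff_forall.mpr h)).choose_spec
  · exact_mod_cast hx _
  · intros
    positivity

theorem sum_pos_of_nonempty {k : ℕ} (x : Fin k → ℕ) (hx : ∀ i, 0 < x i) {S : Finset (Fin k)}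
    (hS : S.Nonempty) : 0 < ∑ i ∈ S, (x i : ℤ) :=
  Finset.sum_pos (fun i _ => by exact_mod_cast hx i) hS

theorem V_sum_eq {m n : ℕ} (p : V m n) : ∑ i, (p.1.1 i : ℤ) = ∑ j, (p.1.2 j : ℤ) := by
  exact_mod_cast p.2.2.2

theorem IsChamber.subset {m n : ℕ} {c : Set ((Fin m → ℝ) × (Fin n → ℝ))} (hc : IsChamber c) :
    c ⊆ wallComplement m n := by
  obtain ⟨q, _, rfl⟩ := hc
  exact connectedComponentIn_subset _ _

theorem IsChamber.isPreconnected {m n : ℕ} {c : Set ((Fin m → ℝ) × (Fin n → ℝ))}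
    (hc : IsChamber c) : IsPreconnected c := by
  obtain ⟨q, _, rfl⟩ := hc
  exact isPreconnected_connectedComponentIn

/-- Nonempty proper `I` and `J` are excluded by the walls; if one of them is empty or full,
positivity of the entries forces the other to be the same. -/
theorem IsChamber.eq_of_wallValue_eq_zero {m n : ℕ} {c : Set ((Fin m → ℝ) × (Fin n → ℝ))}
    (hc : IsChamber c) {I : Multiset (Fin m)} {J : Multiset (Fin n)}
    (hI : I ≤ Finset.univ.val) (hJ : J ≤ Finset.univ.val) {p : V m n} (hp : toReal p ∈ c)
    (h : wallValue I J p = 0) :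
    (I = 0 ∧ J = 0) ∨ (I = Finset.univ.val ∧ J = Finset.univ.val) := by
  obtain ⟨S, rfl⟩ := exists_finset_of_le_univ hI
  obtain ⟨T, rfl⟩ := exists_finset_of_le_univ hJ
  rw [wallValue_finset] at h
  have hsum := V_sum_eq p
  have hμ := p.2.1
  have hν := p.2.2.1
  rcases S.eq_empty_or_nonempty with rfl | hS
  · rcases T.eq_empty_or_nonempty with rfl | hT
    · exact Or.inl ⟨rfl, rfl⟩
    · have := sum_pos_of_nonempty _ hν hT
      simp at h
      omega
  rcases T.eq_empty_or_nonempty with rfl | hT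
  · have := sum_pos_of_nonempty _ hμ hS
    simp at h
    omega
  by_cases hSu : S = Finset.univ
  · by_cases hTu : T = Finset.univ
    · exact Or.inr ⟨by rw [hSu], by rw [hTu]⟩
    · have := sum_lt_sum_univ _ hν hTu
      rw [hSu] at h
      omega
  by_cases hTu : T = Finset.univ
  · have := sum_lt_sum_univ _ hμ hSu
    rw [hTu] at h
    omega
  exfalso
  have hq := hc.subset hp
  refine hq.2 S T hS hSu hT hTu ⟨hq.1, ?_⟩
  have h' : ∑ i ∈ S, (p.1.1 i : ℤ) - ∑ j ∈ T, (p.1.2 j : ℤ) = 0 := by omega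
  simp only [toReal]
  exact_mod_cast h'

/-- A change of sign on the connected chamber would, by the intermediate value theorem, produce a
point on a wall. -/
theorem IsChamber.wallValue_pos {m n : ℕ} {c : Set ((Fin m → ℝ) × (Fin n → ℝ))}
    (hc : IsChamber c) {I : Multiset (Fin m)} {J : Multiset (Fin n)}
    (hI : I ≤ Finset.univ.val) (hJ : J ≤ Finset.univ.val) {p p' : V m n} (hp : toReal p ∈ c)
    (hp' : toReal p' ∈ c) (h : 0 < wallValue I J p) : 0 < wallValue I J p' := by
  obtain ⟨S, rfl⟩ := exists_finset_of_le_univ hI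
  obtain ⟨T, rfl⟩ := exists_finset_of_le_univ hJ
  rw [wallValue_finset] at h ⊢
  by_contra hle
  rw [not_lt] at hle
  have hsum := V_sum_eq p
  have hsum' := V_sum_eq p'
  -- When `S` or `T` is empty or full, positivity of the entries already rules out the sign change,
  -- so a genuine wall remains.
  have hT : T.Nonempty := by
    rw [Finset.nonempty_iff_ne_empty]
    rintro rfl
    have : 0 ≤ ∑ i ∈ S, (p.1.1 i : ℤ) := Finset.sum_nonneg fun _ _ => by positivity
    simp at h
    omega
  have hSu : S ≠ Finset.univ := by
    rintro rfl
    have : ∑ j ∈ T, (p.1.2 j : ℤ) ≤ ∑ j, (p.1.2 j : ℤ) :=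
      Finset.sum_le_sum_of_subset_of_nonneg (Finset.subset_univ T) fun _ _ _ => by positivity
    omega
  have hS : S.Nonempty := by
    rw [Finset.nonempty_iff_ne_empty]
    rintro rfl
    have := sum_pos_of_nonempty _ p'.2.2.1 hT
    simp at hle
    omega
  have hTu : T ≠ Finset.univ := by
    rintro rfl
    have := sum_lt_sum_univ _ p'.2.1 hSu
    omega
  set φ : (Fin m → ℝ) × (Fin n → ℝ) → ℝ := fun q => ∑ j ∈ T, q.2 j - ∑ i ∈ S, q.1 i with hφ
  have hcont : ContinuousOn φ c := by
    apply Continuous.continuousOn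
    fun_prop
  have h1 : φ (toReal p') ≤ 0 := by
    simp only [hφ, toReal]
    exact_mod_cast hle
  have h2 : 0 ≤ φ (toReal p) := by
    simp only [hφ, toReal]
    exact_mod_cast h.le
  obtain ⟨q, hq, hq0⟩ := hc.isPreconnected.intermediate_value hp' hp hcont ⟨h1, h2⟩
  have hqc := hc.subset hq
  refine hqc.2 S T hS hSu hT hTu ⟨hqc.1, ?_⟩
  simp only [hφ] at hq0
  linarith

/-! ### Symbolic operators -/

/-- The ring of polynomials in `μ_1, …, μ_m, ν_1, …, ν_n`. -/
abbrev Coeffs (m n : ℕ) : Type := MvPolynomial (Fin m ⊕ Fin n) ℚ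

/-- Evaluation at a point. -/
def evalAt {m n : ℕ} (p : V m n) : Coeffs m n →+* ℚ :=
  MvPolynomial.eval (Sum.elim (fun i => (p.1.1 i : ℚ)) (fun j => (p.1.2 j : ℚ)))

/-- A family of energy operators of energy `y_J - x_I`, with weight depending polynomially on the
parameters. The flag marks the Heisenberg operators. -/
structure SymOp (m n : ℕ) where
  I : Multiset (Fin m)
  J : Multiset (Fin n)
  F : (Coeffs m n)[X]
  heisenberg : Bool

namespace SymOp

variable {m n : ℕ}

/-- The energy as a linear form. -/
def lin (o : SymOp m n) : Coeffs m n :=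
  (o.J.map fun j => MvPolynomial.X (Sum.inr j)).sum -
    (o.I.map fun i => MvPolynomial.X (Sum.inl i)).sum

/-- The product of the variables involved. -/
def mono (o : SymOp m n) : Coeffs m n :=
  (o.I.map fun i => MvPolynomial.X (Sum.inl i)).prod *
    (o.J.map fun j => MvPolynomial.X (Sum.inr j)).prod

/-- The operator at a point. -/
def inst (p : V m n) (o : SymOp m n) : ℤ × ℚ[X] := (wallValue o.I o.J p, o.F.map (evalAt p))

/-- The non-central part of the commutator. -/
def comm (o o' : SymOp m n) : SymOp m n where
  I := o.I + o'.I
  J := o.J + o'.J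
  F := commWeight o.lin o'.lin o.F o'.F
  heisenberg := false

theorem evalAt_lin (p : V m n) (o : SymOp m n) :
    evalAt p o.lin = (wallValue o.I o.J p : ℚ) := by
  simp [lin, wallValue, evalAt, map_multiset_sum, Multiset.map_map, Function.comp_def]

theorem wallValue_add (I I' : Multiset (Fin m)) (J J' : Multiset (Fin n)) (p : V m n) :
    wallValue (I + I') (J + J') p = wallValue I J p + wallValue I' J' p := by
  simp only [wallValue, Multiset.map_add, Multiset.sum_add]
  ring

theorem mono_comm (o o' : SymOp m n) : (o.comm o').mono = o.mono * o'.mono := by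
  simp only [mono, comm, Multiset.map_add, Multiset.prod_add]
  ring

theorem inst_comm (p : V m n) (o o' : SymOp m n) :
    (o.comm o').inst p = commOp (o.inst p) (o'.inst p) := by
  simp only [inst, comm, commOp, wallValue_add, commWeight, Polynomial.map_sub,
    Polynomial.map_mul, Polynomial.map_comp, map_X, map_C, evalAt_lin]

/-- Heisenberg operators have weight one and carry a single variable; the weights of all other
operators are divisible by the variables involved. -/
structure Good (o : SymOp m n) : Prop where
  card_eq : o.heisenberg = true → o.I.card + o.J.card = 1
  weight_eq : o.heisenberg = true → o.F = 1
  lin_eq : o.heisenberg = true → o.lin = o.mono ∨ o.lin = -o.mono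
  dvd : o.heisenberg = false → C o.mono ∣ o.F

theorem comp_sub_C_sub_dvd (b : Coeffs m n) (H : (Coeffs m n)[X]) :
    C b ∣ H.comp (X - C b) - H := by
  have h := sub_dvd_eval_sub (X - C b) X (H.map C)
  rw [eval_map, eval_map, ← comp, ← comp, comp_X] at h
  have h2 : (X - C b : (Coeffs m n)[X]) - X = -C b := by ring
  rw [h2] at h
  obtain ⟨K, hK⟩ := h
  exact ⟨-K, by rw [hK]; ring⟩

theorem Good.mono_dvd_lin {o : SymOp m n} (ho : o.Good) (h : o.heisenberg = true) :
    o.mono ∣ o.lin := by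
  rcases ho.lin_eq h with h1 | h1
  · rw [h1]
  · exact ⟨-1, by rw [h1]; ring⟩

theorem Good.C_mono_dvd_C_lin {o : SymOp m n} (ho : o.Good) (h : o.heisenberg = true) :
    C o.mono ∣ C o.lin :=
  map_dvd C (ho.mono_dvd_lin h)

/-- Against a Heisenberg operator the commutator weight is, up to sign, a finite difference `H(X -
b) - H` with `b` the energy of that operator. It is divisible by `b`, hence by the missing variable.
Two Heisenberg operators give weight zero. -/
theorem Good.comm {o o' : SymOp m n} (ho : o.Good) (ho' : o'.Good) : (o.comm o').Good where
  card_eq h := by simp [SymOp.comm] at h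
  weight_eq h := by simp [SymOp.comm] at h
  lin_eq h := by simp [SymOp.comm] at h
  dvd _ := by
    rw [mono_comm, C_mul]
    simp only [SymOp.comm, commWeight]
    rcases hb : o.heisenberg with _ | _ <;> rcases hb' : o'.heisenberg with _ | _
    · obtain ⟨H, hH⟩ := ho.dvd hb
      obtain ⟨H', hH'⟩ := ho'.dvd hb'
      rw [hH, hH']
      refine ⟨H * H'.comp (X - C o.lin) - H' * H.comp (X - C o'.lin), ?_⟩
      simp only [mul_comp, C_comp]
      ring
    · obtain ⟨H, hH⟩ := ho.dvd hb
      rw [ho'.weight_eq hb', hH]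
      obtain ⟨K, hK⟩ := (ho'.C_mono_dvd_C_lin hb').trans (comp_sub_C_sub_dvd o'.lin H)
      refine ⟨-K, ?_⟩
      simp only [mul_comp, C_comp, one_comp]
      linear_combination -C o.mono * hK
    · obtain ⟨H', hH'⟩ := ho'.dvd hb'
      rw [ho.weight_eq hb, hH']
      obtain ⟨K, hK⟩ := (ho.C_mono_dvd_C_lin hb).trans (comp_sub_C_sub_dvd o.lin H')
      refine ⟨K, ?_⟩
      simp only [mul_comp, C_comp, one_comp]
      linear_combination C o'.mono * hK
    · rw [ho.weight_eq hb, ho'.weight_eq hb']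
      simp

end SymOp

/-! ### Polynomial summation -/

/-- The explicit factor `k`, the absence of a constant term, is what later provides divisibility by
the variables. -/
theorem exists_faulhaber (i : ℕ) : ∃ T : ℚ[X], ∀ k : ℕ,
    ∑ j ∈ Finset.range k, (j : ℚ) ^ i = (k : ℚ) * T.eval (k : ℚ) := by
  refine ⟨∑ l ∈ Finset.range (i + 1), C (_root_.bernoulli l * ((i + 1).choose l) / (i + 1)) *
    X ^ (i - l), fun k => ?_⟩
  rw [sum_range_pow, eval_finsetSum, Finset.mul_sum]
  refine Finset.sum_congr rfl fun l hl => ?_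
  have hl' : l ≤ i := by
    rw [Finset.mem_range] at hl
    omega
  rw [eval_mul, eval_C, eval_pow, eval_X, show i + 1 - l = (i - l) + 1 by omega, pow_succ]
  ring

/-- Faulhaber coefficientwise, with a single `Q` valid at all evaluation points at once: the upper
limit of summation is itself a polynomial in the parameters. -/
theorem exists_sum_eval {K : Type*} [CommRing K] [Algebra ℚ K] (G : K[X]) (b : K) :
    ∃ Q : K, ∀ (e : K →+* ℚ) (k : ℕ), e b = k →
      ∑ j ∈ Finset.range k, (G.map e).eval (j : ℚ) = e (b * Q) := by
  choose T hT using exists_faulhaber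
  refine ⟨∑ i ∈ Finset.range (G.natDegree + 1), G.coeff i * aeval b (T i), fun e k hk => ?_⟩
  have h1 : ∀ j : ℕ, (G.map e).eval (j : ℚ) =
      ∑ i ∈ Finset.range (G.natDegree + 1), e (G.coeff i) * (j : ℚ) ^ i := by
    intro j
    rw [eval_map, eval₂_eq_sum_range]
  simp_rw [h1]
  rw [Finset.sum_comm, map_mul, map_sum, hk, Finset.mul_sum]
  refine Finset.sum_congr rfl fun i _ => ?_
  have h2 : e (aeval b (T i)) = (T i).eval (k : ℚ) := by
    have h3 : e.comp (algebraMap ℚ K) = RingHom.id ℚ := Subsingleton.elim _ _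
    rw [aeval_def, hom_eval₂, h3, hk]
    exact eval₂_id
  rw [← Finset.mul_sum, hT, map_mul, h2]
  ring

end CompletedHurwitz

end

noncomputable section

namespace CompletedHurwitz

open Polynomial

/-! ### Sums over modified lists -/

theorem sum_map_set_add {α M : Type*} [AddCommMonoid M] (f : α → M) (L : List α) (t : ℕ)
    (ht : t < L.length) (x : α) :
    ((L.set t x).map f).sum + f L[t] = (L.map f).sum + f x := by
  induction L generalizing t with
  | nil => simp at ht
  | cons a L ih =>
    cases t with
    | zero => simp; abel
    | succ t =>
      have := ih t (by simpa using ht)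
      simp only [List.set_cons_succ, List.map_cons, List.sum_cons, List.getElem_cons_succ]
      rw [add_assoc, this, add_assoc]

theorem sum_map_eraseIdx_add {α M : Type*} [AddCommMonoid M] (f : α → M) (L : List α) (t : ℕ)
    (ht : t < L.length) :
    ((L.eraseIdx t).map f).sum + f L[t] = (L.map f).sum := by
  induction L generalizing t with
  | nil => simp at ht
  | cons a L ih =>
    cases t with
    | zero => simp; abel
    | succ t =>
      have := ih t (by simpa using ht)
      simp only [List.eraseIdx_cons_succ, List.map_cons, List.sum_cons, List.getElem_cons_succ]
      rw [add_assoc, this]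

namespace SymOp

variable {m n : ℕ}

/-! ### Vacuum expectations of symbolic operators on a chamber -/

theorem vev_inst_append_of_pos (N : ℕ) (p : V m n) (L : List (SymOp m n)) (o : SymOp m n)
    (ho : 0 < wallValue o.I o.J p) (hN : absEnergy ((L ++ [o]).map (inst p)) ≤ N) :
    vev N ((L ++ [o]).map (inst p)) = ∑ t : Fin L.length,
      (vev N ((L.set t (L[t].comm o)).map (inst p)) +
        central (L[t].inst p) (o.inst p) * vev N ((L.eraseIdx t).map (inst p))) := by
  have hN' : absEnergy (L.map (inst p)) + (o.inst p).1 ≤ N := by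
    have h : |(o.inst p).1| = (o.inst p).1 := abs_of_pos ho
    rw [← h]
    simpa [absEnergy] using hN
  rw [List.map_append, List.map_singleton, vev_append_of_pos N _ _ ho hN']
  refine Fintype.sum_equiv (finCongr (by simp)) _ _ fun t => ?_
  have hget : (L.map (inst p))[t] = (L[(t : ℕ)]'(by simpa using t.2)).inst p :=
    List.getElem_map _
  rw [hget, ← inst_comm, ← List.map_set, List.eraseIdx_map]
  rfl

/-- By the triangle inequality, an `N` large enough for the original product stays large enough
throughout the recursion. -/
theorem absEnergy_inst_set_comm_le (p : V m n) (L : List (SymOp m n)) (o : SymOp m n)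
    (t : Fin L.length) :
    absEnergy ((L.set t (L[t].comm o)).map (inst p)) ≤ absEnergy ((L ++ [o]).map (inst p)) := by
  have h := sum_map_set_add (fun o : SymOp m n => |wallValue o.I o.J p|) L t t.2 (L[t].comm o)
  have h2 := abs_add_le (wallValue L[t].I L[t].J p) (wallValue o.I o.J p)
  rw [← wallValue_add] at h2
  simp only [absEnergy, List.map_map, Function.comp_def, inst, List.map_append, List.sum_append,
    List.map_singleton, List.sum_singleton, comm, Fin.getElem_fin] at h h2 ⊢
  linarith

theorem wallValue_univ (p : V m n) : wallValue Finset.univ.val Finset.univ.val p = 0 := by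
  rw [wallValue_finset, V_sum_eq, sub_self]

theorem central_inst (p : V m n) {o o' : SymOp m n} (ho : 0 < wallValue o'.I o'.J p)
    (h : wallValue o.I o.J p + wallValue o'.I o'.J p = 0) :
    central (o.inst p) (o'.inst p) = ∑ k ∈ Finset.range (wallValue o'.I o'.J p).toNat,
      ((o'.F * o.F.comp (X - C o'.lin)).map (evalAt p)).eval (k : ℚ) := by
  have hIco : Finset.Ico (0 : ℤ) (wallValue o'.I o'.J p) =
      (Finset.range (wallValue o'.I o'.J p).toNat).map Nat.castEmbedding := by
    ext k
    simp only [Finset.mem_Ico, Finset.mem_map, Finset.mem_range, Nat.castEmbedding_apply]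
    constructor
    · rintro ⟨h1, h2⟩
      exact ⟨k.toNat, by omega, by omega⟩
    · rintro ⟨j, h1, rfl⟩
      omega
  have h' : (o.inst p).1 + (o'.inst p).1 = 0 := h
  rw [central, if_pos h']
  change ∑ k ∈ Finset.Ico (0 : ℤ) (wallValue o'.I o'.J p), _ = _
  rw [hIco, Finset.sum_map]
  refine Finset.sum_congr rfl fun k _ => ?_
  simp [Polynomial.map_mul, Polynomial.map_comp, evalAt_lin, inst]

theorem exists_central_of_eq_C_mul {o o' : SymOp m n} {c b : Coeffs m n} {G : (Coeffs m n)[X]}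
    (hI : o.I + o'.I = Finset.univ.val) (hJ : o.J + o'.J = Finset.univ.val)
    (hG : o'.F * o.F.comp (X - C o'.lin) = C c * G)
    (hb : ∀ p, evalAt p b = (wallValue o'.I o'.J p : ℚ)) (hdvd : o.mono * o'.mono ∣ c * b) :
    ∃ Q : Coeffs m n, ∀ p : V m n, 0 < wallValue o'.I o'.J p →
      central (o.inst p) (o'.inst p) = evalAt p (o.mono * o'.mono * Q) := by
  obtain ⟨K, hK⟩ := hdvd
  obtain ⟨Q, hQ⟩ := exists_sum_eval G b
  refine ⟨K * Q, fun p hp => ?_⟩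
  have h0 : wallValue o.I o.J p + wallValue o'.I o'.J p = 0 := by
    rw [← wallValue_add, hI, hJ, wallValue_univ]
  have h1 : evalAt p b = ((wallValue o'.I o'.J p).toNat : ℚ) := by
    rw [hb]
    exact_mod_cast (Int.toNat_of_nonneg hp.le).symm
  have h2 := hQ (evalAt p) _ h1
  rw [central_inst p hp h0, hG, ← mul_assoc, ← hK]
  simp only [Polynomial.map_mul, map_C, eval_mul, eval_C]
  rw [← Finset.mul_sum, h2, mul_assoc, ← map_mul]

/-- A non-Heisenberg weight contributes its own variables. If the other operator is Heisenberg, its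
single variable comes from the factor `b` of the summation formula. Two Heisenberg operators would
have only this one factor for two variables. -/
theorem exists_central {o o' : SymOp m n} (ho : o.Good) (ho' : o'.Good)
    (hI : o.I + o'.I = Finset.univ.val) (hJ : o.J + o'.J = Finset.univ.val)
    (hflag : o.heisenberg = false ∨ o'.heisenberg = false) :
    ∃ Q : Coeffs m n, ∀ p : V m n, 0 < wallValue o'.I o'.J p →
      central (o.inst p) (o'.inst p) = evalAt p (o.mono * o'.mono * Q) := by
  rcases hb : o.heisenberg with _ | _
  · obtain ⟨H, hH⟩ := ho.dvd hb
    rcases hb' : o'.heisenberg with _ | _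
    · obtain ⟨H', hH'⟩ := ho'.dvd hb'
      refine exists_central_of_eq_C_mul hI hJ (c := o.mono * o'.mono)
        (G := H' * H.comp (X - C o'.lin)) ?_ (fun p => evalAt_lin p o') (dvd_mul_right _ _)
      rw [hH, hH', mul_comp, C_comp, C_mul]
      ring
    · refine exists_central_of_eq_C_mul hI hJ (c := o.mono)
        (G := H.comp (X - C o'.lin)) ?_ (fun p => evalAt_lin p o')
        (mul_dvd_mul_left _ (ho'.mono_dvd_lin hb'))
      rw [hH, ho'.weight_eq hb', mul_comp, C_comp, one_mul]
  · have hb' : o'.heisenberg = false := by simpa [hb] using hflag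
    -- As the total energy is zero, the upper limit may be written `-o.lin`, which exhibits the
    -- variable of the Heisenberg operator `o`.
    obtain ⟨H', hH'⟩ := ho'.dvd hb'
    refine exists_central_of_eq_C_mul hI hJ (c := o'.mono) (b := -o.lin) (G := H') ?_ ?_ ?_
    · rw [hH', ho.weight_eq hb, one_comp, mul_one]
    · intro p
      have h0 : wallValue o.I o.J p + wallValue o'.I o'.J p = 0 := by
        rw [← wallValue_add, hI, hJ, wallValue_univ]
      rw [map_neg, evalAt_lin, neg_eq_of_add_eq_zero_right]
      exact_mod_cast h0
    · rw [mul_comm]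
      exact mul_dvd_mul_left _ ((dvd_neg).mpr (ho.mono_dvd_lin hb))

/-- The product of all variables. -/
def monoAll (m n : ℕ) : Coeffs m n :=
  ((Finset.univ.val : Multiset (Fin m)).map fun i => MvPolynomial.X (Sum.inl i)).prod *
    ((Finset.univ.val : Multiset (Fin n)).map fun j => MvPolynomial.X (Sum.inr j)).prod

theorem mono_mul_mono {o o' : SymOp m n} (hI : o.I + o'.I = Finset.univ.val)
    (hJ : o.J + o'.J = Finset.univ.val) : o.mono * o'.mono = monoAll m n := by
  rw [← mono_comm]
  simp only [mono, comm, hI, hJ, monoAll]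

theorem Good.eq_one_of_heisenberg {o o' : SymOp m n} (ho : o.Good) (ho' : o'.Good)
    (hI : o.I + o'.I = Finset.univ.val) (hJ : o.J + o'.J = Finset.univ.val)
    (hm : 0 < m) (hn : 0 < n) (hb : o.heisenberg = true) (hb' : o'.heisenberg = true) :
    m = 1 ∧ n = 1 := by
  have h1 := congrArg Multiset.card hI
  have h2 := congrArg Multiset.card hJ
  have h3 := ho.card_eq hb
  have h4 := ho'.card_eq hb'
  simp at h1 h2
  omega

theorem le_sum_map {α β : Type*} (f : α → Multiset β) {L : List α} {x : α} (hx : x ∈ L) :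
    f x ≤ (L.map f).sum := by
  induction L with
  | nil => simp at hx
  | cons a L ih =>
    rw [List.map_cons, List.sum_cons]
    rcases List.mem_cons.mp hx with rfl | h
    · exact Multiset.le_add_right _ _
    · exact (ih h).trans (Multiset.le_add_left _ _)

/-- The central contribution of the commutator of the last operator with another one. -/
theorem exists_central_mul_vev {c : Set ((Fin m → ℝ) × (Fin n → ℝ))} (hc : IsChamber c)
    (hm : 0 < m) (hn : 0 < n) {L : List (SymOp m n)} {o : SymOp m n}
    (hL : ∀ x ∈ L, x.Good) (ho : o.Good)
    (hI : (L.map SymOp.I).sum + o.I = Finset.univ.val)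
    (hJ : (L.map SymOp.J).sum + o.J = Finset.univ.val)
    (hflag : (∃ x ∈ L ++ [o], x.heisenberg = false) ∨ ¬ (m = 1 ∧ n = 1))
    (hpos : ∀ p : V m n, toReal p ∈ c → 0 < wallValue o.I o.J p) (t : Fin L.length) :
    ∃ Q : Coeffs m n, ∀ p : V m n, toReal p ∈ c → ∀ N : ℕ,
      central (L[t].inst p) (o.inst p) * vev N ((L.eraseIdx t).map (inst p)) =
        evalAt p (monoAll m n * Q) := by
  have eI := sum_map_eraseIdx_add SymOp.I L t t.2
  have eJ := sum_map_eraseIdx_add SymOp.J L t t.2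
  -- If the combined energy vanishes nowhere on the chamber, the central term is zero throughout.
  by_cases hz : ∃ p : V m n, toReal p ∈ c ∧
      wallValue (L[t].I + o.I) (L[t].J + o.J) p = 0
  swap
  · refine ⟨0, fun p hp N => ?_⟩
    have : ¬ ((L[t].inst p).1 + (o.inst p).1 = 0) := fun h =>
      hz ⟨p, hp, by rw [wallValue_add]; exact h⟩
    rw [central, if_neg this]
    simp
  obtain ⟨q, hq, hq0⟩ := hz
  have hIle : L[t].I + o.I ≤ Finset.univ.val := by
    rw [← hI]
    exact add_le_add_left (le_sum_map _ (List.getElem_mem t.2)) _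
  have hJle : L[t].J + o.J ≤ Finset.univ.val := by
    rw [← hJ]
    exact add_le_add_left (le_sum_map _ (List.getElem_mem t.2)) _
  -- The pair carries no variables, contradicting the positive energy of `o`, or all of them, so
  -- that the other operators carry none.
  obtain ⟨h1, h2⟩ | ⟨hI2, hJ2⟩ := hc.eq_of_wallValue_eq_zero hIle hJle hq hq0
  · have := hpos q hq
    rw [add_eq_zero] at h1 h2
    rw [h1.2, h2.2] at this
    simp [wallValue] at this
  have hI0 : ((L.eraseIdx t).map SymOp.I).sum = 0 := by
    rw [← eI, add_assoc] at hI
    exact add_eq_right.mp (hI.trans hI2.symm)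
  have hJ0 : ((L.eraseIdx t).map SymOp.J).sum = 0 := by
    rw [← eJ, add_assoc] at hJ
    exact add_eq_right.mp (hJ.trans hJ2.symm)
  -- If other operators remain, the last of them has energy zero and kills the vacuum; so only the
  -- empty remainder matters.
  rcases List.eq_nil_or_concat' (L.eraseIdx t) with hnil | ⟨L', o', hL'⟩
  · have hlen : L.length = 1 := by
      have h1 := congrArg List.length hnil
      rw [List.length_eraseIdx_of_lt t.2] at h1
      have := t.2
      simp at h1
      omega
    obtain ⟨a, rfl⟩ := List.length_eq_one_iff.mp hlen
    have hat : [a][t] = a := by simp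
    rw [hat] at hI2 hJ2 ⊢
    have hag : a.Good := hL a (by simp)
    have hor : a.heisenberg = false ∨ o.heisenberg = false := by
      rcases hflag with ⟨x, hx, hxf⟩ | h
      · simp only [List.singleton_append, List.mem_cons, List.not_mem_nil, or_false] at hx
        rcases hx with rfl | rfl
        · exact Or.inl hxf
        · exact Or.inr hxf
      · by_contra hcon
        simp only [not_or, Bool.not_eq_false] at hcon
        exact h (hag.eq_one_of_heisenberg ho hI2 hJ2 hm hn hcon.1 hcon.2)
    obtain ⟨Q, hQ⟩ := exists_central hag ho hI2 hJ2 hor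
    refine ⟨Q, fun p hp N => ?_⟩
    rw [hnil, List.map_nil, vev_nil, mul_one, hQ p (hpos p hp), mono_mul_mono hI2 hJ2]
  · refine ⟨0, fun p hp N => ?_⟩
    have hI' : o'.I = 0 := by
      rw [hL'] at hI0
      simp only [List.map_append, List.sum_append, List.map_singleton, List.sum_singleton,
        add_eq_zero] at hI0
      exact hI0.2
    have hJ' : o'.J = 0 := by
      rw [hL'] at hJ0
      simp only [List.map_append, List.sum_append, List.map_singleton, List.sum_singleton,
        add_eq_zero] at hJ0
      exact hJ0.2
    rw [hL', List.map_append, List.map_singleton, vev_append_of_nonpos]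
    · simp
    · simp [inst, hI', hJ', wallValue]

/-- On a chamber, vacuum expectations of good families are polynomials divisible by all
variables. -/
theorem exists_vev_eq {c : Set ((Fin m → ℝ) × (Fin n → ℝ))} (hc : IsChamber c)
    (hm : 0 < m) (hn : 0 < n) (k : ℕ) (L : List (SymOp m n)) (hk : L.length = k)
    (hL : ∀ x ∈ L, x.Good)
    (hI : (L.map SymOp.I).sum = Finset.univ.val) (hJ : (L.map SymOp.J).sum = Finset.univ.val)
    (hflag : (∃ x ∈ L, x.heisenberg = false) ∨ ¬ (m = 1 ∧ n = 1)) :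
    ∃ Q : Coeffs m n, ∀ p : V m n, toReal p ∈ c → ∀ N : ℕ,
      absEnergy (L.map (inst p)) ≤ N →
        vev N (L.map (inst p)) = evalAt p (monoAll m n * Q) := by
  induction k generalizing L with
  | zero =>
    rw [List.length_eq_zero_iff] at hk
    subst hk
    have := congrArg Multiset.card hI
    simp at this
    omega
  | succ k ih =>
    obtain rfl | ⟨L, o, rfl⟩ := List.eq_nil_or_concat' L
    · simp at hk
    have ho : o.Good := hL o (by simp)
    have hL' : ∀ x ∈ L, x.Good := fun x hx => hL x (by simp [hx])
    simp only [List.map_append, List.sum_append, List.map_singleton, List.sum_singleton]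
      at hI hJ
    have hIle : o.I ≤ Finset.univ.val := by
      rw [← hI]
      exact Multiset.le_add_left _ _
    have hJle : o.J ≤ Finset.univ.val := by
      rw [← hJ]
      exact Multiset.le_add_left _ _
    -- The sign of the last energy is constant on the chamber, so the case distinction is uniform in
    -- `p`.
    by_cases hex : ∃ q : V m n, toReal q ∈ c ∧ 0 < wallValue o.I o.J q
    swap
    · refine ⟨0, fun p hp N _ => ?_⟩
      rw [List.map_append, List.map_singleton, vev_append_of_nonpos]
      · simp
      · exact not_lt.mp fun h => hex ⟨p, hp, h⟩
    obtain ⟨q, hq, hq0⟩ := hex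
    have hpos : ∀ p : V m n, toReal p ∈ c → 0 < wallValue o.I o.J p := fun p hp =>
      hc.wallValue_pos hIle hJle hq hp hq0
    have hset : ∀ t : Fin L.length, ∃ Q : Coeffs m n, ∀ p : V m n, toReal p ∈ c → ∀ N : ℕ,
        absEnergy ((L.set t (L[t].comm o)).map (inst p)) ≤ N →
          vev N ((L.set t (L[t].comm o)).map (inst p)) = evalAt p (monoAll m n * Q) := by
      intro t
      refine ih (L.set t (L[t].comm o)) (by simpa using hk) ?_ ?_ ?_ ?_
      · intro x hx
        rcases List.mem_or_eq_of_mem_set hx with h | rfl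
        · exact hL' x h
        · exact (hL' _ (List.getElem_mem t.2)).comm ho
      · have h := sum_map_set_add SymOp.I L t t.2 (L[t].comm o)
        have h2 : (L[t].comm o).I = o.I + L[t].I := add_comm _ _
        rw [h2, ← add_assoc, hI] at h
        exact add_right_cancel h
      · have h := sum_map_set_add SymOp.J L t t.2 (L[t].comm o)
        have h2 : (L[t].comm o).J = o.J + L[t].J := add_comm _ _
        rw [h2, ← add_assoc, hJ] at h
        exact add_right_cancel h
      -- A commutator is never flagged as Heisenberg, so after one step the exceptional case cannot
      -- occur.
      · exact Or.inl ⟨_, List.mem_set t.2 _, rfl⟩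
    choose Q hQ using hset
    choose R hR using exists_central_mul_vev hc hm hn hL' ho hI hJ hflag hpos
    refine ⟨∑ t, (Q t + R t), fun p hp N hN => ?_⟩
    rw [vev_inst_append_of_pos N p L o (hpos p hp) hN, Finset.mul_sum, map_sum]
    refine Finset.sum_congr rfl fun t _ => ?_
    rw [hQ t p hp N ((absEnergy_inst_set_comm_le p L o t).trans hN), hR t p hp N, mul_add,
      map_add]

/-! ### The operators of the double Hurwitz number -/

/-- The adjoint of the `i`-th creation operator. -/
def lower (i : Fin m) : SymOp m n := ⟨{i}, 0, 1, true⟩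

/-- The `j`-th creation operator. -/
def raise (j : Fin n) : SymOp m n := ⟨0, {j}, 1, true⟩

/-- The operator of a completed `(r + 1)`-cycle. -/
def cycle (m n r : ℕ) : SymOp m n := ⟨0, 0, (cyclePoly r).map MvPolynomial.C, false⟩

theorem good_lower (i : Fin m) : (lower i : SymOp m n).Good where
  card_eq _ := by simp [lower]
  weight_eq _ := rfl
  lin_eq _ := Or.inr (by simp [lin, mono, lower])
  dvd h := by simp [lower] at h

theorem good_raise (j : Fin n) : (raise j : SymOp m n).Good where
  card_eq _ := by simp [raise]
  weight_eq _ := rfl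
  lin_eq _ := Or.inl (by simp [lin, mono, raise])
  dvd h := by simp [raise] at h

theorem good_cycle (r : ℕ) : (cycle m n r).Good where
  card_eq h := by simp [cycle] at h
  weight_eq h := by simp [cycle] at h
  lin_eq h := by simp [cycle] at h
  dvd _ := by simp [cycle, mono]

/-- The operators whose vacuum expectation is the Hurwitz number. -/
def hurwitzOps (m n r s : ℕ) : List (SymOp m n) :=
  List.ofFn lower ++ (List.replicate s (cycle m n r) ++ List.ofFn raise)

theorem map_inst_hurwitzOps (r s : ℕ) (p : V m n) :
    (hurwitzOps m n r s).map (inst p) =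
      lowers p.1.1 ++ (List.replicate s (0, cyclePoly r) ++ raises p.1.2) := by
  have h : (cycle m n r).inst p = (0, cyclePoly r) := by
    have h1 : (evalAt p).comp MvPolynomial.C = RingHom.id ℚ := Subsingleton.elim _ _
    simp [inst, cycle, wallValue, Polynomial.map_map, h1]
  simp only [hurwitzOps, List.map_append, List.map_ofFn, List.map_replicate, h, lowers, raises]
  simp [Function.comp_def, inst, lower, raise, wallValue]

theorem good_of_mem_hurwitzOps {r s : ℕ} {o : SymOp m n} (ho : o ∈ hurwitzOps m n r s) :
    o.Good := by
  simp only [hurwitzOps, List.mem_append, List.mem_ofFn', Set.mem_range, List.mem_replicate] at ho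
  rcases ho with ⟨i, rfl⟩ | ⟨_, rfl⟩ | ⟨j, rfl⟩
  · exact good_lower i
  · exact good_cycle r
  · exact good_raise j

theorem sum_I_hurwitzOps (m n r s : ℕ) :
    ((hurwitzOps m n r s).map SymOp.I).sum = Finset.univ.val := by
  simp [hurwitzOps, List.map_ofFn, Function.comp_def, lower, raise, cycle, List.sum_ofFn,
    Finset.sum_multiset_singleton]

theorem sum_J_hurwitzOps (m n r s : ℕ) :
    ((hurwitzOps m n r s).map SymOp.J).sum = Finset.univ.val := by
  simp [hurwitzOps, List.map_ofFn, Function.comp_def, lower, raise, cycle, List.sum_ofFn,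
    Finset.sum_multiset_singleton]

theorem absEnergy_hurwitzOps (r s : ℕ) (p : V m n) :
    absEnergy ((hurwitzOps m n r s).map (inst p)) =
      (((∑ i, p.1.1 i) + ∑ i, p.1.1 i : ℕ) : ℤ) := by
  have h := V_sum_eq p
  rw [map_inst_hurwitzOps]
  simp [absEnergy, lowers, raises, List.map_ofFn, Function.comp_def, List.sum_ofFn, h]

theorem evalAt_monoAll (p : V m n) :
    evalAt p (monoAll m n) = (∏ i, (p.1.1 i : ℚ)) * ∏ j, (p.1.2 j : ℚ) := by
  have h : monoAll m n =
      (∏ i, MvPolynomial.X (Sum.inl i)) * ∏ j, MvPolynomial.X (Sum.inr j) := rfl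
  simp [h, evalAt]

end SymOp

end CompletedHurwitz

end

/-! ### Piecewise polynomiality -/

theorem theorem6p3 (m n r s : ℕ) (hm : 0 < m) (hn : 0 < n)
    (hs : ¬ (s = 0 ∧ m = 1 ∧ n = 1)) :
    CompletedHurwitz.IsPiecewisePolynomial
      (fun p : CompletedHurwitz.V m n => CompletedHurwitz.hurwitz r s p) := by
  open CompletedHurwitz SymOp in
  intro c hc
  have hflag : (∃ x ∈ hurwitzOps m n r s, x.heisenberg = false) ∨ ¬ (m = 1 ∧ n = 1) := by
    by_cases h : s = 0
    · exact Or.inr fun h' => hs ⟨h, h'⟩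
    · exact Or.inl ⟨cycle m n r, by simp [hurwitzOps, h], rfl⟩
  obtain ⟨Q, hQ⟩ := exists_vev_eq hc hm hn _ (hurwitzOps m n r s) rfl
    (fun _ => good_of_mem_hurwitzOps) (sum_I_hurwitzOps m n r s) (sum_J_hurwitzOps m n r s) hflag
  refine ⟨Q, fun p hp => ?_⟩
  -- Here `N` is `2d`, the total absolute energy of the product, which is also enough for the
  -- Frobenius formula.
  have h := hQ p hp _ (absEnergy_hurwitzOps r s p).le
  have h1 : (∏ i, (p.1.1 i : ℚ)) ≠ 0 :=
    Finset.prod_ne_zero_iff.mpr fun i _ => by exact_mod_cast (p.2.1 i).ne'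
  have h2 : (∏ j, (p.1.2 j : ℚ)) ≠ 0 :=
    Finset.prod_ne_zero_iff.mpr fun j _ => by exact_mod_cast (p.2.2.1 j).ne'
  change hurwitz r s p = evalAt p Q
  -- The factor `monoAll` evaluates to the denominator of the prefactor, so `Q` itself is the
  -- polynomial on the chamber.
  rw [hurwitz_eq_vev r s p le_rfl, ← map_inst_hurwitzOps, h, map_mul, evalAt_monoAll]
  field_simp
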